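/- An instance $I$ of Survivable Source Location with Flow-Cost Bounds consists of a finite directed or undirected graph $G=(V,E)$ (parallel edges allowed) with node-costs $c_v$, edge-costs $c_e$, connectivity demands $d_v$, flow-cost bounds $b_v$, node-capacities $q_v$ and flow-supplies $p_v$, all nonnegative integers, where $1 \le q_v \le p_v \le k$ for all $v\in V$ and $k=\max_{v\in V} d_v$. For $S\subseteq V$, $v\in V$ and $F\subseteq E$ let $\lambda^{p,q}_{(V,F)}(S,v)$ be the maximum value of an integral flow from $s$ to $v$ in the network obtained from $(V,F)$ by adding a new node $s$ joined to every $u\in S$ by $p_u$ edges, where every edge has capacity $1$ and every node $u\notin\{s,v\}$ has capacity $q_u$. Let $\mu_G(S,v)$ be the minimum of $\sum_{e\in F}c_e$ over all $F\subseteq E$ with $\lambda^{p,q}_{(V,F)}(S,v)\ge d_v$, and $\mu_G(S,v)=\infty$ if there is no such $F$. A set $S\subseteq V$ is feasible if $\lambda^{p,q}_G(S,v)\ge d_v$ and $\mu_G(S,v)\le b_v$ for every $v\in V$; its cost is $\sum_{v\in S}c_v$. Theorem. SSL with Flow-Cost Bounds admits approximation ratio $H(d(V))+H(c(E))$, where $H(j)=\sum_{i=1}^{j}1/i$,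 $d(V)=\sum_{v\in V}d_v$ and $c(E)=\sum_{e\in E}c_e$. That is, there is an algorithm that runs in time polynomial in the length of the (binary encoded) instance and that computes, for every instance that has a feasible set, a feasible set whose cost is at most $H(d(V))+H(c(E))$ times the minimum cost of a feasible set. -/

import Mathlib

namespace SSL

/-- An instance of Survivable Source Location with Flow-Cost Bounds. The graph has nodes `Fin n`
and edges `Fin m`; parallel edges are allowed; it is directed or undirected according to `directed`
(in the undirected case `src e` and `tgt e` are the two ends of `e`, in any order).
All numbers are nonnegative integers, and `1 ≤ q u ≤ p u ≤ k`, with `k` the maximum demand. -/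
structure Instance where
  n : ℕ
  m : ℕ
  directed : Bool
  src : Fin m → Fin n
  tgt : Fin m → Fin n
  /-- node-costs `c_v` -/
  nodeCost : Fin n → ℕ
  /-- connectivity demands `d_v` -/
  demand : Fin n → ℕ
  /-- node-capacities `q_v` -/
  q : Fin n → ℕ
  /-- flow-supplies `p_v` -/
  p : Fin n → ℕ
  /-- edge-costs `c_e` -/
  edgeCost : Fin m → ℕ
  /-- flow-cost bounds `b_v` -/
  bound : Fin n → ℕ
  one_le_q : ∀ u, 1 ≤ q u
  q_le_p : ∀ u, q u ≤ p u
  p_le_k : ∀ u, p u ≤ Finset.univ.sup demand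

namespace Instance

variable (I : Instance)

/-- Flow entering `u` when every edge `e` carries `fwd e` from `src e` to `tgt e` and `bwd e` from
`tgt e` to `src e`. -/
def inflow (fwd bwd : Fin I.m → ℕ) (u : Fin I.n) : ℕ :=
  ∑ e, ((if I.tgt e = u then fwd e else 0) + (if I.src e = u then bwd e else 0))

/-- Flow leaving `u`. -/
def outflow (fwd bwd : Fin I.m → ℕ) (u : Fin I.n) : ℕ :=
  ∑ e, ((if I.src e = u then fwd e else 0) + (if I.tgt e = u then bwd e else 0))

/-- Integral flows from `s` to `v` in the network obtained from the subgraph with edge set `F` by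
adding a new node `s` joined to every `u ∈ S` by `p u` edges. Every edge has capacity `1`, every
node `u ≠ s, v` has capacity `q u`, and `supply u` is the number of used edges from `s` to `u`. -/
structure IsFlow (F : Finset (Fin I.m)) (S : Finset (Fin I.n)) (v : Fin I.n)
    (fwd bwd : Fin I.m → ℕ) (supply : Fin I.n → ℕ) : Prop where
  edge_cap : ∀ e ∈ F, fwd e + bwd e ≤ 1
  edge_support : ∀ e ∉ F, fwd e = 0 ∧ bwd e = 0
  direction : I.directed = true → ∀ e, bwd e = 0
  supply_cap : ∀ u ∈ S, supply u ≤ I.p u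
  supply_support : ∀ u ∉ S, supply u = 0
  conservation : ∀ u, u ≠ v → supply u + I.inflow fwd bwd u = I.outflow fwd bwd u
  node_cap : ∀ u, u ≠ v → supply u + I.inflow fwd bwd u ≤ I.q u

/-- The values of the flows above, that is, of the net flow into `v`. -/
def flowValues (F : Finset (Fin I.m)) (S : Finset (Fin I.n)) (v : Fin I.n) : Set ℕ :=
  {k | ∃ fwd bwd supply, I.IsFlow F S v fwd bwd supply ∧
    supply v + I.inflow fwd bwd v = k + I.outflow fwd bwd v}

/-- The `(S,v)`-`(p,q)`-connectivity of the subgraph with edge set `F`: the maximum value of a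
flow (the maximum exists, see `connectivity_isGreatest`). -/
noncomputable def connectivity (F : Finset (Fin I.m)) (S : Finset (Fin I.n)) (v : Fin I.n) : ℕ :=
  sSup (I.flowValues F S v)

theorem connectivity_isGreatest (F : Finset (Fin I.m)) (S : Finset (Fin I.n)) (v : Fin I.n) :
    IsGreatest (I.flowValues F S v) (I.connectivity F S v) := by
  have hne : (I.flowValues F S v).Nonempty := by
    refine ⟨0, fun _ => 0, fun _ => 0, fun _ => 0, ⟨?_, ?_, ?_, ?_, ?_, ?_, ?_⟩, ?_⟩ <;>
      simp [inflow, outflow]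
  have hbdd : BddAbove (I.flowValues F S v) := by
    refine ⟨I.p v + ∑ _e : Fin I.m, 2, ?_⟩
    rintro k ⟨fwd, bwd, supply, h, hk⟩
    have h1 : supply v ≤ I.p v := by
      by_cases hv : v ∈ S
      · exact h.supply_cap v hv
      · simp [h.supply_support v hv]
    have h2 : I.inflow fwd bwd v ≤ ∑ _e : Fin I.m, 2 := by
      refine Finset.sum_le_sum fun e _ => ?_
      have : fwd e + bwd e ≤ 1 := by
        by_cases he : e ∈ F
        · exact h.edge_cap e he
        · have := h.edge_support e he
          omega
      split_ifs <;> omega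
    omega
  exact ⟨Nat.sSup_mem hne hbdd, fun _ hk => le_csSup hbdd hk⟩

/-- `μ(S,v)`: the minimum cost of an edge set `F` such that the `(S,v)`-`(p,q)`-connectivity of the
subgraph with edge set `F` is at least `d_v`, and `∞` if there is no such `F`. -/
noncomputable def flowCost (S : Finset (Fin I.n)) (v : Fin I.n) : ℕ∞ :=
  ⨅ F ∈ {F : Finset (Fin I.m) | I.demand v ≤ I.connectivity F S v},
    ((∑ e ∈ F, I.edgeCost e : ℕ) : ℕ∞)

/-- `S` satisfies all connectivity demands and all flow-cost bounds. -/
def Feasible (S : Finset (Fin I.n)) : Prop :=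
  (∀ v, I.demand v ≤ I.connectivity Finset.univ S v) ∧
    ∀ v, I.flowCost S v ≤ (I.bound v : ℕ∞)

/-- The cost of a set of nodes. -/
def cost (S : Finset (Fin I.n)) : ℕ := ∑ v ∈ S, I.nodeCost v

/-- The length of the instance, all numbers being written in binary. -/
def size : ℕ :=
  I.n + I.m
    + ∑ v, (Nat.size (I.nodeCost v) + Nat.size (I.demand v) + Nat.size (I.q v)
        + Nat.size (I.p v) + Nat.size (I.bound v))
    + ∑ e, (Nat.size (I.src e) + Nat.size (I.tgt e) + Nat.size (I.edgeCost e))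

end Instance

/-! A random access machine with step count. The memory consists of arrays with indices in `ℕ`, each
cell holding a natural number; a program mentions only finitely many arrays (by name), the index
into an array is computed. Arithmetic is addition, truncated subtraction and halving (rounding
down), all of unit cost; there is no multiplication, so that in `t` steps the length of the numbers
grows by at most `O(t)` bits. -/

/-- The content of cell `i` of array `a` is `σ a i`. -/
abbrev Memory := ℕ → ℕ → ℕ

inductive Term where
  | const (k : ℕ)
  | get (a : ℕ) (i : Term)
  | add (x y : Term)
  | sub (x y : Term)
  | half (x : Term)

namespace Term

def eval (σ : Memory) : Term → ℕ
  | const k => k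
  | get a i => σ a (i.eval σ)
  | add x y => x.eval σ + y.eval σ
  | sub x y => x.eval σ - y.eval σ
  | half x => x.eval σ / 2

/-- The number of steps that the evaluation of a term takes. -/
def steps : Term → ℕ
  | const _ => 1
  | get _ i => i.steps + 1
  | add x y => x.steps + y.steps + 1
  | sub x y => x.steps + y.steps + 1
  | half x => x.steps + 1

end Term

inductive Program where
  | skip
  /-- write the value of `x` into the cell of array `a` whose index is the value of `i` -/
  | set (a : ℕ) (i x : Term)
  | seq (A B : Program)
  /-- run `A` if the value of `x` is nonzero, and `B` otherwise -/
  | cond (x : Term) (A B : Program)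
  /-- run `A` as long as the value of `x` is nonzero -/
  | loop (x : Term) (A : Program)

/-- `Runs A σ t τ`: the program `A`, started on memory `σ`, halts after exactly `t` steps with
memory `τ`. -/
inductive Runs : Program → Memory → ℕ → Memory → Prop where
  | skip (σ : Memory) : Runs Program.skip σ 1 σ
  | set (σ : Memory) (a : ℕ) (i x : Term) :
      Runs (Program.set a i x) σ (i.steps + x.steps + 1)
        (Function.update σ a (Function.update (σ a) (i.eval σ) (x.eval σ)))
  | seq {A B : Program} {σ τ υ : Memory} {s t : ℕ} (hA : Runs A σ s τ) (hB : Runs B τ t υ) :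
      Runs (Program.seq A B) σ (s + t) υ
  | cond_true {x : Term} {A B : Program} {σ τ : Memory} {t : ℕ} (hx : x.eval σ ≠ 0)
      (hA : Runs A σ t τ) : Runs (Program.cond x A B) σ (x.steps + 1 + t) τ
  | cond_false {x : Term} {A B : Program} {σ τ : Memory} {t : ℕ} (hx : x.eval σ = 0)
      (hB : Runs B σ t τ) : Runs (Program.cond x A B) σ (x.steps + 1 + t) τ
  | loop_done {x : Term} {A : Program} {σ : Memory} (hx : x.eval σ = 0) :
      Runs (Program.loop x A) σ (x.steps + 1) σ
  | loop_step {x : Term} {A : Program} {σ τ υ : Memory} {s t : ℕ} (hx : x.eval σ ≠ 0)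
      (hA : Runs A σ s τ) (hrest : Runs (Program.loop x A) τ t υ) :
      Runs (Program.loop x A) σ (x.steps + 1 + s + t) υ

/-- An array that holds the entries of `f` in its first cells, and `0` elsewhere. -/
def toArray {l : ℕ} (f : Fin l → ℕ) (i : ℕ) : ℕ := if h : i < l then f ⟨i, h⟩ else 0

namespace Instance

variable (I : Instance)

/-- The initial memory: the instance in arrays `0` to `8`, and `0` in every other cell. -/
def input : Memory
  | 0 => toArray ![I.n, I.m, if I.directed then 1 else 0]
  | 1 => toArray fun e => (I.src e : ℕ)
  | 2 => toArray fun e => (I.tgt e : ℕ)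
  | 3 => toArray I.edgeCost
  | 4 => toArray I.nodeCost
  | 5 => toArray I.demand
  | 6 => toArray I.q
  | 7 => toArray I.p
  | 8 => toArray I.bound
  | _ => fun _ => 0

/-- The node set that a final memory describes: all `v` whose cell in array `9` is nonzero. -/
def output (τ : Memory) : Finset (Fin I.n) := Finset.univ.filter fun v => τ 9 v ≠ 0

end Instance

/-- There is a polynomial time algorithm that finds, for every instance `I` that has a feasible
solution, a feasible solution whose cost is at most `ρ I` times the cost of any feasible solution. -/
def AdmitsApproximationRatio (ρ : Instance → ℚ) : Prop :=
  ∃ (A : Program) (P : Polynomial ℕ), ∀ I : Instance,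
    ∃ (t : ℕ) (τ : Memory), Runs A I.input t τ ∧ t ≤ P.eval I.size ∧
      ((∃ S, I.Feasible S) →
        I.Feasible (I.output τ) ∧
          ∀ S, I.Feasible S → (I.cost (I.output τ) : ℚ) ≤ ρ I * (I.cost S : ℚ))

end SSL

/-!
The algorithm is greedy covering, in the manner of Wolsey, applied to a penalized minimum cost flow.

For a node `v` and a set `S` let `val v S` be the minimum cost of sending `d_v` units from `S` to
`v`, where every unit that is not sent costs `c(E) + 1`. As a solution without missing units costs
at most `c(E)`, the set `S` is feasible if and only if `val v S ≤ min (b_v) (c(E))` for all `v`,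
that is, if and only if `gap S = ∑ v, (val v S - min (b_v) (c(E)))` vanishes (with truncated
subtraction). Here `val` is *defined* as the optimum of the dual linear program, over integral
potentials. With this definition it is immediate that `val v` is decreasing and supermodular
in `S`: the pointwise maximum and minimum of two potentials are potentials for the intersection and
the union, and the dual objective is submodular in the required sense (`dualLoss_submodular`).
Truncation preserves supermodularity of decreasing functions, so `gap` is decreasing and
supermodular (`gap_supermodular`), and the greedy rule that adds the node of least cost per unit of
gap that it closes finds a set of gap `0` whose cost is at most `H(gap ∅)` times the minimum
(`greedy_step`, `exec_greedy`). Finally `gap ∅ ≤ d(V) * (c(E) + 1)`, and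
`H(x * (y + 1)) ≤ H(x) + H(y)` (`harmonic_mul_succ_le`).

Weak duality shows that feasible sets have gap `0` (`gap_eq_zero_of_feasible`). The converse, and
the computation of `val`, rest on the primal-dual algorithm for minimum cost flows: augment along
tight paths, found by a Dijkstra-like search that raises potentials, until nothing is missing or the
potential of the sink has reached the penalty `c(E) + 1`. The flow and the potential satisfy
complementary slackness and so certify each other (`Instance.Certificate`, `exec_minCostFlow`,
`feasible_of_gap_eq_zero`). The source arcs of `v` itself are removed beforehand, so that at most
`2 * m` augmentations are needed, whatever the size of the demands.

The program is written in a small language of counted loops, `Code`, that has a total semantics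
`Code.exec`. If a code never writes to the array that holds its loop counts, its compilation to the
random access machine runs in time polynomial in these counts (`runs_compile`), and here all counts
are linear in the length of the instance. The machine cannot multiply, so products are computed by
doubling; the number of binary digits that this takes is found by the only loop that is not counted
(`runs_countDigits`).
-/

namespace SSL

/-! ### Programs with counted loops -/

/-- The memory `σ` after `x` has been written into cell `i` of array `a`. -/
def put (σ : Memory) (a i x : ℕ) : Memory :=
  Function.update σ a (Function.update (σ a) i x)

theorem put_apply (σ : Memory) (a i x b j : ℕ) :
    put σ a i x b j = if b = a ∧ j = i then x else σ b j := by
  unfold put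
  by_cases hb : b = a
  · subst hb
    by_cases hj : j = i <;> simp [hj]
  · simp [hb]

theorem put_ne {a b : ℕ} (h : b ≠ a) (σ : Memory) (i x : ℕ) : put σ a i x b = σ b := by
  simp [put, h]

theorem put_same (σ : Memory) (a i x : ℕ) :
    put σ a i x a = Function.update (σ a) i x := by
  simp [put]

/-- Programs all of whose loops are counted: `rep c b k A` runs `A` as often as cell `k` of array
`b` says, with the running index in cell `0` of array `c`. -/
inductive Code where
  | skip
  | set (a : ℕ) (i x : Term)
  | seq (A B : Code)
  | cond (x : Term) (A B : Code)
  | rep (c b k : ℕ) (A : Code)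

namespace Code

/-- The arrays that a code may write to. -/
def writes : Code → List ℕ
  | skip => []
  | set a _ _ => [a]
  | seq A B => A.writes ++ B.writes
  | cond _ A B => A.writes ++ B.writes
  | rep c _ _ A => c :: A.writes

/-- The effect of a code on the memory. -/
def exec : Code → Memory → Memory
  | skip, σ => σ
  | set a i x, σ => put σ a (i.eval σ) (x.eval σ)
  | seq A B, σ => B.exec (A.exec σ)
  | cond x A B, σ => if x.eval σ ≠ 0 then A.exec σ else B.exec σ
  | rep c b k A, σ =>
      (fun τ => put (A.exec τ) c 0 (A.exec τ c 0 + 1))^[σ b k] (put σ c 0 0)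

/-- The code as a program of the random access machine. -/
def compile : Code → Program
  | skip => .skip
  | set a i x => .set a i x
  | seq A B => .seq A.compile B.compile
  | cond x A B => .cond x A.compile B.compile
  | rep c b k A =>
      .seq (.set c (.const 0) (.const 0))
        (.loop (.sub (.get b (.const k)) (.get c (.const 0)))
          (.seq A.compile (.set c (.const 0) (.add (.get c (.const 0)) (.const 1)))))

/-- All loops read their counts from array `b`, which is never written to, and no loop body writes
to the index of its loop. -/
def wf (b : ℕ) : Code → Bool
  | skip => true
  | set a _ _ => a != b
  | seq A B => A.wf b && B.wf b
  | cond _ A B => A.wf b && B.wf b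
  | rep c b' _ A => (b' == b) && (c != b) && !(A.writes.contains c) && A.wf b

/-- A bound on the running time, in terms of a bound on all loop counts. -/
noncomputable def timePoly : Code → Polynomial ℕ
  | skip => 1
  | set _ i x => Polynomial.C (i.steps + x.steps + 1)
  | seq A B => A.timePoly + B.timePoly
  | cond x A B => Polynomial.C (x.steps + 1) + A.timePoly + B.timePoly
  -- setting up and leaving the loop takes `9` steps, testing and increasing the index `12`
  | rep _ _ _ A => 9 + Polynomial.X * (A.timePoly + 12)

/-- The frame rule: arrays that a code does not write to are unchanged. -/
theorem exec_frame (A : Code) {a : ℕ} (h : a ∉ A.writes) (σ : Memory) : A.exec σ a = σ a := by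
  induction A generalizing σ with
  | skip => rfl
  | set b i x =>
    simp only [writes, List.mem_singleton] at h
    simp [exec, put_ne h]
  | seq A B ihA ihB =>
    simp only [writes, List.mem_append, not_or] at h
    simp [exec, ihA h.1, ihB h.2]
  | cond x A B ihA ihB =>
    simp only [writes, List.mem_append, not_or] at h
    simp only [exec]
    split_ifs
    · exact ihA h.1 σ
    · exact ihB h.2 σ
  | rep c b k A ih =>
    simp only [writes, List.mem_cons, not_or] at h
    simp only [exec]
    have : ∀ (l : ℕ) (τ : Memory),
        ((fun τ => put (A.exec τ) c 0 (A.exec τ c 0 + 1))^[l] τ) a = τ a := by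
      intro l
      induction l with
      | zero => intro τ; rfl
      | succ l ihl =>
        intro τ
        rw [Function.iterate_succ_apply, ihl, put_ne h.1, ih h.2]
    rw [this, put_ne h.1]

theorem wf_frame {b : ℕ} (A : Code) (h : A.wf b = true) : b ∉ A.writes := by
  induction A with
  | skip => simp [writes]
  | set a i x =>
    have : a ≠ b := by simpa [wf] using h
    simpa [writes] using this.symm
  | seq A B ihA ihB =>
    simp only [wf, Bool.and_eq_true] at h
    simp [writes, ihA h.1, ihB h.2]
  | cond x A B ihA ihB =>
    simp only [wf, Bool.and_eq_true] at h
    simp [writes, ihA h.1, ihB h.2]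
  | rep c b' k A ih =>
    simp only [wf, Bool.and_eq_true] at h
    have : c ≠ b := by simpa using h.1.1.2
    simp [writes, ih h.2, this.symm]

/-- The induction rule for counted loops: an invariant may use that the arrays the loop does not
write to are unchanged. -/
theorem exec_rep {A : Code} {c b k : ℕ} {σ : Memory} (Inv : ℕ → Memory → Prop)
    (hc : c ∉ A.writes) (h0 : Inv 0 (put σ c 0 0))
    (hs : ∀ i τ, i < σ b k → τ c 0 = i → (∀ a, a ∉ (rep c b k A).writes → τ a = σ a) → Inv i τ →
      Inv (i + 1) (put (A.exec τ) c 0 (i + 1))) :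
    Inv (σ b k) ((rep c b k A).exec σ) := by
  have key : ∀ l ≤ σ b k,
      let τ := (fun τ => put (A.exec τ) c 0 (A.exec τ c 0 + 1))^[l] (put σ c 0 0)
      τ c 0 = l ∧ (∀ a, a ∉ (rep c b k A).writes → τ a = σ a) ∧ Inv l τ := by
    intro l
    induction l with
    | zero =>
      intro _
      refine ⟨by simp [put_apply], fun a ha => ?_, h0⟩
      simp only [writes, List.mem_cons, not_or] at ha
      exact put_ne ha.1 _ _ _
    | succ l ih =>
      intro hl
      obtain ⟨h1, h2, h3⟩ := ih (by omega)
      simp only [Function.iterate_succ_apply'] at *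
      set τ := (fun τ => put (A.exec τ) c 0 (A.exec τ c 0 + 1))^[l] (put σ c 0 0) with hτ
      have hcc : A.exec τ c 0 = l := by rw [exec_frame A hc, h1]
      rw [hcc]
      refine ⟨by simp [put_apply], fun a ha => ?_, hs l τ (by omega) h1 h2 h3⟩
      have ha' := ha
      simp only [writes, List.mem_cons, not_or] at ha'
      rw [put_ne ha'.1, exec_frame A ha'.2, h2 a ha]
  exact (key _ le_rfl).2.2

/-- A code with well-formed loops runs as `exec` says, in time polynomial in its loop counts. -/
theorem runs_compile {b B : ℕ} (A : Code) (hA : A.wf b = true) (σ : Memory)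
    (hB : ∀ k, σ b k ≤ B) :
    ∃ t ≤ A.timePoly.eval B, Runs A.compile σ t (A.exec σ) := by
  induction A generalizing σ with
  | skip => exact ⟨1, by simp [timePoly], Runs.skip σ⟩
  | set a i x => exact ⟨_, by simp [timePoly], Runs.set σ a i x⟩
  | seq A C ihA ihC =>
    simp only [wf, Bool.and_eq_true] at hA
    obtain ⟨t, ht, hr⟩ := ihA hA.1 σ hB
    obtain ⟨t', ht', hr'⟩ := ihC hA.2 (A.exec σ)
      (fun k => by rw [exec_frame A (wf_frame A hA.1)]; exact hB k)
    exact ⟨t + t', by simp only [timePoly, Polynomial.eval_add]; omega, Runs.seq hr hr'⟩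
  | cond x A C ihA ihC =>
    simp only [wf, Bool.and_eq_true] at hA
    by_cases hx : x.eval σ = 0
    · obtain ⟨t, ht, hr⟩ := ihC hA.2 σ hB
      refine ⟨_, ?_, by simpa [exec, hx, compile] using Runs.cond_false hx hr⟩
      simp only [timePoly, Polynomial.eval_add, Polynomial.eval_C]; omega
    · obtain ⟨t, ht, hr⟩ := ihA hA.1 σ hB
      refine ⟨_, ?_, by simpa [exec, hx, compile] using Runs.cond_true hx hr⟩
      simp only [timePoly, Polynomial.eval_add, Polynomial.eval_C]; omega
  | rep c b' k A ih =>
    simp only [wf, Bool.and_eq_true] at hA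
    obtain ⟨⟨⟨hbb, hcb⟩, hc⟩, hw⟩ := hA
    have hbb : b' = b := by simpa using hbb
    have hcb : c ≠ b := by simpa using hcb
    have hc : c ∉ A.writes := by simpa using hc
    subst hbb
    set T := A.timePoly.eval B with hT
    -- `l` further passes, started with index `i`
    have key : ∀ (l i : ℕ) (τ : Memory), τ c 0 = i → τ b' k = i + l → (∀ k, τ b' k ≤ B) →
        ∃ t ≤ 6 + l * (T + 12), Runs (.loop (.sub (.get b' (.const k)) (.get c (.const 0)))
          (.seq A.compile (.set c (.const 0) (.add (.get c (.const 0)) (.const 1))))) τ t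
          ((fun τ => put (A.exec τ) c 0 (A.exec τ c 0 + 1))^[l] τ) := by
      intro l
      induction l with
      | zero =>
        intro i τ h1 h2 _
        exact ⟨_, by simp [Term.steps], Runs.loop_done (by simp [Term.eval, h1, h2])⟩
      | succ l ihl =>
        intro i τ h1 h2 h3
        obtain ⟨t, ht, hr⟩ := ih hw τ h3
        have hfb : A.exec τ b' = τ b' := exec_frame A (wf_frame A hw) τ
        have hfc : A.exec τ c = τ c := exec_frame A hc τ
        obtain ⟨t', ht', hr'⟩ := ihl (i + 1) (put (A.exec τ) c 0 (A.exec τ c 0 + 1))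
          (by rw [put_apply, if_pos ⟨rfl, rfl⟩, hfc, h1])
          (by rw [put_ne hcb.symm, hfb, h2]; omega)
          (fun k => by rw [put_ne hcb.symm, hfb]; exact h3 k)
        refine ⟨_, ?_, Runs.loop_step (by simp [Term.eval, h1, h2])
          (Runs.seq hr (Runs.set _ _ _ _)) hr'⟩
        simp only [Term.steps]
        have : (l + 1) * (T + 12) = l * (T + 12) + (T + 12) := by ring
        omega
    obtain ⟨t, ht, hr⟩ := key (σ b' k) 0 (put σ c 0 0) (by simp [put_apply])
      (by rw [put_ne hcb.symm]; simp) (fun k => by rw [put_ne hcb.symm]; exact hB k)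
    refine ⟨_, ?_, Runs.seq (Runs.set _ _ _ _) hr⟩
    have : σ b' k * (T + 12) ≤ B * (T + 12) := Nat.mul_le_mul_right _ (hB k)
    simp only [timePoly, Polynomial.eval_add, Polynomial.eval_mul, Polynomial.eval_X,
      Polynomial.eval_ofNat, Term.steps, ← hT]
    omega

end Code

/-! ### Harmonic numbers -/

theorem div_le_harmonic_sub (x g : ℕ) :
    (g : ℚ) / ((x + g : ℕ) : ℚ) ≤ harmonic (x + g) - harmonic x := by
  have key : ∀ h ≤ g, (h : ℚ) / ((x + g : ℕ) : ℚ) ≤ harmonic (x + h) - harmonic x := by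
    intro h
    induction h with
    | zero => simp
    | succ h ih =>
      intro hg
      have h1 := ih (by omega)
      have h2 : (1 : ℚ) / ((x + g : ℕ) : ℚ) ≤ ((x + h + 1 : ℕ) : ℚ)⁻¹ := by
        rw [one_div]
        apply inv_anti₀ (by positivity)
        exact_mod_cast (by omega : x + h + 1 ≤ x + g)
      rw [← add_assoc, harmonic_succ, Nat.cast_succ h, add_div]
      linarith
  exact key g le_rfl

theorem harmonic_add_sub_le (x g : ℕ) :
    harmonic (x + g) - harmonic x ≤ (g : ℚ) / ((x + 1 : ℕ) : ℚ) := by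
  induction g with
  | zero => simp
  | succ g ih =>
    have h2 : ((x + g + 1 : ℕ) : ℚ)⁻¹ ≤ (1 : ℚ) / ((x + 1 : ℕ) : ℚ) := by
      rw [one_div]
      apply inv_anti₀ (by positivity)
      exact_mod_cast (by omega : x + 1 ≤ x + g + 1)
    rw [← add_assoc, harmonic_succ, Nat.cast_succ g, add_div]
    linarith

theorem harmonic_mono {x y : ℕ} (h : x ≤ y) : harmonic x ≤ harmonic y := by
  obtain ⟨g, rfl⟩ := Nat.exists_eq_add_of_le h
  have := div_le_harmonic_sub x g
  have : (0 : ℚ) ≤ (g : ℚ) / ((x + g : ℕ) : ℚ) := by positivity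
  linarith

/-- This is where the sum of two harmonic numbers in the approximation ratio comes from. -/
theorem harmonic_mul_succ_le (x y : ℕ) :
    harmonic (x * (y + 1)) ≤ harmonic x + harmonic y := by
  induction y with
  | zero => simp
  | succ y ih =>
    have h1 := harmonic_add_sub_le (x * (y + 1)) x
    have h2 : (x : ℚ) / ((x * (y + 1) + 1 : ℕ) : ℚ) ≤ ((y + 1 : ℕ) : ℚ)⁻¹ := by
      rw [inv_eq_one_div, div_le_div_iff₀ (by positivity) (by positivity)]
      push_cast
      linarith
    rw [harmonic_succ, mul_add x (y + 1) 1, mul_one]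
    linarith

/-! ### Greedy covering by a supermodular gap function -/

section Greedy

variable {V : Type*} [DecidableEq V] {gap : Finset V → ℕ}

/-- Supermodularity bounds the joint gain of `T` by the sum of the gains of its elements. -/
theorem gap_sub_le_sum (hanti : ∀ A B, A ⊆ B → gap B ≤ gap A)
    (hsuper : ∀ A B, gap A + gap B ≤ gap (A ∪ B) + gap (A ∩ B)) (S T : Finset V) :
    gap S ≤ gap (S ∪ T) + ∑ w ∈ T, (gap S - gap (insert w S)) := by
  induction T using Finset.induction_on with
  | empty => simp
  | insert w T hw ih =>
    rw [Finset.sum_insert hw]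
    have h1 := hsuper (S ∪ T) (insert w S)
    have h2 : S ∪ T ∪ insert w S = S ∪ insert w T := by
      ext x; simp only [Finset.mem_union, Finset.mem_insert]; tauto
    have h3 : gap ((S ∪ T) ∩ insert w S) ≤ gap S :=
      hanti _ _ (Finset.subset_inter Finset.subset_union_left (Finset.subset_insert _ _))
    rw [h2] at h1
    omega

/-- The greedy choice of `u` pays at most the average price that `T` pays per unit of gap. -/
theorem greedy_price (hanti : ∀ A B, A ⊆ B → gap B ≤ gap A)
    (hsuper : ∀ A B, gap A + gap B ≤ gap (A ∪ B) + gap (A ∩ B)) (c : V → ℕ) (S T : Finset V)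
    (u : V) (hu : ∀ w, c u * (gap S - gap (insert w S)) ≤ c w * (gap S - gap (insert u S)))
    (hT : gap T = 0) :
    c u * gap S ≤ (∑ w ∈ T, c w) * (gap S - gap (insert u S)) := by
  have h0 : gap (S ∪ T) = 0 := by
    have := hanti T (S ∪ T) Finset.subset_union_right
    omega
  have h1 := gap_sub_le_sum hanti hsuper S T
  rw [h0, zero_add] at h1
  calc c u * gap S ≤ c u * ∑ w ∈ T, (gap S - gap (insert w S)) := Nat.mul_le_mul_left _ h1
    _ ≤ _ := by
      rw [Finset.mul_sum, Finset.sum_mul]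
      exact Finset.sum_le_sum fun w _ => hu w

/-- One greedy step keeps the cost within `OPT * (H (gap ∅) - H (gap S))`. -/
theorem greedy_step (hanti : ∀ A B, A ⊆ B → gap B ≤ gap A)
    (hsuper : ∀ A B, gap A + gap B ≤ gap (A ∪ B) + gap (A ∩ B)) (c : V → ℕ) (S T : Finset V)
    (u : V) (hu : ∀ w, c u * (gap S - gap (insert w S)) ≤ c w * (gap S - gap (insert u S)))
    (hT : gap T = 0) (hpos : gap (insert u S) < gap S)
    (hS : ((∑ w ∈ S, c w : ℕ) : ℚ) ≤
      (∑ w ∈ T, c w : ℕ) * (harmonic (gap ∅) - harmonic (gap S))) :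
    ((∑ w ∈ insert u S, c w : ℕ) : ℚ) ≤
      (∑ w ∈ T, c w : ℕ) * (harmonic (gap ∅) - harmonic (gap (insert u S))) := by
  have hprice := greedy_price hanti hsuper c S T u hu hT
  obtain ⟨g, hg⟩ := Nat.exists_eq_add_of_le hpos.le
  have hg' : gap S - gap (insert u S) = g := by omega
  rw [hg'] at hprice
  have hu' : u ∉ S := fun h => by rw [Finset.insert_eq_of_mem h] at hpos; omega
  have hH := div_le_harmonic_sub (gap (insert u S)) g
  rw [← hg] at hH
  have hGpos : (0 : ℚ) < gap S := by exact_mod_cast (by omega : 0 < gap S)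
  have h1 : (c u : ℚ) ≤ (∑ w ∈ T, c w : ℕ) * ((g : ℚ) / gap S) := by
    rw [← mul_div_assoc, le_div_iff₀ hGpos]
    exact_mod_cast hprice
  have h2 : ((∑ w ∈ T, c w : ℕ) : ℚ) * ((g : ℚ) / gap S) ≤
      (∑ w ∈ T, c w : ℕ) * (harmonic (gap S) - harmonic (gap (insert u S))) :=
    mul_le_mul_of_nonneg_left hH (by positivity)
  rw [Finset.sum_insert hu', Nat.cast_add]
  nlinarith

end Greedy

/-! ### Penalized flow values, defined by linear programming duality -/

namespace Instance

variable (I : Instance)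

/-- The total cost of all edges. -/
def totalCost : ℕ := ∑ e, I.edgeCost e

/-- The part of the dual objective that is subtracted from `d_v * a v`, for potentials `a u`, `b u`
at the entry and the exit of each node `u`: every edge, node and supply contributes its capacity
times the amount by which the potential difference exceeds its cost. The node `v` itself gets
capacity `2 * m + 1`, which no flow exceeds. -/
def dualLoss (v : Fin I.n) (S : Finset (Fin I.n)) (a b : Fin I.n → ℕ) : ℕ :=
  ∑ e, ((a (I.tgt e) - (b (I.src e) + I.edgeCost e)) +
      (if I.directed then 0 else a (I.src e) - (b (I.tgt e) + I.edgeCost e))) +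
    ∑ u, (if u = v then 2 * I.m + 1 else I.q u) * (b u - a u) +
    ∑ u, (if u ∈ S then I.p u else 0) * a u

/-- The minimum cost of a flow of `d_v` units from `S` to `v`, where every missing unit costs
`c(E) + 1`, as the optimum of the dual linear program. -/
noncomputable def val (v : Fin I.n) (S : Finset (Fin I.n)) : ℕ :=
  sSup {z | ∃ a b : Fin I.n → ℕ, a v ≤ I.totalCost + 1 ∧
    z = I.demand v * a v - I.dualLoss v S a b}

theorem val_bddAbove (v : Fin I.n) (S : Finset (Fin I.n)) :
    BddAbove {z | ∃ a b : Fin I.n → ℕ, a v ≤ I.totalCost + 1 ∧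
      z = I.demand v * a v - I.dualLoss v S a b} := by
  refine ⟨I.demand v * (I.totalCost + 1), ?_⟩
  rintro z ⟨a, b, ha, rfl⟩
  exact (Nat.sub_le _ _).trans (Nat.mul_le_mul_left _ ha)

theorem exists_val_eq (v : Fin I.n) (S : Finset (Fin I.n)) :
    ∃ a b : Fin I.n → ℕ, a v ≤ I.totalCost + 1 ∧
      I.val v S = I.demand v * a v - I.dualLoss v S a b :=
  Nat.sSup_mem (s := {z | ∃ a b : Fin I.n → ℕ, a v ≤ I.totalCost + 1 ∧
    z = I.demand v * a v - I.dualLoss v S a b})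
    ⟨_, fun _ => 0, fun _ => 0, Nat.zero_le _, rfl⟩ (I.val_bddAbove v S)

theorem le_val (v : Fin I.n) (S : Finset (Fin I.n)) (a b : Fin I.n → ℕ)
    (ha : a v ≤ I.totalCost + 1) : I.demand v * a v - I.dualLoss v S a b ≤ I.val v S :=
  le_csSup (I.val_bddAbove v S) ⟨a, b, ha, rfl⟩

theorem val_le (v : Fin I.n) (S : Finset (Fin I.n)) :
    I.val v S ≤ I.demand v * (I.totalCost + 1) := by
  obtain ⟨a, b, ha, h⟩ := I.exists_val_eq v S
  rw [h]
  exact (Nat.sub_le _ _).trans (Nat.mul_le_mul_left _ ha)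

theorem dualLoss_mono (v : Fin I.n) {S T : Finset (Fin I.n)} (h : S ⊆ T) (a b : Fin I.n → ℕ) :
    I.dualLoss v S a b ≤ I.dualLoss v T a b := by
  unfold dualLoss
  refine Nat.add_le_add_left (Finset.sum_le_sum fun u _ => Nat.mul_le_mul_right _ ?_) _
  by_cases hu : u ∈ S
  · simp [hu, h hu]
  · simp [hu]

theorem val_anti (v : Fin I.n) {S T : Finset (Fin I.n)} (h : S ⊆ T) : I.val v T ≤ I.val v S := by
  obtain ⟨a, b, ha, hv⟩ := I.exists_val_eq v T
  rw [hv]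
  exact (Nat.sub_le_sub_left (I.dualLoss_mono v h a b) _).trans (I.le_val v S a b ha)

/-- The dual loss is submodular jointly in the potentials and, in reversed order, in the set. -/
theorem dualLoss_submodular (v : Fin I.n) (A B : Finset (Fin I.n)) (a a' b b' : Fin I.n → ℕ) :
    I.dualLoss v (A ∩ B) (fun u => max (a u) (a' u)) (fun u => max (b u) (b' u)) +
      I.dualLoss v (A ∪ B) (fun u => min (a u) (a' u)) (fun u => min (b u) (b' u)) ≤
    I.dualLoss v A a b + I.dualLoss v B a' b' := by
  have hsub : ∀ x x' y y' c : ℕ,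
      (max x x' - (max y y' + c)) + (min x x' - (min y y' + c)) ≤
        (x - (y + c)) + (x' - (y' + c)) := by intros; omega
  have h1 : ∀ e, (max (a (I.tgt e)) (a' (I.tgt e)) -
          (max (b (I.src e)) (b' (I.src e)) + I.edgeCost e) +
        (if I.directed then 0 else max (a (I.src e)) (a' (I.src e)) -
          (max (b (I.tgt e)) (b' (I.tgt e)) + I.edgeCost e))) +
      (min (a (I.tgt e)) (a' (I.tgt e)) -
          (min (b (I.src e)) (b' (I.src e)) + I.edgeCost e) +
        (if I.directed then 0 else min (a (I.src e)) (a' (I.src e)) -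
          (min (b (I.tgt e)) (b' (I.tgt e)) + I.edgeCost e))) ≤
      (a (I.tgt e) - (b (I.src e) + I.edgeCost e) +
        (if I.directed then 0 else a (I.src e) - (b (I.tgt e) + I.edgeCost e))) +
      (a' (I.tgt e) - (b' (I.src e) + I.edgeCost e) +
        (if I.directed then 0 else a' (I.src e) - (b' (I.tgt e) + I.edgeCost e))) := by
    intro e
    have e1 := hsub (a (I.tgt e)) (a' (I.tgt e)) (b (I.src e)) (b' (I.src e)) (I.edgeCost e)
    have e2 := hsub (a (I.src e)) (a' (I.src e)) (b (I.tgt e)) (b' (I.tgt e)) (I.edgeCost e)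
    split_ifs <;> omega
  have h2 : ∀ u, (if u = v then 2 * I.m + 1 else I.q u) * (max (b u) (b' u) - max (a u) (a' u)) +
      (if u = v then 2 * I.m + 1 else I.q u) * (min (b u) (b' u) - min (a u) (a' u)) ≤
      (if u = v then 2 * I.m + 1 else I.q u) * (b u - a u) +
      (if u = v then 2 * I.m + 1 else I.q u) * (b' u - a' u) := by
    intro u
    rw [← mul_add, ← mul_add]
    refine Nat.mul_le_mul_left _ ?_
    have := hsub (b u) (b' u) (a u) (a' u) 0
    simpa using this
  have h3 : ∀ u, (if u ∈ A ∩ B then I.p u else 0) * max (a u) (a' u) +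
      (if u ∈ A ∪ B then I.p u else 0) * min (a u) (a' u) ≤
      (if u ∈ A then I.p u else 0) * a u + (if u ∈ B then I.p u else 0) * a' u := by
    intro u
    by_cases hA : u ∈ A <;> by_cases hB : u ∈ B <;> simp only [Finset.mem_inter,
      Finset.mem_union, hA, hB, and_self, or_self, and_false, or_false,
      or_true, if_true, if_false, zero_mul, zero_add, add_zero, and_true, le_refl]
    · rw [← mul_add, ← mul_add]
      exact Nat.mul_le_mul_left _ (by omega)
    · exact Nat.mul_le_mul_left _ (min_le_left _ _)
    · exact Nat.mul_le_mul_left _ (min_le_right _ _)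
  have s1 := Finset.sum_le_sum fun e (_ : e ∈ Finset.univ) => h1 e
  have s2 := Finset.sum_le_sum fun u (_ : u ∈ Finset.univ) => h2 u
  have s3 := Finset.sum_le_sum fun u (_ : u ∈ Finset.univ) => h3 u
  rw [Finset.sum_add_distrib, Finset.sum_add_distrib (f := fun e => _ + _)] at s1
  rw [Finset.sum_add_distrib, Finset.sum_add_distrib] at s2 s3
  simp only [dualLoss]
  omega

theorem val_supermodular (v : Fin I.n) (A B : Finset (Fin I.n)) :
    I.val v A + I.val v B ≤ I.val v (A ∪ B) + I.val v (A ∩ B) := by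
  obtain ⟨a, b, ha, hA⟩ := I.exists_val_eq v A
  obtain ⟨a', b', ha', hB⟩ := I.exists_val_eq v B
  have h1 := I.le_val v (A ∩ B) (fun u => max (a u) (a' u)) (fun u => max (b u) (b' u))
    (max_le ha ha')
  have h2 := I.le_val v (A ∪ B) (fun u => min (a u) (a' u)) (fun u => min (b u) (b' u))
    ((min_le_left _ _).trans ha)
  have h3 := I.dualLoss_submodular v A B a a' b b'
  have h4 := I.val_anti v (Finset.inter_subset_left (s₁ := A) (s₂ := B))
  have h5 := I.val_anti v (Finset.inter_subset_right (s₁ := A) (s₂ := B))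
  have h6 : I.demand v * max (a v) (a' v) + I.demand v * min (a v) (a' v) =
      I.demand v * a v + I.demand v * a' v := by
    rw [← mul_add, ← mul_add, max_add_min]
  omega

/-- By how much, in total, the penalized flow values exceed the bounds. As a flow costs at most
`c(E)` unless units are missing, lowering the bounds to `c(E)` enforces the demands. -/
noncomputable def gap (S : Finset (Fin I.n)) : ℕ :=
  ∑ v, (I.val v S - min (I.bound v) I.totalCost)

theorem gap_anti (A B : Finset (Fin I.n)) (h : A ⊆ B) : I.gap B ≤ I.gap A :=
  Finset.sum_le_sum fun v _ => Nat.sub_le_sub_right (I.val_anti v h) _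

theorem gap_supermodular (A B : Finset (Fin I.n)) :
    I.gap A + I.gap B ≤ I.gap (A ∪ B) + I.gap (A ∩ B) := by
  unfold gap
  rw [← Finset.sum_add_distrib, ← Finset.sum_add_distrib]
  refine Finset.sum_le_sum fun v _ => ?_
  have h1 := I.val_supermodular v A B
  have h2 := I.val_anti v (Finset.inter_subset_left (s₁ := A) (s₂ := B))
  have h3 := I.val_anti v (Finset.inter_subset_right (s₁ := A) (s₂ := B))
  have h4 := I.val_anti v (Finset.subset_union_left (s₁ := A) (s₂ := B))
  have h5 := I.val_anti v (Finset.subset_union_right (s₁ := A) (s₂ := B))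
  omega

theorem gap_le (S : Finset (Fin I.n)) : I.gap S ≤ (∑ v, I.demand v) * (I.totalCost + 1) := by
  rw [Finset.sum_mul]
  exact Finset.sum_le_sum fun v _ => (Nat.sub_le _ _).trans (I.val_le v S)

theorem gap_eq_zero_iff (S : Finset (Fin I.n)) :
    I.gap S = 0 ↔ ∀ v, I.val v S ≤ min (I.bound v) I.totalCost := by
  unfold gap
  rw [Finset.sum_eq_zero_iff]
  simp only [Finset.mem_univ, forall_const, Nat.sub_eq_zero_iff_le]

end Instance

/-! ### Flows in networks whose nodes and arcs are numbered -/

/-- A flow network with nodes `0, …, nodes - 1` and arcs `0, …, arcs - 1`. -/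
structure Net where
  nodes : ℕ
  arcs : ℕ
  source : ℕ
  sink : ℕ
  tail : ℕ → ℕ
  head : ℕ → ℕ
  cap : ℕ → ℕ
  cost : ℕ → ℕ

namespace Net

/-- All arcs join nodes of the network, and the sink is one of them. -/
structure Valid (G : Net) : Prop where
  tail_lt : ∀ j < G.arcs, G.tail j < G.nodes
  head_lt : ∀ j < G.arcs, G.head j < G.nodes
  sink_lt : G.sink < G.nodes
  sink_ne : G.sink ≠ G.source

/-- `x` is a flow of value `F` into the sink. -/
structure IsFlow (G : Net) (x : ℕ → ℕ) (F : ℕ) : Prop where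
  le_cap : ∀ j < G.arcs, x j ≤ G.cap j
  conserve : ∀ w < G.nodes, w ≠ G.source →
    ∑ j ∈ Finset.range G.arcs, (if G.tail j = w then x j else 0) + (if w = G.sink then F else 0) =
      ∑ j ∈ Finset.range G.arcs, (if G.head j = w then x j else 0)

/-- The total cost of a flow. -/
def flowCost (G : Net) (x : ℕ → ℕ) : ℕ := ∑ j ∈ Finset.range G.arcs, G.cost j * x j

/-- The price of the capacities in the dual objective. -/
def loss (G : Net) (π : ℕ → ℕ) : ℕ :=
  ∑ j ∈ Finset.range G.arcs, G.cap j * (π (G.head j) - (π (G.tail j) + G.cost j))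

theorem sum_mul_potential (G : Net) (x π f : ℕ → ℕ) (hf : ∀ j < G.arcs, f j < G.nodes) :
    ∑ w ∈ Finset.range G.nodes, π w * ∑ j ∈ Finset.range G.arcs, (if f j = w then x j else 0) =
      ∑ j ∈ Finset.range G.arcs, x j * π (f j) := by
  simp_rw [Finset.mul_sum]
  rw [Finset.sum_comm]
  refine Finset.sum_congr rfl fun j hj => ?_
  rw [Finset.sum_eq_single (f j)]
  · simp [mul_comm]
  · intro w _ hw
    simp [hw.symm]
  · intro h
    exact absurd (Finset.mem_range.2 (hf j (Finset.mem_range.1 hj))) h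

theorem IsFlow.potential_balance {G : Net} (hG : G.Valid) {x : ℕ → ℕ} {F : ℕ} (hx : G.IsFlow x F)
    {π : ℕ → ℕ} (hπ : π G.source = 0) :
    ∑ j ∈ Finset.range G.arcs, x j * π (G.tail j) + F * π G.sink =
      ∑ j ∈ Finset.range G.arcs, x j * π (G.head j) := by
  rw [← G.sum_mul_potential x π _ hG.tail_lt, ← G.sum_mul_potential x π _ hG.head_lt]
  have h1 : F * π G.sink =
      ∑ w ∈ Finset.range G.nodes, π w * (if w = G.sink then F else 0) := by
    rw [Finset.sum_eq_single G.sink]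
    · simp [mul_comm]
    · intro w _ hw; simp [hw]
    · intro h; exact absurd (Finset.mem_range.2 hG.sink_lt) h
  rw [h1, ← Finset.sum_add_distrib]
  refine Finset.sum_congr rfl fun w hw => ?_
  by_cases hs : w = G.source
  · simp [hs, hπ]
  · rw [← mul_add, hx.conserve w (Finset.mem_range.1 hw) hs]

theorem IsFlow.weak_duality {G : Net} (hG : G.Valid) {x : ℕ → ℕ} {F : ℕ} (hx : G.IsFlow x F)
    {π : ℕ → ℕ} (hπ : π G.source = 0) : F * π G.sink ≤ G.flowCost x + G.loss π := by
  have h := hx.potential_balance hG hπ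
  have h2 : ∑ j ∈ Finset.range G.arcs, x j * π (G.head j) ≤
      ∑ j ∈ Finset.range G.arcs, (x j * π (G.tail j) + (G.cost j * x j +
        G.cap j * (π (G.head j) - (π (G.tail j) + G.cost j)))) := by
    refine Finset.sum_le_sum fun j hj => ?_
    have hc := hx.le_cap j (Finset.mem_range.1 hj)
    calc x j * π (G.head j) ≤ x j * (π (G.tail j) + (G.cost j +
          (π (G.head j) - (π (G.tail j) + G.cost j)))) := Nat.mul_le_mul_left _ (by omega)
      _ = x j * π (G.tail j) + (G.cost j * x j +
          x j * (π (G.head j) - (π (G.tail j) + G.cost j))) := by ring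
      _ ≤ _ := by gcongr
  rw [Finset.sum_add_distrib, Finset.sum_add_distrib] at h2
  unfold flowCost loss
  omega

/-- Complementary slackness. -/
theorem IsFlow.duality {G : Net} (hG : G.Valid) {x : ℕ → ℕ} {F : ℕ} (hx : G.IsFlow x F)
    {π : ℕ → ℕ} (hπ : π G.source = 0)
    (h1 : ∀ j < G.arcs, x j < G.cap j → π (G.head j) ≤ π (G.tail j) + G.cost j)
    (h2 : ∀ j < G.arcs, 0 < x j → π (G.tail j) + G.cost j ≤ π (G.head j)) :
    F * π G.sink = G.flowCost x + G.loss π := by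
  have h := hx.potential_balance hG hπ
  have h2 : ∑ j ∈ Finset.range G.arcs, x j * π (G.head j) =
      ∑ j ∈ Finset.range G.arcs, (x j * π (G.tail j) + (G.cost j * x j +
        G.cap j * (π (G.head j) - (π (G.tail j) + G.cost j)))) := by
    refine Finset.sum_congr rfl fun j hj => ?_
    have hj := Finset.mem_range.1 hj
    have hc := hx.le_cap j hj
    rcases Nat.eq_zero_or_pos (x j) with h0 | h0
    · rcases Nat.eq_zero_or_pos (G.cap j) with h3 | h3
      · simp [h0, h3]
      · have := h1 j hj (by omega)
        simp [h0, Nat.sub_eq_zero_of_le this]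
    · have h4 := h2 j hj h0
      obtain ⟨y, hy⟩ := Nat.exists_eq_add_of_le h4
      have h5 : (G.cap j) * y = x j * y := by
        rcases hc.lt_or_eq with h6 | h6
        · have := h1 j hj h6
          have : y = 0 := by omega
          simp [this]
        · rw [h6]
      rw [hy, Nat.add_sub_cancel_left, h5]
      ring
  rw [Finset.sum_add_distrib, Finset.sum_add_distrib] at h2
  unfold flowCost loss
  omega

end Net

/-! ### The flow network of an instance -/

/-- The concatenation of two arrays of length `m` and two arrays of length `n`. -/
def blocks {m n : ℕ} (f g : Fin m → ℕ) (h k : Fin n → ℕ) (j : ℕ) : ℕ :=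
  if j < m then toArray f j
  else if j < m + m then toArray g (j - m)
  else if j < m + m + n then toArray h (j - (m + m))
  else toArray k (j - (m + m + n))

section Blocks

variable {m n : ℕ} (f g : Fin m → ℕ) (h k : Fin n → ℕ)

theorem toArray_val {l : ℕ} (f : Fin l → ℕ) (i : Fin l) : toArray f i = f i := by
  simp [toArray]

theorem toArray_of_lt {l : ℕ} (f : Fin l → ℕ) {i : ℕ} (hi : i < l) : toArray f i = f ⟨i, hi⟩ := by
  simp [toArray, hi]

theorem blocks_one (e : Fin m) : blocks f g h k e = f e := by
  simp [blocks, toArray_val]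

theorem blocks_two (e : Fin m) : blocks f g h k (m + e) = g e := by
  have : ¬ (m + (e : ℕ) < m) := by omega
  simp [blocks, toArray_val]

theorem blocks_three (u : Fin n) : blocks f g h k (m + m + u) = h u := by
  have h1 : ¬ (m + m + (u : ℕ) < m) := by omega
  have h2 : ¬ (m + m + (u : ℕ) < m + m) := by omega
  simp [blocks, toArray_val, h1]

theorem blocks_four (u : Fin n) : blocks f g h k (m + m + n + u) = k u := by
  have h1 : ¬ (m + m + n + (u : ℕ) < m) := by omega
  have h2 : ¬ (m + m + n + (u : ℕ) < m + m) := by omega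
  simp [blocks, toArray_val, h1, h2]

theorem sum_range_blocks (F : ℕ → ℕ) : ∑ j ∈ Finset.range (m + m + n + n), F j =
    ∑ e : Fin m, F e + ∑ e : Fin m, F (m + e) + ∑ u : Fin n, F (m + m + u) +
      ∑ u : Fin n, F (m + m + n + u) := by
  rw [Finset.sum_range_add, Finset.sum_range_add, Finset.sum_range_add]
  simp only [Finset.sum_range]

theorem forall_lt_blocks {P : ℕ → Prop} : (∀ j < m + m + n + n, P j) ↔
    (∀ e : Fin m, P e) ∧ (∀ e : Fin m, P (m + e)) ∧ (∀ u : Fin n, P (m + m + u)) ∧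
      ∀ u : Fin n, P (m + m + n + u) := by
  constructor
  · intro H
    exact ⟨fun e => H _ (by omega), fun e => H _ (by omega), fun u => H _ (by omega),
      fun u => H _ (by omega)⟩
  · rintro ⟨h1, h2, h3, h4⟩ j hj
    by_cases c1 : j < m
    · exact h1 ⟨j, c1⟩
    by_cases c2 : j < m + m
    · have := h2 ⟨j - m, by omega⟩
      simpa [show m + (j - m) = j by omega] using this
    by_cases c3 : j < m + m + n
    · have := h3 ⟨j - (m + m), by omega⟩
      simpa [show m + m + (j - (m + m)) = j by omega] using this
    · have := h4 ⟨j - (m + m + n), by omega⟩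
      simpa [show m + m + n + (j - (m + m + n)) = j by omega] using this

end Blocks

namespace Instance

variable (I : Instance)

/-- The flow network for the sink `v`. Every node `u` is split into an entry `u` and an exit
`n + u`; the source is `2 * n`. The arcs are, in this order, the edges from `src` to `tgt`, the
edges from `tgt` to `src` (with capacity `0` in a directed graph), the node arcs from entries to
exits, and the arcs from the source to the entries, with capacities `sup`. -/
def net (v : Fin I.n) (sup : Fin I.n → ℕ) : Net where
  nodes := I.n + I.n + 1
  arcs := I.m + I.m + I.n + I.n
  source := I.n + I.n
  sink := v
  tail := blocks (m := I.m) (n := I.n) (fun e => I.n + I.src e) (fun e => I.n + I.tgt e)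
    (fun u => u) (fun _ => I.n + I.n)
  head := blocks (m := I.m) (n := I.n) (fun e => I.tgt e) (fun e => I.src e)
    (fun u => I.n + u) (fun u => u)
  cap := blocks (m := I.m) (n := I.n) (fun _ => 1) (fun _ => if I.directed then 0 else 1)
    (fun u => if u = v then 2 * I.m + 1 else I.q u) sup
  cost := blocks (m := I.m) (n := I.n) I.edgeCost I.edgeCost (fun _ => 0) (fun _ => 0)

theorem net_valid (v : Fin I.n) (sup : Fin I.n → ℕ) : (I.net v sup).Valid where
  tail_lt := by
    refine (forall_lt_blocks (m := I.m) (n := I.n)).2 ⟨?_, ?_, ?_, ?_⟩ <;> intro i <;>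
      simp only [net, blocks_one, blocks_two, blocks_three, blocks_four] <;> omega
  head_lt := by
    refine (forall_lt_blocks (m := I.m) (n := I.n)).2 ⟨?_, ?_, ?_, ?_⟩ <;> intro i <;>
      simp only [net, blocks_one, blocks_two, blocks_three, blocks_four] <;> omega
  sink_lt := by simp only [net]; omega
  sink_ne := by simp only [net]; omega

/-- Potentials at the entries and exits of nodes as a potential of the network. -/
def potential (a b : Fin I.n → ℕ) (w : ℕ) : ℕ :=
  if w < I.n then toArray a w else toArray b (w - I.n)

theorem potential_entry (a b : Fin I.n → ℕ) (u : Fin I.n) : I.potential a b u = a u := by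
  simp [potential, toArray_val]

theorem potential_exit (a b : Fin I.n → ℕ) (u : Fin I.n) :
    I.potential a b (I.n + u) = b u := by
  have : ¬ (I.n + (u : ℕ) < I.n) := by omega
  simp [potential, toArray_val]

theorem potential_source (a b : Fin I.n → ℕ) : I.potential a b (I.n + I.n) = 0 := by
  simp [potential, toArray]

/-- The supplies of the network that are due to `S`. -/
def supplyOf (S : Finset (Fin I.n)) (u : Fin I.n) : ℕ := if u ∈ S then I.p u else 0

theorem loss_net (v : Fin I.n) (sup : Fin I.n → ℕ) (π : ℕ → ℕ) (hπ : π (I.n + I.n) = 0) :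
    (I.net v sup).loss π =
      ∑ e, ((π (I.tgt e) - (π (I.n + I.src e) + I.edgeCost e)) +
        (if I.directed then 0 else π (I.src e) - (π (I.n + I.tgt e) + I.edgeCost e))) +
      ∑ u : Fin I.n, (if u = v then 2 * I.m + 1 else I.q u) * (π (I.n + u) - π u) +
      ∑ u : Fin I.n, sup u * π u := by
  simp only [Net.loss, net, sum_range_blocks, blocks_one, blocks_two, blocks_three, blocks_four,
    Finset.sum_add_distrib, hπ]
  congr 3
  · simp
  · refine Finset.sum_congr rfl fun e _ => ?_
    split_ifs <;> simp

theorem loss_net_potential (v : Fin I.n) (S : Finset (Fin I.n)) (a b : Fin I.n → ℕ) :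
    (I.net v (I.supplyOf S)).loss (I.potential a b) = I.dualLoss v S a b := by
  rw [I.loss_net v _ _ (I.potential_source a b)]
  simp only [potential_entry, potential_exit, dualLoss, supplyOf]

theorem flowCost_net (v : Fin I.n) (sup : Fin I.n → ℕ) (x : ℕ → ℕ) :
    (I.net v sup).flowCost x = ∑ e : Fin I.m, I.edgeCost e * (x e + x (I.m + e)) := by
  simp only [Net.flowCost, net, sum_range_blocks, blocks_one, blocks_two, blocks_three,
    blocks_four, mul_add, Finset.sum_add_distrib]
  simp

theorem sum_tail_entry (v : Fin I.n) (sup : Fin I.n → ℕ) (x : ℕ → ℕ) (u : Fin I.n) :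
    ∑ j ∈ Finset.range (I.net v sup).arcs, (if (I.net v sup).tail j = u then x j else 0) =
      x (I.m + I.m + u) := by
  have h1 : ∀ i : Fin I.n, I.n + (i : ℕ) ≠ u := by intro i; omega
  have h2 : I.n + I.n ≠ (u : ℕ) := by omega
  simp [net, sum_range_blocks, blocks_one, blocks_two, blocks_three, blocks_four, h1, h2,
    Fin.val_inj]

theorem sum_head_entry (v : Fin I.n) (sup : Fin I.n → ℕ) (x : ℕ → ℕ) (u : Fin I.n) :
    ∑ j ∈ Finset.range (I.net v sup).arcs, (if (I.net v sup).head j = u then x j else 0) =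
      I.inflow (fun e => x e) (fun e => x (I.m + e)) u + x (I.m + I.m + I.n + u) := by
  have h1 : ∀ i : Fin I.n, I.n + (i : ℕ) ≠ u := by intro i; omega
  simp [net, sum_range_blocks, blocks_one, blocks_two, blocks_three, blocks_four, h1,
    Fin.val_inj, inflow, Finset.sum_add_distrib]

theorem sum_tail_exit (v : Fin I.n) (sup : Fin I.n → ℕ) (x : ℕ → ℕ) (u : Fin I.n) :
    ∑ j ∈ Finset.range (I.net v sup).arcs,
      (if (I.net v sup).tail j = I.n + u then x j else 0) =
      I.outflow (fun e => x e) (fun e => x (I.m + e)) u := by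
  have h1 : ∀ i : Fin I.n, (i : ℕ) ≠ I.n + u := by intro i; omega
  have h2 : I.n ≠ (u : ℕ) := by omega
  simp [net, sum_range_blocks, blocks_one, blocks_two, blocks_three, blocks_four, h1, h2,
    Fin.val_inj, outflow, Finset.sum_add_distrib]

theorem sum_head_exit (v : Fin I.n) (sup : Fin I.n → ℕ) (x : ℕ → ℕ) (u : Fin I.n) :
    ∑ j ∈ Finset.range (I.net v sup).arcs,
      (if (I.net v sup).head j = I.n + u then x j else 0) = x (I.m + I.m + u) := by
  have h1 : ∀ i : Fin I.n, (i : ℕ) ≠ I.n + u := by intro i; omega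
  simp [net, sum_range_blocks, blocks_one, blocks_two, blocks_three, blocks_four, h1,
    Fin.val_inj]

/-- Conservation in the network, node by node of the graph. -/
theorem isFlow_net_iff (v : Fin I.n) (sup : Fin I.n → ℕ) (x : ℕ → ℕ) (F : ℕ) :
    (I.net v sup).IsFlow x F ↔
      (∀ j < I.m + I.m + I.n + I.n, x j ≤ (I.net v sup).cap j) ∧
      (∀ u : Fin I.n, x (I.m + I.m + u) + (if u = v then F else 0) =
        I.inflow (fun e => x e) (fun e => x (I.m + e)) u + x (I.m + I.m + I.n + u)) ∧
      ∀ u : Fin I.n, I.outflow (fun e => x e) (fun e => x (I.m + e)) u = x (I.m + I.m + u) := by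
  constructor
  · intro h
    refine ⟨h.le_cap, fun u => ?_, fun u => ?_⟩
    · have := h.conserve u (by simp only [net]; omega) (by simp only [net]; omega)
      rw [sum_tail_entry, sum_head_entry] at this
      simpa [net, Fin.val_inj] using this
    · have := h.conserve (I.n + u) (by simp only [net]; omega) (by simp only [net]; omega)
      rw [sum_tail_exit, sum_head_exit] at this
      rwa [if_neg (by simp only [net]; omega), add_zero] at this
  · rintro ⟨h1, h2, h3⟩
    refine ⟨h1, fun w hw hs => ?_⟩
    simp only [net] at hw hs
    by_cases hn : w < I.n
    · have := h2 ⟨w, hn⟩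
      have e1 := I.sum_tail_entry v sup x ⟨w, hn⟩
      have e2 := I.sum_head_entry v sup x ⟨w, hn⟩
      dsimp only at e1 e2
      rw [e1, e2, ← this]
      simp [net, Fin.ext_iff]
    · obtain ⟨u, rfl⟩ : ∃ u : Fin I.n, w = I.n + u := ⟨⟨w - I.n, by omega⟩, by simp; omega⟩
      rw [sum_tail_exit, sum_head_exit, h3, if_neg (by simp only [net]; omega), add_zero]

theorem outflow_le (fwd bwd : Fin I.m → ℕ) (h : ∀ e, fwd e + bwd e ≤ 1) (u : Fin I.n) :
    I.outflow fwd bwd u ≤ I.m := by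
  have : I.outflow fwd bwd u ≤ ∑ _e : Fin I.m, 1 := by
    refine Finset.sum_le_sum fun e _ => ?_
    have := h e
    split_ifs <;> omega
  simpa using this

theorem IsFlow.edge_le {I : Instance} {E : Finset (Fin I.m)} {S : Finset (Fin I.n)} {v : Fin I.n}
    {fwd bwd : Fin I.m → ℕ} {supply : Fin I.n → ℕ} (h : I.IsFlow E S v fwd bwd supply)
    (e : Fin I.m) : fwd e + bwd e ≤ if e ∈ E then 1 else 0 := by
  by_cases he : e ∈ E
  · simpa [he] using h.edge_cap e he
  · have := h.edge_support e he
    simp [he, this.1, this.2]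

/-- Flows in the graph are flows in the network. The node arc of `u` carries what leaves `u`. -/
theorem IsFlow.toNet {I : Instance} {E : Finset (Fin I.m)} {S : Finset (Fin I.n)} {v : Fin I.n}
    {fwd bwd : Fin I.m → ℕ} {supply : Fin I.n → ℕ} (h : I.IsFlow E S v fwd bwd supply) {k : ℕ}
    (hk : supply v + I.inflow fwd bwd v = k + I.outflow fwd bwd v) :
    (I.net v (I.supplyOf S)).IsFlow (blocks fwd bwd (I.outflow fwd bwd) supply) k := by
  have h1 : ∀ e, fwd e + bwd e ≤ 1 := fun e => (h.edge_le e).trans (by split_ifs <;> simp)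
  rw [isFlow_net_iff]
  refine ⟨?_, fun u => ?_, fun u => ?_⟩
  · refine forall_lt_blocks.2 ⟨fun e => ?_, fun e => ?_, fun u => ?_, fun u => ?_⟩
    · simp only [net, blocks_one]
      exact (Nat.le_add_right _ _).trans (h1 e)
    · simp only [net, blocks_two]
      split_ifs with hd
      · exact (h.direction hd e).le
      · exact (Nat.le_add_left _ _).trans (h1 e)
    · simp only [net, blocks_three]
      split_ifs with hu
      · have := I.outflow_le fwd bwd h1 u
        omega
      · rw [← h.conservation u hu]
        exact h.node_cap u hu
    · simp only [net, blocks_four, supplyOf]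
      split_ifs with hu
      · exact h.supply_cap u hu
      · exact (h.supply_support u hu).le
  · simp only [blocks_one, blocks_two, blocks_three, blocks_four]
    change _ = I.inflow fwd bwd u + supply u
    split_ifs with hu
    · subst hu; omega
    · have := h.conservation u hu
      omega
  · simp only [blocks_one, blocks_two, blocks_three]

/-- The dual optimum is a lower bound for the cost of every edge set that meets the demand. -/
theorem val_le_of_connectivity (v : Fin I.n) (S : Finset (Fin I.n)) (E : Finset (Fin I.m))
    (h : I.demand v ≤ I.connectivity E S v) : I.val v S ≤ ∑ e ∈ E, I.edgeCost e := by
  obtain ⟨fwd, bwd, supply, hf, hk⟩ := (I.connectivity_isGreatest E S v).1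
  obtain ⟨a, b, -, hv⟩ := I.exists_val_eq v S
  have hw := (hf.toNet hk).weak_duality (I.net_valid _ _) (π := I.potential a b)
    (I.potential_source a b)
  rw [loss_net_potential, flowCost_net] at hw
  have hs : I.potential a b (I.net v (I.supplyOf S)).sink = a v := I.potential_entry a b v
  rw [hs] at hw
  have hd := Nat.mul_le_mul_right (a v) h
  have hc : ∑ e : Fin I.m, I.edgeCost e * (blocks fwd bwd (I.outflow fwd bwd) supply e +
      blocks fwd bwd (I.outflow fwd bwd) supply (I.m + e)) ≤ ∑ e ∈ E, I.edgeCost e := by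
    rw [← Finset.univ_inter E, ← Finset.sum_ite_mem]
    refine Finset.sum_le_sum fun e _ => ?_
    rw [blocks_one, blocks_two]
    refine (Nat.mul_le_mul_left _ (hf.edge_le e)).trans ?_
    split_ifs <;> simp
  omega

theorem gap_eq_zero_of_feasible {S : Finset (Fin I.n)} (h : I.Feasible S) : I.gap S = 0 := by
  rw [gap_eq_zero_iff]
  intro v
  have hv := h.2 v
  unfold flowCost at hv
  by_contra hcon
  have : ((I.bound v + 1 : ℕ) : ℕ∞) ≤ ⨅ F ∈ {F : Finset (Fin I.m) |
      I.demand v ≤ I.connectivity F S v}, ((∑ e ∈ F, I.edgeCost e : ℕ) : ℕ∞) := by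
    refine le_iInf₂ fun E hE => ?_
    have h1 := I.val_le_of_connectivity v S E hE
    have h2 : ∑ e ∈ E, I.edgeCost e ≤ I.totalCost :=
      Finset.sum_le_sum_of_subset (Finset.subset_univ E)
    have h3 : I.bound v + 1 ≤ ∑ e ∈ E, I.edgeCost e := by omega
    exact_mod_cast h3
  have h4 : ((I.bound v + 1 : ℕ) : ℕ∞) ≤ (I.bound v : ℕ∞) := this.trans hv
  have : I.bound v + 1 ≤ I.bound v := by exact_mod_cast h4
  omega

/-- The supplies of `S` without the one at `v`, which serves `v` directly and at no cost. -/
def supplyExcept (v : Fin I.n) (S : Finset (Fin I.n)) (u : Fin I.n) : ℕ :=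
  if u ∈ S ∧ u ≠ v then I.p u else 0

/-- The number of units that have to reach `v` through edges. -/
def residualDemand (v : Fin I.n) (S : Finset (Fin I.n)) : ℕ :=
  I.demand v - if v ∈ S then I.p v else 0

theorem loss_supplyOf (v : Fin I.n) (S : Finset (Fin I.n)) (π : ℕ → ℕ)
    (hπ : π (I.n + I.n) = 0) : (I.net v (I.supplyOf S)).loss π =
      (I.net v (I.supplyExcept v S)).loss π + (if v ∈ S then I.p v else 0) * π v := by
  rw [I.loss_net v _ π hπ, I.loss_net v _ π hπ, add_assoc _ _ (_ * π v)]
  congr 1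
  rw [← Finset.add_sum_erase _ _ (Finset.mem_univ v),
    ← Finset.add_sum_erase _ (fun u : Fin I.n => I.supplyExcept v S u * π u) (Finset.mem_univ v)]
  have h1 : I.supplyExcept v S v = 0 := by simp [supplyExcept]
  have h2 : ∑ u ∈ Finset.univ.erase v, I.supplyOf S u * π u =
      ∑ u ∈ Finset.univ.erase v, I.supplyExcept v S u * π u := by
    refine Finset.sum_congr rfl fun u hu => ?_
    simp [supplyOf, supplyExcept, Finset.ne_of_mem_erase hu]
  rw [h1, h2, supplyOf]
  ring

/-- An optimal solution: a flow `x` that leaves `rem` units of the residual demand missing, its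
penalized cost `z`, and a potential that certifies optimality by complementary slackness. -/
structure Certificate (v : Fin I.n) (S : Finset (Fin I.n)) (x π : ℕ → ℕ) (F rem z : ℕ) :
    Prop where
  isFlow : (I.net v (I.supplyExcept v S)).IsFlow x F
  demand_eq : F + rem = I.residualDemand v S
  source : π (I.n + I.n) = 0
  sink_le : π v ≤ I.totalCost + 1
  tight : rem = 0 ∨ π v = I.totalCost + 1
  slack : ∀ j < (I.net v (I.supplyExcept v S)).arcs, x j < (I.net v (I.supplyExcept v S)).cap j →
    π ((I.net v (I.supplyExcept v S)).head j) ≤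
      π ((I.net v (I.supplyExcept v S)).tail j) + (I.net v (I.supplyExcept v S)).cost j
  used : ∀ j < (I.net v (I.supplyExcept v S)).arcs, 0 < x j →
    π ((I.net v (I.supplyExcept v S)).tail j) + (I.net v (I.supplyExcept v S)).cost j ≤
      π ((I.net v (I.supplyExcept v S)).head j)
  value : z = (I.net v (I.supplyExcept v S)).flowCost x + (I.totalCost + 1) * rem

variable {I}

/-- Strong duality, given a pair of solutions that satisfy complementary slackness. -/
theorem Certificate.val_eq {v : Fin I.n} {S : Finset (Fin I.n)} {x π : ℕ → ℕ} {F rem z : ℕ}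
    (h : I.Certificate v S x π F rem z) : I.val v S = z := by
  have hdem := h.demand_eq
  unfold residualDemand at hdem
  set pv := if v ∈ S then I.p v else 0 with hpv
  apply le_antisymm
  · obtain ⟨a, b, ha, hv⟩ := I.exists_val_eq v S
    have hw := h.isFlow.weak_duality (I.net_valid _ _) (π := I.potential a b)
      (I.potential_source a b)
    have hl := I.loss_supplyOf v S (I.potential a b) (I.potential_source a b)
    rw [loss_net_potential, potential_entry, ← hpv] at hl
    have hs : I.potential a b (I.net v (I.supplyExcept v S)).sink = a v := I.potential_entry a b v
    rw [hs] at hw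
    have h1 : I.demand v * a v ≤ (F + rem + pv) * a v := Nat.mul_le_mul_right _ (by omega)
    have h2 : rem * a v ≤ (I.totalCost + 1) * rem := by
      rw [mul_comm]; exact Nat.mul_le_mul_right _ ha
    rw [add_mul, add_mul] at h1
    have := h.value
    omega
  · have hd := h.isFlow.duality (I.net_valid _ _) h.source h.slack h.used
    change F * π v = _ at hd
    rcases Nat.eq_zero_or_pos (F + rem) with h0 | h0
    · have hF : F = 0 := by omega
      have hr : rem = 0 := by omega
      have := h.value
      rw [hF, zero_mul] at hd
      rw [hr, mul_zero] at this
      omega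
    · have hle := I.le_val v S (fun u => π u) (fun u => π (I.n + u)) h.sink_le
      have hl := I.loss_supplyOf v S π h.source
      rw [← hpv] at hl
      have hl2 : I.dualLoss v S (fun u => π u) (fun u => π (I.n + u)) =
          (I.net v (I.supplyOf S)).loss π := by
        rw [I.loss_net v _ _ h.source]
        simp only [dualLoss, supplyOf]
      have h1 : I.demand v * π v = F * π v + rem * π v + pv * π v := by
        rw [← add_mul, ← add_mul]
        congr 1
        omega
      have h2 : rem * π v = (I.totalCost + 1) * rem := by
        rcases h.tight with h3 | h3
        · simp [h3]
        · rw [h3, mul_comm]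
      have := h.value
      omega

/-- Opposite flows on the two directions of an edge are cancelled, so that the edge capacity is
respected. -/
theorem exists_flow_of_net {v : Fin I.n} {S : Finset (Fin I.n)} {x : ℕ → ℕ} {F : ℕ}
    (h : (I.net v (I.supplyExcept v S)).IsFlow x F)
    (hF : I.demand v ≤ F + if v ∈ S then I.p v else 0) :
    I.demand v ≤ I.connectivity Finset.univ S v ∧
      I.flowCost S v ≤ ((I.net v (I.supplyExcept v S)).flowCost x : ℕ∞) := by
  obtain ⟨h1, h2, h3⟩ := (I.isFlow_net_iff v _ x F).1 h
  obtain ⟨c1, c2, c3, c4⟩ := forall_lt_blocks.1 h1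
  simp only [net, blocks_one, blocks_two, blocks_three, blocks_four] at c1 c2 c3 c4
  set f : Fin I.m → ℕ := fun e => x e - x (I.m + e) with hf
  set b : Fin I.m → ℕ := fun e => x (I.m + e) - x e with hb
  set sup : Fin I.n → ℕ := fun u => if u = v then (if v ∈ S then I.p v else 0)
    else x (I.m + I.m + I.n + u) with hsup
  have c2' : ∀ e : Fin I.m, x (I.m + e) ≤ 1 := fun e => (c2 e).trans (by split_ifs <;> simp)
  -- what is cancelled at `u`
  set δ : Fin I.n → ℕ := fun u => ∑ e : Fin I.m,
    ((if I.tgt e = u then min (x e) (x (I.m + e)) else 0) +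
      (if I.src e = u then min (x e) (x (I.m + e)) else 0)) with hδ
  have hin : ∀ u, I.inflow (fun e => x e) (fun e => x (I.m + e)) u = I.inflow f b u + δ u := by
    intro u
    rw [hδ]
    simp only [inflow]
    rw [← Finset.sum_add_distrib]
    refine Finset.sum_congr rfl fun e _ => ?_
    simp only [hf, hb]
    split_ifs <;> omega
  have hout : ∀ u, I.outflow (fun e => x e) (fun e => x (I.m + e)) u = I.outflow f b u + δ u := by
    intro u
    rw [hδ]
    simp only [outflow]
    rw [← Finset.sum_add_distrib]
    refine Finset.sum_congr rfl fun e _ => ?_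
    simp only [hf, hb]
    split_ifs <;> omega
  have hflow : ∀ E : Finset (Fin I.m), (∀ e ∉ E, f e + b e = 0) → I.IsFlow E S v f b sup := by
    intro E hE
    refine ⟨fun e _ => ?_, fun e he => ?_, fun hd e => ?_, fun u hu => ?_, fun u hu => ?_,
      fun u hu => ?_, fun u hu => ?_⟩
    · have := c1 e
      have := c2' e
      simp only [hf, hb]; omega
    · have := hE e he
      omega
    · have := c2 e
      simp only [hd, if_true] at this
      simp only [hb]; omega
    · simp only [hsup]
      split_ifs with huv hv
      · rw [huv]
      · exact absurd (huv ▸ hu) hv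
      · have := c4 u
        rwa [supplyExcept, if_pos ⟨hu, huv⟩] at this
    · simp only [hsup]
      split_ifs with huv hv
      · exact absurd (huv ▸ hv) hu
      · rfl
      · have := c4 u
        rw [supplyExcept, if_neg (fun hh => hu hh.1)] at this
        omega
    · have e1 := h2 u
      have e2 := h3 u
      rw [hin] at e1
      rw [hout] at e2
      simp only [hu, if_false] at e1
      simp only [hsup, hu, if_false]
      omega
    · have e1 := h2 u
      have e2 := c3 u
      rw [hin] at e1
      simp only [hu, if_false] at e1 e2
      simp only [hsup, hu, if_false]
      omega
  have hval : sup v + I.inflow f b v = (F + if v ∈ S then I.p v else 0) + I.outflow f b v := by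
    have e1 := h2 v
    have e2 := h3 v
    have e3 := c4 v
    rw [hin] at e1
    rw [hout] at e2
    simp only [supplyExcept, ne_eq, not_true_eq_false, and_false, if_false] at e3
    simp only [if_true] at e1
    simp only [hsup, if_true]
    omega
  have hconn : ∀ E : Finset (Fin I.m), (∀ e ∉ E, f e + b e = 0) →
      I.demand v ≤ I.connectivity E S v := fun E hE =>
    hF.trans ((I.connectivity_isGreatest E S v).2 ⟨f, b, sup, hflow E hE, hval⟩)
  refine ⟨hconn _ (by simp), ?_⟩
  set E : Finset (Fin I.m) := Finset.univ.filter fun e => f e + b e ≠ 0 with hE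
  unfold flowCost
  refine (iInf₂_le E (hconn E fun e he => by simpa [hE] using he)).trans ?_
  rw [flowCost_net]
  norm_cast
  rw [hE, Finset.sum_filter]
  refine Finset.sum_le_sum fun e _ => ?_
  split_ifs with h0
  · refine Nat.le_mul_of_pos_right _ ?_
    simp only [hf, hb] at h0
    omega
  · exact Nat.zero_le _

/-- The converse of `gap_eq_zero_of_feasible`. The penalty forces `rem = 0`, as a missing unit costs
more than `c(E)`. -/
theorem feasible_of_gap_eq_zero {S : Finset (Fin I.n)}
    (hex : ∀ v, ∃ x π F rem z, I.Certificate v S x π F rem z) (h : I.gap S = 0) :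
    I.Feasible S := by
  rw [gap_eq_zero_iff] at h
  have key : ∀ v, I.demand v ≤ I.connectivity Finset.univ S v ∧
      I.flowCost S v ≤ (I.bound v : ℕ∞) := by
    intro v
    obtain ⟨x, π, F, rem, z, hc⟩ := hex v
    have h1 := h v
    rw [hc.val_eq] at h1
    have h2 := hc.value
    have hrem : rem = 0 := by
      rcases Nat.eq_zero_or_pos rem with h3 | h3
      · exact h3
      · have := Nat.le_mul_of_pos_right (I.totalCost + 1) h3
        omega
    have hdem := hc.demand_eq
    unfold residualDemand at hdem
    obtain ⟨h3, h4⟩ := exists_flow_of_net hc.isFlow (by omega)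
    refine ⟨h3, h4.trans ?_⟩
    rw [hrem, mul_zero, add_zero] at h2
    rw [← h2]
    exact_mod_cast (by omega : z ≤ I.bound v)
  exact ⟨fun v => (key v).1, fun v => (key v).2⟩

end Instance

/-! ### Residual networks and the primal-dual method -/

/-- A residual network: every arc `j` comes with its reversal `pr j`; the cost of an arc is the
difference `cp j - cn j`. -/
structure ResNet where
  nodes : ℕ
  arcs : ℕ
  source : ℕ
  sink : ℕ
  tail : ℕ → ℕ
  head : ℕ → ℕ
  cp : ℕ → ℕ
  cn : ℕ → ℕ
  pr : ℕ → ℕ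

namespace ResNet

/-- All arcs join nodes of the network, and `pr` pairs every arc with its reversal, whose cost is
the negative. -/
structure Valid (R : ResNet) : Prop where
  tail_lt : ∀ j < R.arcs, R.tail j < R.nodes
  head_lt : ∀ j < R.arcs, R.head j < R.nodes
  source_lt : R.source < R.nodes
  sink_lt : R.sink < R.nodes
  sink_ne : R.sink ≠ R.source
  pr_lt : ∀ j < R.arcs, R.pr j < R.arcs
  pr_ne : ∀ j < R.arcs, R.pr j ≠ j
  pr_pr : ∀ j < R.arcs, R.pr (R.pr j) = j
  tail_pr : ∀ j < R.arcs, R.tail (R.pr j) = R.head j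
  head_pr : ∀ j < R.arcs, R.head (R.pr j) = R.tail j
  cp_pr : ∀ j < R.arcs, R.cp (R.pr j) = R.cn j
  cn_pr : ∀ j < R.arcs, R.cn (R.pr j) = R.cp j

variable (R : ResNet)

/-- No residual arc has negative reduced cost. -/
def Good (rc π : ℕ → ℕ) : Prop :=
  ∀ j < R.arcs, 0 < rc j → π (R.head j) + R.cn j ≤ π (R.tail j) + R.cp j

/-- The reduced cost of an arc, for potentials that are `Good`. -/
def red (π : ℕ → ℕ) (j : ℕ) : ℕ := R.cp j + π (R.tail j) - (R.cn j + π (R.head j))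

/-- The residual arc `j` leaves the set of nodes of nonzero rank. -/
def Cut (rc rk : ℕ → ℕ) (j : ℕ) : Prop := rk (R.tail j) ≠ 0 ∧ rk (R.head j) = 0 ∧ rc j ≠ 0

/-- The nodes of nonzero rank form a tree of tight residual arcs that is rooted at the source; ranks
increase along its arcs, and `par w` is the arc of the tree that enters `w`. -/
structure Tree (rc π rk par : ℕ → ℕ) : Prop where
  root : rk R.source = 1
  par_lt : ∀ w < R.nodes, rk w ≠ 0 → w ≠ R.source → par w < R.arcs
  head_par : ∀ w < R.nodes, rk w ≠ 0 → w ≠ R.source → R.head (par w) = w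
  rk_tail_ne : ∀ w < R.nodes, rk w ≠ 0 → w ≠ R.source → rk (R.tail (par w)) ≠ 0
  rk_tail_lt : ∀ w < R.nodes, rk w ≠ 0 → w ≠ R.source → rk (R.tail (par w)) < rk w
  pos : ∀ w < R.nodes, rk w ≠ 0 → w ≠ R.source → 0 < rc (par w)
  tight : ∀ w < R.nodes, rk w ≠ 0 → w ≠ R.source →
    π w + R.cn (par w) = π (R.tail (par w)) + R.cp (par w)

/-- The potential after the nodes outside the tree have been raised by `δ`. -/
def raise (π rk : ℕ → ℕ) (δ w : ℕ) : ℕ := if w < R.nodes ∧ rk w = 0 then π w + δ else π w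

variable {R}

theorem raise_of_ne {π rk : ℕ → ℕ} {δ w : ℕ} (h : rk w ≠ 0) : R.raise π rk δ w = π w := by
  simp [raise, h]

theorem raise_of_eq {π rk : ℕ → ℕ} {δ w : ℕ} (hw : w < R.nodes) (h : rk w = 0) :
    R.raise π rk δ w = π w + δ := by
  simp [raise, h, hw]

theorem Good.raise (hR : R.Valid) {rc π rk : ℕ → ℕ} (h : R.Good rc π) {δ : ℕ}
    (hδ : ∀ j < R.arcs, R.Cut rc rk j → δ ≤ R.red π j) : R.Good rc (R.raise π rk δ) := by
  intro j hj hpos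
  have h1 := h j hj hpos
  have ht := hR.tail_lt j hj
  have hh := hR.head_lt j hj
  by_cases ct : rk (R.tail j) = 0 <;> by_cases ch : rk (R.head j) = 0
  · rw [raise_of_eq ht ct, raise_of_eq hh ch]; omega
  · rw [raise_of_eq ht ct, raise_of_ne ch]; omega
  · have := hδ j hj ⟨ct, ch, by omega⟩
    rw [raise_of_ne ct, raise_of_eq hh ch]
    unfold red at this
    omega
  · rw [raise_of_ne ct, raise_of_ne ch]; exact h1

theorem Tree.raise {rc π rk par : ℕ → ℕ} (h : R.Tree rc π rk par) (δ : ℕ) :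
    R.Tree rc (R.raise π rk δ) rk par where
  root := h.root
  par_lt := h.par_lt
  head_par := h.head_par
  rk_tail_ne := h.rk_tail_ne
  rk_tail_lt := h.rk_tail_lt
  pos := h.pos
  tight w hw hr hs := by
    rw [raise_of_ne hr, raise_of_ne (h.rk_tail_ne w hw hr hs)]
    exact h.tight w hw hr hs

/-- After the raise, an arc of least reduced cost in the cut is tight and extends the tree. -/
theorem Tree.extend (hR : R.Valid) {rc π rk par : ℕ → ℕ} (h : R.Tree rc π rk par)
    (hg : R.Good rc π) {j k : ℕ} (hj : j < R.arcs) (hc : R.Cut rc rk j)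
    (hk : ∀ w < R.nodes, rk w < k) :
    R.Tree rc (R.raise π rk (R.red π j)) (Function.update rk (R.head j) k)
      (Function.update par (R.head j) j) := by
  have hT := h.raise (R.red π j)
  obtain ⟨c1, c2, c3⟩ := hc
  have hsrc : R.source ≠ R.head j := by
    intro hs
    rw [← hs, h.root] at c2
    omega
  have htj : R.tail j ≠ R.head j := fun he => c1 (he ▸ c2)
  have hne : ∀ w, rk w ≠ 0 → w ≠ R.head j := fun w hw he => hw (he ▸ c2)
  have hgj := hg j hj (by omega)
  have hold : ∀ w, w ≠ R.head j → Function.update rk (R.head j) k w ≠ 0 → rk w ≠ 0 :=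
    fun w hwj hr => by rwa [Function.update_of_ne hwj] at hr
  refine ⟨by rw [Function.update_of_ne hsrc]; exact h.root, ?_, ?_, ?_, ?_, ?_, ?_⟩ <;>
    intro w hw hr hs <;> rcases eq_or_ne w (R.head j) with rfl | hwj
  · rwa [Function.update_self]
  · rw [Function.update_of_ne hwj]; exact h.par_lt w hw (hold w hwj hr) hs
  · rw [Function.update_self]
  · rw [Function.update_of_ne hwj]; exact h.head_par w hw (hold w hwj hr) hs
  · rwa [Function.update_self, Function.update_of_ne htj]
  · have h1 := h.rk_tail_ne w hw (hold w hwj hr) hs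
    rwa [Function.update_of_ne hwj, Function.update_of_ne (hne _ h1)]
  · rw [Function.update_self, Function.update_self, Function.update_of_ne htj]
    exact hk _ (hR.tail_lt j hj)
  · have h1 := h.rk_tail_ne w hw (hold w hwj hr) hs
    rw [Function.update_of_ne hwj, Function.update_of_ne hwj, Function.update_of_ne (hne _ h1)]
    exact h.rk_tail_lt w hw (hold w hwj hr) hs
  · rw [Function.update_self]; exact Nat.pos_of_ne_zero c3
  · rw [Function.update_of_ne hwj]; exact h.pos w hw (hold w hwj hr) hs
  · rw [Function.update_self, raise_of_eq hw c2, raise_of_ne c1]; unfold red; omega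
  · rw [Function.update_of_ne hwj]; exact hT.tight w hw (hold w hwj hr) hs

variable (R)

/-- The total residual capacity of the arcs that enter `w`. -/
def resIn (rc : ℕ → ℕ) (w : ℕ) : ℕ :=
  ∑ j ∈ Finset.range R.arcs, if R.head j = w then rc j else 0

/-- Residual capacities after one unit has been sent through arc `j`. -/
def push (rc : ℕ → ℕ) (j : ℕ) : ℕ → ℕ :=
  Function.update (Function.update rc j (rc j - 1)) (R.pr j) (rc (R.pr j) + 1)

variable {R}

theorem push_add (hR : R.Valid) {rc : ℕ → ℕ} {j : ℕ} (hj : j < R.arcs) (hpos : 0 < rc j) (i : ℕ) :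
    R.push rc j i + (if i = j then 1 else 0) = rc i + (if i = R.pr j then 1 else 0) := by
  have hne := hR.pr_ne j hj
  unfold push
  by_cases h1 : i = R.pr j
  · subst h1; simp [hne]
  · rw [Function.update_of_ne h1]
    by_cases h2 : i = j
    · subst h2; simp [h1]; omega
    · simp [h1, h2]

theorem resIn_push (hR : R.Valid) {rc : ℕ → ℕ} {j : ℕ} (hj : j < R.arcs) (hpos : 0 < rc j)
    (w : ℕ) : R.resIn (R.push rc j) w + (if w = R.head j then 1 else 0) =
      R.resIn rc w + (if w = R.tail j then 1 else 0) := by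
  have key : ∀ l < R.arcs, ∑ i ∈ Finset.range R.arcs,
      (if R.head i = w then (if i = l then 1 else 0) else 0) = if w = R.head l then 1 else 0 := by
    intro l hl
    rw [Finset.sum_eq_single l]
    · simp [eq_comm]
    · intro i _ hi; simp [hi]
    · intro hn; exact absurd (Finset.mem_range.2 hl) hn
  rw [← key j hj, ← hR.head_pr j hj, ← key _ (hR.pr_lt j hj)]
  unfold resIn
  rw [← Finset.sum_add_distrib, ← Finset.sum_add_distrib]
  refine Finset.sum_congr rfl fun i _ => ?_
  have := push_add hR hj hpos i
  by_cases hw : R.head i = w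
  · simpa [hw] using this
  · simp [hw]

theorem push_pair (hR : R.Valid) {rc : ℕ → ℕ} {j : ℕ} (hj : j < R.arcs) (hpos : 0 < rc j) {i : ℕ}
    (hi : i < R.arcs) : R.push rc j i + R.push rc j (R.pr i) = rc i + rc (R.pr i) := by
  have h1 := push_add hR hj hpos i
  have h2 := push_add hR hj hpos (R.pr i)
  have e1 : (R.pr i = j) ↔ (i = R.pr j) :=
    ⟨fun h => by rw [← h, hR.pr_pr i hi], fun h => by rw [h, hR.pr_pr j hj]⟩
  have e2 : (R.pr i = R.pr j) ↔ (i = j) :=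
    ⟨fun h => by rw [← hR.pr_pr i hi, h, hR.pr_pr j hj], fun h => by rw [h]⟩
  simp only [e1, e2] at h2
  omega

theorem Good.push (hR : R.Valid) {rc π : ℕ → ℕ} (h : R.Good rc π) {j : ℕ} (hj : j < R.arcs)
    (hpos : 0 < rc j) (ht : π (R.head j) + R.cn j = π (R.tail j) + R.cp j) :
    R.Good (R.push rc j) π := by
  intro i hi hp
  have h1 := push_add hR hj hpos i
  by_cases hij : i = R.pr j
  · rw [hij, hR.head_pr j hj, hR.tail_pr j hj, hR.cp_pr j hj, hR.cn_pr j hj]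
    omega
  · apply h i hi
    rw [if_neg hij] at h1
    omega

variable (R)

/-- `rc` results from the capacities `rc₀` by sending `F` units from the source to the sink and, if
`o = 1`, one more unit from `u` to the sink. -/
structure Sent (rc₀ rc : ℕ → ℕ) (F o u : ℕ) : Prop where
  pair : ∀ j < R.arcs, rc j + rc (R.pr j) = rc₀ j + rc₀ (R.pr j)
  balance : ∀ w, R.resIn rc w + (if w = R.sink then F + o else 0) =
    R.resIn rc₀ w + (if w = R.source then F else 0) + (if w = u then o else 0)

/-- The state while a path of the tree is augmented, starting from its end at the sink: the part
from `u` to the sink is done. -/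
structure Augmenting (rc₀ rc π rk par : ℕ → ℕ) (F u : ℕ) : Prop where
  sent : R.Sent rc₀ rc F 1 u
  good : R.Good rc π
  lt : u < R.nodes
  rk_ne : rk u ≠ 0
  pos : ∀ w < R.nodes, rk w ≠ 0 → w ≠ R.source → rk w ≤ rk u → 0 < rc (par w)

variable {R}

theorem Sent.push (hR : R.Valid) {rc₀ rc : ℕ → ℕ} {F j : ℕ} (h : R.Sent rc₀ rc F 1 (R.head j))
    (hj : j < R.arcs) (hpos : 0 < rc j) : R.Sent rc₀ (R.push rc j) F 1 (R.tail j) where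
  pair i hi := by rw [push_pair hR hj hpos hi, h.pair i hi]
  balance w := by
    have h1 := resIn_push hR hj hpos w
    have h2 := h.balance w
    omega

theorem Augmenting.step (hR : R.Valid) {rc₀ rc rc' π rk par : ℕ → ℕ} {F u : ℕ}
    (hT : R.Tree rc' π rk par) (h : R.Augmenting rc₀ rc π rk par F u) (hu : u ≠ R.source) :
    R.Augmenting rc₀ (R.push rc (par u)) π rk par F (R.tail (par u)) := by
  have hj := hT.par_lt u h.lt h.rk_ne hu
  have hh := hT.head_par u h.lt h.rk_ne hu
  have hp := h.pos u h.lt h.rk_ne hu le_rfl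
  have hlt := hT.rk_tail_lt u h.lt h.rk_ne hu
  refine ⟨?_, ?_, hR.tail_lt _ hj, hT.rk_tail_ne u h.lt h.rk_ne hu, ?_⟩
  · exact Sent.push hR (by rw [hh]; exact h.sent) hj hp
  · refine Good.push hR h.good hj hp ?_
    rw [hh]
    exact hT.tight u h.lt h.rk_ne hu
  · intro w hw hr hs hle
    have h1 := push_add hR hj hp (par w)
    have h2 := h.pos w hw hr hs (by omega)
    -- the arcs entering different nodes differ
    have h3 : par w ≠ par u := fun he => by
      have := hT.head_par w hw hr hs
      rw [he, hh] at this
      rw [← this] at hle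
      omega
    rw [if_neg h3] at h1
    omega

theorem Augmenting.start {rc₀ rc π rk par : ℕ → ℕ} {F : ℕ} (hsent : R.Sent rc₀ rc F 0 R.source)
    (hg : R.Good rc π) (hT : R.Tree rc π rk par) (hlt : R.sink < R.nodes)
    (hr : rk R.sink ≠ 0) : R.Augmenting rc₀ rc π rk par F R.sink where
  sent := ⟨hsent.pair, fun w => by have := hsent.balance w; split_ifs at * <;> omega⟩
  good := hg
  lt := hlt
  rk_ne := hr
  pos w hw h1 h2 _ := hT.pos w hw h1 h2

theorem Sent.finish {rc₀ rc : ℕ → ℕ} {F : ℕ} (h : R.Sent rc₀ rc F 1 R.source) :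
    R.Sent rc₀ rc (F + 1) 0 R.source where
  pair := h.pair
  balance w := by have := h.balance w; split_ifs at * <;> omega

/-- The flow value is bounded by the capacity into the sink, which bounds the number of
augmentations. -/
theorem Sent.le_resIn {rc₀ rc : ℕ → ℕ} {F : ℕ} (h : R.Sent rc₀ rc F 0 R.source)
    (hne : R.sink ≠ R.source) : F ≤ R.resIn rc₀ R.sink := by
  have := h.balance R.sink
  rw [if_pos rfl, if_neg hne] at this
  split_ifs at this <;> omega

variable (R)

/-- `R` is the residual network of the zero flow in `G`: arc `G.arcs + j` is the reversal of
arc `j`. -/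
structure IsResidual (G : Net) : Prop where
  nodes : R.nodes = G.nodes
  arcs : R.arcs = G.arcs + G.arcs
  source : R.source = G.source
  sink : R.sink = G.sink
  tail : ∀ j < G.arcs, R.tail j = G.tail j
  head : ∀ j < G.arcs, R.head j = G.head j
  cp : ∀ j < G.arcs, R.cp j = G.cost j
  cn : ∀ j < G.arcs, R.cn j = 0
  pr : ∀ j < G.arcs, R.pr j = G.arcs + j
  tail' : ∀ j < G.arcs, R.tail (G.arcs + j) = G.head j
  head' : ∀ j < G.arcs, R.head (G.arcs + j) = G.tail j
  cp' : ∀ j < G.arcs, R.cp (G.arcs + j) = 0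
  cn' : ∀ j < G.arcs, R.cn (G.arcs + j) = G.cost j
  pr' : ∀ j < G.arcs, R.pr (G.arcs + j) = j

variable {R}

theorem IsResidual.valid {G : Net} (h : R.IsResidual G) (hG : G.Valid)
    (hs : G.source < G.nodes) : R.Valid := by
  have key : ∀ P : ℕ → Prop, (∀ j < G.arcs, P j) → (∀ j < G.arcs, P (G.arcs + j)) →
      ∀ j < R.arcs, P j := by
    intro P h1 h2 j hj
    rw [h.arcs] at hj
    by_cases hjK : j < G.arcs
    · exact h1 j hjK
    · have := h2 (j - G.arcs) (by omega)
      rwa [Nat.add_sub_cancel' (by omega)] at this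
  constructor
  · refine key _ (fun j hj => ?_) fun j hj => ?_
    · rw [h.tail j hj, h.nodes]; exact hG.tail_lt j hj
    · rw [h.tail' j hj, h.nodes]; exact hG.head_lt j hj
  · refine key _ (fun j hj => ?_) fun j hj => ?_
    · rw [h.head j hj, h.nodes]; exact hG.head_lt j hj
    · rw [h.head' j hj, h.nodes]; exact hG.tail_lt j hj
  · rw [h.source, h.nodes]; exact hs
  · rw [h.sink, h.nodes]; exact hG.sink_lt
  · rw [h.sink, h.source]; exact hG.sink_ne
  · refine key _ (fun j hj => ?_) fun j hj => ?_
    · rw [h.pr j hj, h.arcs]; omega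
    · rw [h.pr' j hj, h.arcs]; omega
  · refine key _ (fun j hj => ?_) fun j hj => ?_
    · rw [h.pr j hj]; omega
    · rw [h.pr' j hj]; omega
  · refine key _ (fun j hj => ?_) fun j hj => ?_
    · rw [h.pr j hj, h.pr' j hj]
    · rw [h.pr' j hj, h.pr j hj]
  · refine key _ (fun j hj => ?_) fun j hj => ?_
    · rw [h.pr j hj, h.tail' j hj, h.head j hj]
    · rw [h.pr' j hj, h.head' j hj, h.tail j hj]
  · refine key _ (fun j hj => ?_) fun j hj => ?_
    · rw [h.pr j hj, h.head' j hj, h.tail j hj]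
    · rw [h.pr' j hj, h.tail' j hj, h.head j hj]
  · refine key _ (fun j hj => ?_) fun j hj => ?_
    · rw [h.pr j hj, h.cp' j hj, h.cn j hj]
    · rw [h.pr' j hj, h.cn' j hj, h.cp j hj]
  · refine key _ (fun j hj => ?_) fun j hj => ?_
    · rw [h.pr j hj, h.cn' j hj, h.cp j hj]
    · rw [h.pr' j hj, h.cp' j hj, h.cn j hj]

theorem IsResidual.resIn_eq {G : Net} (h : R.IsResidual G) (rc : ℕ → ℕ) (w : ℕ) :
    R.resIn rc w = ∑ j ∈ Finset.range G.arcs, (if G.head j = w then rc j else 0) +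
      ∑ j ∈ Finset.range G.arcs, (if G.tail j = w then rc (G.arcs + j) else 0) := by
  unfold resIn
  rw [h.arcs, Finset.sum_range_add]
  congr 1
  · refine Finset.sum_congr rfl fun j hj => ?_
    rw [h.head j (Finset.mem_range.1 hj)]
  · refine Finset.sum_congr rfl fun j hj => ?_
    rw [h.head' j (Finset.mem_range.1 hj)]

/-- The flow through an arc is the residual capacity of its reversal. -/
theorem Sent.isFlow {G : Net} (h : R.IsResidual G) {rc₀ rc : ℕ → ℕ} {F : ℕ}
    (h0 : ∀ j < G.arcs, rc₀ j = G.cap j) (h1 : ∀ j < G.arcs, rc₀ (G.arcs + j) = 0)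
    (hs : R.Sent rc₀ rc F 0 R.source) : G.IsFlow (fun j => rc (G.arcs + j)) F where
  le_cap j hj := by
    have := hs.pair j (by rw [h.arcs]; omega)
    rw [h.pr j hj, h0 j hj, h1 j hj] at this
    omega
  conserve w hw hws := by
    have hb := hs.balance w
    rw [h.resIn_eq, h.resIn_eq, h.source, if_neg hws, h.sink] at hb
    have e1 : ∑ j ∈ Finset.range G.arcs, (if G.tail j = w then rc₀ (G.arcs + j) else 0) = 0 := by
      refine Finset.sum_eq_zero fun j hj => ?_
      rw [h1 j (Finset.mem_range.1 hj), ite_self]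
    have e2 : ∑ j ∈ Finset.range G.arcs, (if G.head j = w then rc₀ j else 0) =
        ∑ j ∈ Finset.range G.arcs, (if G.head j = w then rc j else 0) +
        ∑ j ∈ Finset.range G.arcs, (if G.head j = w then rc (G.arcs + j) else 0) := by
      rw [← Finset.sum_add_distrib]
      refine Finset.sum_congr rfl fun j hj => ?_
      have hj := Finset.mem_range.1 hj
      have := hs.pair j (by rw [h.arcs]; omega)
      rw [h.pr j hj, h1 j hj] at this
      split_ifs <;> omega
    simp only [ite_self, add_zero] at hb
    omega

end ResNet

/-! ### Notation for programs and rules for their execution -/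

instance : Add Term := ⟨Term.add⟩
instance : Sub Term := ⟨Term.sub⟩

/-- The scalar variable that is kept in cell `0` of array `a`. -/
def Term.var (a : ℕ) : Term := Term.get a (Term.const 0)

/-- A term that is nonzero if and only if `x` and `y` differ. -/
def Term.differ (x y : Term) : Term := (x - y) + (y - x)

theorem eval_add (σ : Memory) (x y : Term) : (x + y).eval σ = x.eval σ + y.eval σ := rfl
theorem eval_sub (σ : Memory) (x y : Term) : (x - y).eval σ = x.eval σ - y.eval σ := rfl
theorem eval_const (σ : Memory) (k : ℕ) : (Term.const k).eval σ = k := rfl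
theorem eval_get (σ : Memory) (a : ℕ) (i : Term) : (Term.get a i).eval σ = σ a (i.eval σ) := rfl
theorem eval_var (σ : Memory) (a : ℕ) : (Term.var a).eval σ = σ a 0 := rfl
theorem eval_half (σ : Memory) (x : Term) : (Term.half x).eval σ = x.eval σ / 2 := rfl

theorem eval_differ (σ : Memory) (x y : Term) :
    (Term.differ x y).eval σ = 0 ↔ x.eval σ = y.eval σ := by
  simp only [Term.differ, eval_add, eval_sub]
  omega

/-- Assign a value to a scalar variable. -/
def Code.assign (a : ℕ) (x : Term) : Code := Code.set a (Term.const 0) x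

infixr:60 " ;; " => Code.seq

namespace Code

theorem exec_skip (σ : Memory) : skip.exec σ = σ := rfl
theorem exec_set (σ : Memory) (a : ℕ) (i x : Term) :
    (set a i x).exec σ = put σ a (i.eval σ) (x.eval σ) := rfl
theorem exec_assign (σ : Memory) (a : ℕ) (x : Term) :
    (assign a x).exec σ = put σ a 0 (x.eval σ) := rfl
theorem exec_seq (σ : Memory) (A B : Code) : (A ;; B).exec σ = B.exec (A.exec σ) := rfl
theorem exec_cond (σ : Memory) (x : Term) (A B : Code) :
    (cond x A B).exec σ = if x.eval σ ≠ 0 then A.exec σ else B.exec σ := rfl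

end Code

open Code Term

/-! ### The primal-dual method as a program

The residual network is kept in the arrays `30` (tails), `31` (heads), `32` and `33` (positive and
negative parts of the costs), `34` (residual capacities) and `35` (reversals), potentials in `36`,
the tree in `37` (ranks) and `38` (entering arcs). Array `10` holds loop counts, `12` the total cost
of all edges, `13` the sink, `14` the number of missing units, and `15` a flag that is set when the
potential of the sink has reached the penalty. -/

/-- The memory `σ` holds the network `R` and the penalty `M`. -/
structure Holds (R : ResNet) (M : ℕ) (σ : Memory) : Prop where
  tail : σ 30 = R.tail
  head : σ 31 = R.head
  cp : σ 32 = R.cp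
  cn : σ 33 = R.cn
  pr : σ 35 = R.pr
  source : σ 10 0 + σ 10 0 = R.source
  nodes : σ 10 3 = R.nodes
  arcs : σ 10 5 = R.arcs
  penalty : σ 12 0 + 1 = M
  sink : σ 13 0 = R.sink

theorem Holds.congr {R : ResNet} {M : ℕ} {σ τ : Memory} (h : Holds R M σ)
    (he : ∀ a ∈ [10, 12, 13, 30, 31, 32, 33, 35], τ a = σ a) : Holds R M τ := by
  simp only [List.mem_cons, List.not_mem_nil, or_false, forall_eq_or_imp, forall_eq] at he
  obtain ⟨h1, h2, h3, h4, h5, h6, h7, h8⟩ := he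
  exact ⟨h4 ▸ h.tail, h5 ▸ h.head, h6 ▸ h.cp, h7 ▸ h.cn, h8 ▸ h.pr, h1 ▸ h.source, h1 ▸ h.nodes,
    h1 ▸ h.arcs, h2 ▸ h.penalty, h3 ▸ h.sink⟩

theorem Holds.frame {R : ResNet} {M : ℕ} {σ τ : Memory} (h : Holds R M σ) (A : Code)
    (hfr : ∀ a, a ∉ A.writes → τ a = σ a)
    (hA : ∀ a ∈ [10, 12, 13, 30, 31, 32, 33, 35], a ∉ A.writes) : Holds R M τ :=
  h.congr fun a ha => hfr a (hA a ha)

theorem Holds.exec {R : ResNet} {M : ℕ} {σ : Memory} (h : Holds R M σ) (A : Code)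
    (hA : ∀ a ∈ [10, 12, 13, 30, 31, 32, 33, 35], a ∉ A.writes) : Holds R M (A.exec σ) :=
  h.frame A (fun _ ha => exec_frame A ha σ) hA

/-- The number of the source. -/
def sourceTerm : Term := get 10 (const 0) + get 10 (const 0)

/-- The reduced cost of the arc whose number is in variable `23`. -/
def redTerm : Term :=
  get 32 (var 23) + get 36 (get 30 (var 23)) - (get 33 (var 23) + get 36 (get 31 (var 23)))

/-- Keep arc `23` in variable `17`, and its reduced cost in `16`, if it is the best one so far. -/
def scanBody : Code :=
  cond (get 37 (get 30 (var 23)))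
    (cond (get 37 (get 31 (var 23))) skip
      (cond (get 34 (var 23))
        (cond (var 16 - redTerm)
          (assign 16 redTerm ;; assign 17 (var 23) ;; assign 18 (const 1)) skip) skip)) skip

theorem exec_scan {R : ResNet} {M : ℕ} {σ : Memory} (h : Holds R M σ) (h18 : σ 18 0 = 0) :
    let τ := (rep 23 10 5 scanBody).exec σ
    (∀ j < R.arcs, R.Cut (σ 34) (σ 37) j → τ 16 0 ≤ R.red (σ 36) j) ∧ τ 16 0 ≤ σ 16 0 ∧
      ((τ 18 0 = 0 ∧ τ 16 0 = σ 16 0) ∨ (τ 18 0 ≠ 0 ∧ τ 17 0 < R.arcs ∧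
        R.Cut (σ 34) (σ 37) (τ 17 0) ∧ τ 16 0 = R.red (σ 36) (τ 17 0))) := by
  intro τ
  have := exec_rep (A := scanBody) (c := 23) (b := 10) (k := 5) (σ := σ)
    (fun i τ => (∀ j < i, R.Cut (σ 34) (σ 37) j → τ 16 0 ≤ R.red (σ 36) j) ∧ τ 16 0 ≤ σ 16 0 ∧
      ((τ 18 0 = 0 ∧ τ 16 0 = σ 16 0) ∨ (τ 18 0 ≠ 0 ∧ τ 17 0 < R.arcs ∧
        R.Cut (σ 34) (σ 37) (τ 17 0) ∧ τ 16 0 = R.red (σ 36) (τ 17 0)))) (by decide)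
    (by simp [put_apply, h18]) ?_
  · rw [h.arcs] at this
    exact this
  · rintro i τ hi h23 hfr ⟨I1, I2, I3⟩
    have hτ := h.frame _ hfr (by decide)
    have e34 : τ 34 = σ 34 := hfr 34 (by decide)
    have e36 : τ 36 = σ 36 := hfr 36 (by decide)
    have e37 : τ 37 = σ 37 := hfr 37 (by decide)
    have hred : redTerm.eval τ = R.red (σ 36) i := by
      simp only [redTerm, eval_sub, eval_add, eval_get, eval_var, hτ.tail, hτ.head, hτ.cp, hτ.cn,
        e36, h23, ResNet.red]
    classical
    have hex : scanBody.exec τ = if R.Cut (σ 34) (σ 37) i ∧ R.red (σ 36) i < τ 16 0 then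
        put (put (put τ 16 0 (R.red (σ 36) i)) 17 0 i) 18 0 1 else τ := by
      simp only [scanBody, exec_cond, exec_seq, exec_assign, exec_skip, eval_get, eval_var,
        hτ.tail, hτ.head, h23, e34, e37, eval_sub, hred, eval_const, ResNet.Cut]
      have : put τ 16 0 (R.red (σ 36) i) 23 0 = i := by simp [put_apply, h23]
      rw [this]
      by_cases c1 : σ 37 (R.tail i) = 0
      · simp [c1]
      by_cases c2 : σ 37 (R.head i) = 0
      · by_cases c3 : σ 34 i = 0
        · simp [c3]
        · by_cases c4 : R.red (σ 36) i < τ 16 0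
          · simp [c1, c2, c3, c4, Nat.sub_eq_zero_iff_le]
          · simp [c1, c2, c3, c4, Nat.sub_eq_zero_of_le (not_lt.1 c4)]
      · simp [c2]
    rw [hex]
    have hiA : i < R.arcs := h.arcs ▸ hi
    split_ifs with hc
    · simp only [put_apply]
      norm_num
      refine ⟨fun j hj hcj => ?_, by omega, hiA, hc.1⟩
      rcases hj.lt_or_eq with h1 | rfl
      · exact hc.2.le.trans (I1 j h1 hcj)
      · exact le_rfl
    · simp only [put_apply]
      norm_num
      refine ⟨fun j hj hcj => ?_, I2, I3⟩
      rcases hj.lt_or_eq with h1 | rfl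
      · exact I1 j h1 hcj
      · by_contra hlt
        exact hc ⟨hcj, by omega⟩

/-- Raise the potentials of the nodes outside the tree by the amount in variable `16`. -/
def raiseLoop : Code :=
  rep 24 10 3 (cond (get 37 (var 24)) skip
    (set 36 (var 24) (get 36 (var 24) + var 16)))

theorem exec_raiseLoop {R : ResNet} {M : ℕ} {σ : Memory} (h : Holds R M σ) :
    raiseLoop.exec σ 36 = R.raise (σ 36) (σ 37) (σ 16 0) := by
  have := exec_rep (A := cond (get 37 (var 24)) skip
    (set 36 (var 24) (get 36 (var 24) + var 16))) (c := 24) (b := 10) (k := 3) (σ := σ)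
    (fun i τ => ∀ w, τ 36 w = if w < i ∧ σ 37 w = 0 then σ 36 w + σ 16 0 else σ 36 w) (by decide)
    (by simp [put_apply]) ?_
  · funext w
    have h2 := this w
    rw [h.nodes] at h2
    exact h2
  · intro i τ hi h24 hfr hI w
    have e16 : τ 16 = σ 16 := hfr 16 (by decide)
    have e37 : τ 37 = σ 37 := hfr 37 (by decide)
    simp only [exec_cond, exec_set, exec_skip, eval_get, eval_var, eval_add, h24, e16, e37]
    have h1 := hI w
    have h2 := hI i
    rcases eq_or_ne w i with rfl | hwi
    · by_cases hr : σ 37 w = 0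
      · simp [hr, put_apply, h1]
      · simp [hr, put_apply, h1]
    · have : w < i + 1 ↔ w < i := by omega
      simp only [this, ← h1]
      by_cases hr : σ 37 i = 0 <;> simp [hr, put_apply, hwi]

/-- Raise the potentials until a new residual arc leaves the tree without reduced cost, and add that
arc to the tree; if the potential of the sink reaches the penalty first, set the flag instead. -/
def growStep : Code :=
  cond (var 15 + get 37 (var 13)) skip
    (assign 16 (var 12 + const 1 - get 36 (var 13)) ;; assign 18 (const 0) ;;
      rep 23 10 5 scanBody ;; raiseLoop ;;
      cond (var 18)
        (set 37 (get 31 (var 17)) (var 22 + const 2) ;; set 38 (get 31 (var 17)) (var 17))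
        (assign 15 (const 1)))

/-- The state of the search after `i` steps. As long as it has not ended, every step adds a node to
the tree, so `R.nodes` steps suffice. The `i`-th step (counted from `0`) assigns rank `i + 2`. -/
structure Growing (R : ResNet) (M i : ℕ) (σ : Memory) : Prop where
  good : R.Good (σ 34) (σ 36)
  tree : R.Tree (σ 34) (σ 36) (σ 37) (σ 38)
  source : σ 36 R.source = 0
  sink_le : σ 36 R.sink ≤ M
  rk_lt : ∀ w < R.nodes, σ 37 w < i + 2
  progress : (σ 15 0 ≠ 0 ∧ σ 36 R.sink = M) ∨ (σ 15 0 = 0 ∧ σ 37 R.sink ≠ 0) ∨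
    (σ 15 0 = 0 ∧ σ 37 R.sink = 0 ∧
      ((Finset.range R.nodes).filter fun w => σ 37 w ≠ 0).card = i + 1)

theorem Growing.step {R : ResNet} (hR : R.Valid) {M i : ℕ} {σ : Memory} (hσ : Holds R M σ)
    (h22 : σ 22 0 = i) (h : Growing R M i σ) : Growing R M (i + 1) (growStep.exec σ) := by
  rw [growStep, exec_cond]
  simp only [eval_add, eval_var, eval_get, hσ.sink, exec_skip]
  split_ifs with hc
  · refine ⟨h.good, h.tree, h.source, h.sink_le, fun w hw => (h.rk_lt w hw).trans (by omega), ?_⟩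
    rcases h.progress with h1 | h1 | h1
    · exact Or.inl h1
    · exact Or.inr (Or.inl h1)
    · omega
  have h15 : σ 15 0 = 0 := by omega
  have hsink : σ 37 R.sink = 0 := by omega
  have hcard : ((Finset.range R.nodes).filter fun w => σ 37 w ≠ 0).card = i + 1 := by
    rcases h.progress with h1 | h1 | h1
    · exact absurd h15 h1.1
    · exact absurd hsink h1.2
    · exact h1.2.2
  simp only [exec_seq]
  set σ₁ := (assign 18 (const 0)).exec
    ((assign 16 (var 12 + const 1 - get 36 (var 13))).exec σ) with hσ₁
  have fr₁ : ∀ a, a ≠ 16 → a ≠ 18 → σ₁ a = σ a := by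
    intro a h1 h2
    simp only [hσ₁, exec_assign, put_ne h1, put_ne h2]
  have e16 : σ₁ 16 0 = M - σ 36 R.sink := by
    simp [hσ₁, exec_assign, put_apply, eval_sub, eval_add, eval_var, eval_get, eval_const,
      hσ.sink, ← hσ.penalty]
  have e18 : σ₁ 18 0 = 0 := by simp [hσ₁, exec_assign, put_apply, eval_const]
  have H₁ : Holds R M σ₁ := hσ.congr (by simp [fr₁])
  obtain ⟨s1, s2, s3⟩ := exec_scan H₁ e18
  set σ₂ := (rep 23 10 5 scanBody).exec σ₁ with hσ₂
  have fr₂ : ∀ a, a ∉ (rep 23 10 5 scanBody).writes → σ₂ a = σ₁ a := fun a ha =>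
    exec_frame _ ha σ₁
  have H₂ : Holds R M σ₂ := H₁.exec _ (by decide)
  have e36 := exec_raiseLoop H₂
  set σ₃ := raiseLoop.exec σ₂ with hσ₃
  have fr₃ : ∀ a, a ∉ raiseLoop.writes → σ₃ a = σ₂ a := fun a ha => exec_frame _ ha σ₂
  have H₃ : Holds R M σ₃ := H₂.exec _ (by decide)
  rw [fr₁ 34 (by decide) (by decide), fr₁ 36 (by decide) (by decide),
    fr₁ 37 (by decide) (by decide)] at s1 s3
  rw [fr₂ 36 (by decide), fr₂ 37 (by decide), fr₁ 36 (by decide) (by decide),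
    fr₁ 37 (by decide) (by decide)] at e36
  have t34 : σ₃ 34 = σ 34 := by
    rw [fr₃ 34 (by decide), fr₂ 34 (by decide), fr₁ 34 (by decide) (by decide)]
  have t37 : σ₃ 37 = σ 37 := by
    rw [fr₃ 37 (by decide), fr₂ 37 (by decide), fr₁ 37 (by decide) (by decide)]
  have t38 : σ₃ 38 = σ 38 := by
    rw [fr₃ 38 (by decide), fr₂ 38 (by decide), fr₁ 38 (by decide) (by decide)]
  have t15 : σ₃ 15 = σ 15 := by
    rw [fr₃ 15 (by decide), fr₂ 15 (by decide), fr₁ 15 (by decide) (by decide)]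
  have t22 : σ₃ 22 0 = i := by
    rw [fr₃ 22 (by decide), fr₂ 22 (by decide), fr₁ 22 (by decide) (by decide), h22]
  have t17 : σ₃ 17 = σ₂ 17 := fr₃ 17 (by decide)
  have t18 : σ₃ 18 = σ₂ 18 := fr₃ 18 (by decide)
  have hgood := h.good.raise hR s1
  have hsrc : R.raise (σ 36) (σ 37) (σ₂ 16 0) R.source = 0 := by
    rw [ResNet.raise_of_ne (by rw [h.tree.root]; decide), h.source]
  have hsnk : R.raise (σ 36) (σ 37) (σ₂ 16 0) R.sink = σ 36 R.sink + σ₂ 16 0 :=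
    ResNet.raise_of_eq hR.sink_lt hsink
  have hle := h.sink_le
  simp only [exec_cond, exec_seq, exec_set, exec_assign, eval_var, eval_get, eval_add, eval_const,
    H₃.head, t17, t18, t22]
  split_ifs with hf
  · obtain ⟨-, hj, hcut, hred⟩ := s3.resolve_left (fun hn => hf hn.1)
    set j := σ₂ 17 0 with hjdef
    have hbest : put σ₃ 37 (R.head j) (i + 2) 17 0 = j := by
      simp [put_apply, t17, hjdef]
    have hhd : put σ₃ 37 (R.head j) (i + 2) 31 = R.head := by
      rw [put_ne (by decide), H₃.head]
    rw [hbest, hhd]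
    have u34 : put (put σ₃ 37 (R.head j) (i + 2)) 38 (R.head j) j 34 = σ 34 := by
      rw [put_ne (by decide), put_ne (by decide), t34]
    have u36 : put (put σ₃ 37 (R.head j) (i + 2)) 38 (R.head j) j 36 =
        R.raise (σ 36) (σ 37) (σ₂ 16 0) := by
      rw [put_ne (by decide), put_ne (by decide), e36]
    have u37 : put (put σ₃ 37 (R.head j) (i + 2)) 38 (R.head j) j 37 =
        Function.update (σ 37) (R.head j) (i + 2) := by
      rw [put_ne (by decide), put_same, t37]
    have u38 : put (put σ₃ 37 (R.head j) (i + 2)) 38 (R.head j) j 38 =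
        Function.update (σ 38) (R.head j) j := by
      rw [put_same, put_ne (by decide), t38]
    have u15 : put (put σ₃ 37 (R.head j) (i + 2)) 38 (R.head j) j 15 = σ 15 := by
      rw [put_ne (by decide), put_ne (by decide), t15]
    refine ⟨?_, ?_, ?_, ?_, ?_, ?_⟩
    · rw [u34, u36]; exact hgood
    · rw [u34, u36, u37, u38, hred]
      exact h.tree.extend hR h.good hj hcut h.rk_lt
    · rw [u36]; exact hsrc
    · rw [u36, hsnk]; omega
    · intro w hw
      rw [u37, Function.update_apply]
      have := h.rk_lt w hw
      split_ifs <;> omega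
    · right
      rw [u15, u37]
      by_cases hw : Function.update (σ 37) (R.head j) (i + 2) R.sink = 0
      · right
        refine ⟨h15, hw, ?_⟩
        have : ((Finset.range R.nodes).filter fun w =>
            Function.update (σ 37) (R.head j) (i + 2) w ≠ 0) =
            insert (R.head j) ((Finset.range R.nodes).filter fun w => σ 37 w ≠ 0) := by
          ext w
          simp only [Finset.mem_filter, Finset.mem_range, Finset.mem_insert]
          rcases eq_or_ne w (R.head j) with rfl | hne
          · simp [hR.head_lt j hj]
          · simp [hne]
        rw [this, Finset.card_insert_of_notMem (by simp [hcut.2.1]), hcard]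
      · exact Or.inl ⟨h15, hw⟩
  · have hδ : σ₂ 16 0 = M - σ 36 R.sink := by
      rcases s3 with h1 | h1
      · rw [h1.2, e16]
      · exact absurd h1.1 hf
    have u : ∀ a, a ≠ 15 → put σ₃ 15 0 1 a = σ₃ a := fun a ha => put_ne ha _ _ _
    refine ⟨?_, ?_, ?_, ?_, ?_, ?_⟩
    · rw [u 34 (by decide), u 36 (by decide), t34, e36]; exact hgood
    · rw [u 34 (by decide), u 36 (by decide), u 37 (by decide), u 38 (by decide), t34, t37, t38,
        e36]
      exact h.tree.raise _
    · rw [u 36 (by decide), e36, hsrc]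
    · rw [u 36 (by decide), e36, hsnk]; omega
    · intro w hw
      rw [u 37 (by decide), t37]
      exact (h.rk_lt w hw).trans (by omega)
    · left
      rw [u 36 (by decide), e36, hsnk]
      exact ⟨by simp [put_apply], by omega⟩

/-- Send one unit through the tree arc that enters node `19`, and go to its tail. -/
def augmentBody : Code :=
  cond (differ (var 19) sourceTerm)
    (assign 20 (get 38 (var 19)) ;; set 34 (var 20) (get 34 (var 20) - const 1) ;;
      set 34 (get 35 (var 20)) (get 34 (get 35 (var 20)) + const 1) ;;
      assign 19 (get 30 (var 20))) skip

theorem exec_augmentLoop {R : ResNet} (hR : R.Valid) {M F : ℕ} {σ : Memory} {rc₀ : ℕ → ℕ}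
    (hσ : Holds R M σ) (hT : R.Tree (σ 34) (σ 36) (σ 37) (σ 38)) (hg : R.Good (σ 34) (σ 36))
    (hs : R.Sent rc₀ (σ 34) F 0 R.source) (hr : σ 37 R.sink ≠ 0)
    (hrk : σ 37 R.sink ≤ R.nodes + 1) (h19 : σ 19 0 = R.sink) :
    let τ := (rep 25 10 3 augmentBody).exec σ
    R.Sent rc₀ (τ 34) (F + 1) 0 R.source ∧ R.Good (τ 34) (σ 36) := by
  intro τ
  have key := exec_rep (A := augmentBody) (c := 25) (b := 10) (k := 3) (σ := σ)
    (fun i τ => R.Augmenting rc₀ (τ 34) (σ 36) (σ 37) (σ 38) F (τ 19 0) ∧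
      (τ 19 0 = R.source ∨ σ 37 (τ 19 0) + i ≤ R.nodes + 1)) (by decide) ?_ ?_
  · obtain ⟨h1, h2⟩ := key
    have h3 : τ 19 0 = R.source := by
      rcases h2 with h2 | h2
      · exact h2
      · -- only the source has rank `1`
        by_contra hne
        rw [hσ.nodes] at h2
        have h4 := hT.rk_tail_lt _ h1.lt h1.rk_ne hne
        have h5 := hT.rk_tail_ne _ h1.lt h1.rk_ne hne
        omega
    have h4 : R.Sent rc₀ (τ 34) F 1 (τ 19 0) := h1.sent
    rw [h3] at h4
    exact ⟨h4.finish, h1.good⟩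
  · rw [put_ne (by decide), put_ne (by decide), h19]
    exact ⟨ResNet.Augmenting.start hs hg hT hR.sink_lt hr, Or.inr (by omega)⟩
  · rintro i τ hi h25 hfr ⟨I1, I2⟩
    have hτ := hσ.frame _ hfr (by decide)
    have e38 : τ 38 = σ 38 := hfr 38 (by decide)
    rw [put_ne (by decide), put_ne (by decide), augmentBody, exec_cond]
    have hd : (differ (var 19) sourceTerm).eval τ = 0 ↔ τ 19 0 = R.source := by
      rw [eval_differ, ← hτ.source]
      rfl
    by_cases hu : τ 19 0 = R.source
    · rw [if_neg (by simpa using hd.2 hu), exec_skip]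
      exact ⟨I1, Or.inl hu⟩
    · rw [if_pos (fun h => hu (hd.1 h))]
      have hstep := I1.step hR hT hu
      set j := σ 38 (τ 19 0) with hj
      have hjlt : j < R.arcs := hT.par_lt _ I1.lt I1.rk_ne hu
      set τ' := (assign 20 (get 38 (var 19)) ;; set 34 (var 20) (get 34 (var 20) - const 1) ;;
        set 34 (get 35 (var 20)) (get 34 (get 35 (var 20)) + const 1) ;;
        assign 19 (get 30 (var 20))).exec τ with hτ'
      have e34 : τ' 34 = R.push (τ 34) j := by
        funext w
        have hne := hR.pr_ne j hjlt
        simp [hτ', exec_seq, exec_set, exec_assign, eval_get, eval_var, eval_sub, eval_add,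
          eval_const, put_apply, e38, ← hj, hτ.pr, ResNet.push, Function.update_apply, hne]
      have e19 : τ' 19 0 = R.tail j := by
        simp [hτ', exec_seq, exec_set, exec_assign, eval_get, eval_var, eval_sub, eval_add,
          eval_const, put_apply, e38, ← hj, hτ.tail]
      rw [e34, e19]
      refine ⟨hstep, Or.inr ?_⟩
      have h1 := hT.rk_tail_lt _ I1.lt I1.rk_ne hu
      rw [← hj] at h1
      rcases I2 with I2 | I2
      · exact absurd I2 hu
      · omega

/-- Start the search with the tree that consists of the source. -/
def resetTree : Code :=
  rep 26 10 3 (set 37 (var 26) (const 0)) ;; set 37 sourceTerm (const 1)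

theorem exec_resetTree {R : ResNet} {M : ℕ} {σ : Memory} (hσ : Holds R M σ) :
    ∀ w < R.nodes, resetTree.exec σ 37 w = if w = R.source then 1 else 0 := by
  have key := exec_rep (A := set 37 (var 26) (const 0)) (c := 26) (b := 10) (k := 3) (σ := σ)
    (fun i τ => ∀ w < i, τ 37 w = 0) (by decide) (by simp) ?_
  · intro w hw
    have hτ : Holds R M ((rep 26 10 3 (set 37 (var 26) (const 0))).exec σ) :=
      hσ.exec _ (by decide)
    rw [resetTree, exec_seq, exec_set, put_apply]
    have hs : sourceTerm.eval ((rep 26 10 3 (set 37 (var 26) (const 0))).exec σ) = R.source := by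
      rw [← hτ.source]; rfl
    rw [hs, key w (by rwa [hσ.nodes])]
    simp [eval_const]
  · intro i τ hi h26 hfr hI w hw
    rw [put_ne (by decide), exec_set, put_apply, eval_var, h26, eval_const]
    split_ifs with h
    · rfl
    · exact hI w (by omega)

/-- Search for a path to the sink and augment along it. -/
def round : Code :=
  cond (var 15) skip (cond (var 14)
    (resetTree ;; rep 22 10 3 growStep ;; cond (var 15) skip
      (assign 19 (var 13) ;; rep 25 10 3 augmentBody ;; assign 14 (var 14 - const 1))) skip)

/-- The state between augmentations: `F` of `r` units have been sent. -/
structure Solving (R : ResNet) (M : ℕ) (rc₀ : ℕ → ℕ) (r F : ℕ) (σ : Memory) : Prop where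
  good : R.Good (σ 34) (σ 36)
  source : σ 36 R.source = 0
  sink_le : σ 36 R.sink ≤ M
  sent : R.Sent rc₀ (σ 34) F 0 R.source
  total : F + σ 14 0 = r
  flag : σ 15 0 ≠ 0 → σ 36 R.sink = M

theorem Growing.start {R : ResNet} (hR : R.Valid) {M r F : ℕ} {rc₀ : ℕ → ℕ} {σ τ : Memory}
    (h : Solving R M rc₀ r F σ) (h15 : σ 15 0 = 0)
    (hτ : ∀ w < R.nodes, τ 37 w = if w = R.source then 1 else 0)
    (h34 : τ 34 = σ 34) (h36 : τ 36 = σ 36) (h15' : τ 15 = σ 15) :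
    Growing R M 0 τ := by
  have hz : ∀ w < R.nodes, τ 37 w ≠ 0 → w ≠ R.source → False := fun w hw h1 h2 => by
    rw [hτ w hw, if_neg h2] at h1
    exact h1 rfl
  refine ⟨h34 ▸ h36 ▸ h.good, ⟨?_, fun w hw h1 h2 => (hz w hw h1 h2).elim,
    fun w hw h1 h2 => (hz w hw h1 h2).elim, fun w hw h1 h2 => (hz w hw h1 h2).elim,
    fun w hw h1 h2 => (hz w hw h1 h2).elim, fun w hw h1 h2 => (hz w hw h1 h2).elim,
    fun w hw h1 h2 => (hz w hw h1 h2).elim⟩, h36 ▸ h.source, h36 ▸ h.sink_le, ?_, ?_⟩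
  · rw [hτ _ hR.source_lt, if_pos rfl]
  · intro w hw
    rw [hτ w hw]
    split_ifs <;> omega
  · right; right
    refine ⟨by rw [h15', h15], by rw [hτ _ hR.sink_lt, if_neg hR.sink_ne], ?_⟩
    have : ((Finset.range R.nodes).filter fun w => τ 37 w ≠ 0) = {R.source} := by
      ext w
      simp only [Finset.mem_filter, Finset.mem_range, Finset.mem_singleton]
      constructor
      · rintro ⟨h1, h2⟩
        by_contra h3
        exact hz w h1 h2 h3
      · rintro rfl
        exact ⟨hR.source_lt, by rw [hτ _ hR.source_lt, if_pos rfl]; decide⟩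
    rw [this, Finset.card_singleton]

theorem Solving.round {R : ResNet} (hR : R.Valid) {M r F : ℕ} {rc₀ : ℕ → ℕ} {σ : Memory}
    (hσ : Holds R M σ) (h : Solving R M rc₀ r F σ) :
    ∃ F', Solving R M rc₀ r F' (round.exec σ) ∧ (round.exec σ 15 0 ≠ 0 ∨ round.exec σ 14 0 = 0 ∨
      F' = F + 1) := by
  unfold SSL.round
  rw [exec_cond, eval_var]
  by_cases h15 : σ 15 0 = 0
  swap
  · rw [if_pos h15, exec_skip]
    exact ⟨F, h, Or.inl h15⟩
  rw [if_neg (by simpa using h15), exec_cond, eval_var]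
  by_cases h14 : σ 14 0 = 0
  · rw [if_neg (by simpa using h14), exec_skip]
    exact ⟨F, h, Or.inr (Or.inl h14)⟩
  rw [if_pos h14, exec_seq, exec_seq]
  set σ₁ := resetTree.exec σ with hσ₁
  have H₁ : Holds R M σ₁ := hσ.exec _ (by decide)
  have f₁ : ∀ a, a ∉ resetTree.writes → σ₁ a = σ a := fun a ha => exec_frame _ ha σ
  have G₁ := Growing.start hR h h15 (exec_resetTree hσ) (f₁ 34 (by decide)) (f₁ 36 (by decide))
    (f₁ 15 (by decide))
  set σ₂ := (rep 22 10 3 growStep).exec σ₁ with hσ₂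
  have H₂ : Holds R M σ₂ := H₁.exec _ (by decide)
  have f₂ : ∀ a, a ∉ (rep 22 10 3 growStep).writes → σ₂ a = σ₁ a := fun a ha => exec_frame _ ha σ₁
  have G₂ : Growing R M R.nodes σ₂ := by
    have := exec_rep (A := growStep) (c := 22) (b := 10) (k := 3) (σ := σ₁)
      (fun i τ => Growing R M i τ) (by decide) ?_ ?_
    · rwa [H₁.nodes] at this
    · have : ∀ a, a ≠ 22 → put σ₁ 22 0 0 a = σ₁ a := fun a ha => put_ne ha _ _ _
      refine ⟨?_, ?_, ?_, ?_, ?_, ?_⟩ <;>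
        simp only [this 34 (by decide), this 36 (by decide), this 37 (by decide),
          this 38 (by decide), this 15 (by decide)]
      exacts [G₁.good, G₁.tree, G₁.source, G₁.sink_le, G₁.rk_lt, G₁.progress]
    · intro i τ hi h22 hfr hI
      have hτ := H₁.frame _ hfr (by decide)
      have G := hI.step hR hτ h22
      have : ∀ a, a ≠ 22 → put (growStep.exec τ) 22 0 (i + 1) a = growStep.exec τ a :=
        fun a ha => put_ne ha _ _ _
      refine ⟨?_, ?_, ?_, ?_, ?_, ?_⟩ <;>
        simp only [this 34 (by decide), this 36 (by decide), this 37 (by decide),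
          this 38 (by decide), this 15 (by decide)]
      exacts [G.good, G.tree, G.source, G.sink_le, G.rk_lt, G.progress]
  have hsent : R.Sent rc₀ (σ₂ 34) F 0 R.source := by
    rw [f₂ 34 (by decide), f₁ 34 (by decide)]; exact h.sent
  have htot : F + σ₂ 14 0 = r := by
    rw [f₂ 14 (by decide), f₁ 14 (by decide)]; exact h.total
  have h14' : σ₂ 14 0 ≠ 0 := by
    rw [f₂ 14 (by decide), f₁ 14 (by decide)]; exact h14
  rw [exec_cond, eval_var]
  by_cases h15₂ : σ₂ 15 0 = 0
  swap
  · rw [if_pos h15₂, exec_skip]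
    refine ⟨F, ⟨G₂.good, G₂.source, G₂.sink_le, hsent, htot, fun _ => ?_⟩, Or.inl h15₂⟩
    rcases G₂.progress with h1 | h1 | h1
    · exact h1.2
    · exact absurd h1.1 h15₂
    · exact absurd h1.1 h15₂
  rw [if_neg (by simpa using h15₂), exec_seq, exec_seq, exec_assign, exec_assign]
  have hreach : σ₂ 37 R.sink ≠ 0 := by
    rcases G₂.progress with h1 | h1 | h1
    · exact absurd h15₂ h1.1
    · exact h1.2
    · have := Finset.card_filter_le (Finset.range R.nodes) fun w => σ₂ 37 w ≠ 0
      rw [h1.2.2, Finset.card_range] at this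
      omega
  have hrk := G₂.rk_lt _ hR.sink_lt
  set σ₃ := put σ₂ 19 0 ((var 13).eval σ₂) with hσ₃
  have f₃ : ∀ a, a ≠ 19 → σ₃ a = σ₂ a := fun a ha => put_ne ha _ _ _
  have H₃ : Holds R M σ₃ := H₂.congr (by simp [f₃])
  have e19 : σ₃ 19 0 = R.sink := by
    rw [hσ₃, put_apply, if_pos ⟨rfl, rfl⟩, eval_var, H₂.sink]
  have A := exec_augmentLoop hR (F := F) (rc₀ := rc₀) H₃
    (by rw [f₃ 34 (by decide), f₃ 36 (by decide), f₃ 37 (by decide), f₃ 38 (by decide)]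
        exact G₂.tree)
    (by rw [f₃ 34 (by decide), f₃ 36 (by decide)]; exact G₂.good)
    (by rw [f₃ 34 (by decide)]; exact hsent) (by rw [f₃ 37 (by decide)]; exact hreach)
    (by rw [f₃ 37 (by decide)]; omega) e19
  set σ₄ := (rep 25 10 3 augmentBody).exec σ₃ with hσ₄
  have f₄ : ∀ a, a ∉ (rep 25 10 3 augmentBody).writes → σ₄ a = σ₃ a :=
    fun a ha => exec_frame _ ha σ₃
  obtain ⟨A1, A2⟩ := A
  have e36 : σ₄ 36 = σ₂ 36 := by rw [f₄ 36 (by decide), f₃ 36 (by decide)]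
  rw [f₃ 36 (by decide)] at A2
  have e15 : σ₄ 15 = σ₂ 15 := by rw [f₄ 15 (by decide), f₃ 15 (by decide)]
  have e14 : σ₄ 14 = σ₂ 14 := by rw [f₄ 14 (by decide), f₃ 14 (by decide)]
  have f₅ : ∀ a, a ≠ 14 → put σ₄ 14 0 ((var 14 - const 1).eval σ₄) a = σ₄ a :=
    fun a ha => put_ne ha _ _ _
  refine ⟨F + 1, ⟨?_, ?_, ?_, ?_, ?_, ?_⟩, Or.inr (Or.inr rfl)⟩
  · rw [f₅ 34 (by decide), f₅ 36 (by decide), e36]; exact A2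
  · rw [f₅ 36 (by decide), e36]; exact G₂.source
  · rw [f₅ 36 (by decide), e36]; exact G₂.sink_le
  · rw [f₅ 34 (by decide)]; exact A1
  · rw [put_apply, if_pos ⟨rfl, rfl⟩, eval_sub, eval_var, eval_const, e14]
    omega
  · rw [f₅ 15 (by decide), e15]
    exact fun hne => absurd h15₂ hne

/-- As there are more rounds than units that the sink can receive, the method ends with an optimal
flow: no unit is missing, or the potential of the sink equals the penalty. -/
theorem Solving.rounds {R : ResNet} (hR : R.Valid) {M r : ℕ} {rc₀ : ℕ → ℕ} {σ : Memory}
    (hσ : Holds R M σ) (h : Solving R M rc₀ r 0 σ) (hcap : R.resIn rc₀ R.sink < σ 10 4) :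
    let τ := (rep 27 10 4 SSL.round).exec σ
    ∃ F, Solving R M rc₀ r F τ ∧ (τ 14 0 = 0 ∨ τ 36 R.sink = M) := by
  intro τ
  have key := exec_rep (A := SSL.round) (c := 27) (b := 10) (k := 4) (σ := σ)
    (fun i τ => ∃ F, Solving R M rc₀ r F τ ∧ (τ 15 0 ≠ 0 ∨ τ 14 0 = 0 ∨ F = i)) (by decide) ?_ ?_
  · obtain ⟨F, h1, h2⟩ := key
    refine ⟨F, h1, ?_⟩
    rcases h2 with h2 | h2 | h2
    · exact Or.inr (h1.flag h2)
    · exact Or.inl h2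
    · have := h1.sent.le_resIn hR.sink_ne
      omega
  · have f : ∀ a, a ≠ 27 → put σ 27 0 0 a = σ a := fun a ha => put_ne ha _ _ _
    refine ⟨0, ⟨?_, ?_, ?_, ?_, ?_, ?_⟩, Or.inr (Or.inr rfl)⟩ <;>
      simp only [f 34 (by decide), f 36 (by decide), f 14 (by decide), f 15 (by decide)]
    exacts [h.good, h.source, h.sink_le, h.sent, h.total, h.flag]
  · rintro i τ hi h27 hfr ⟨F, h1, h2⟩
    have hτ := hσ.frame _ hfr (by decide)
    have f : ∀ a, a ≠ 27 → put (SSL.round.exec τ) 27 0 (i + 1) a = SSL.round.exec τ a :=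
      fun a ha => put_ne ha _ _ _
    rw [f 15 (by decide), f 14 (by decide)]
    obtain ⟨F', h3, h4⟩ : ∃ F', Solving R M rc₀ r F' (SSL.round.exec τ) ∧
        (SSL.round.exec τ 15 0 ≠ 0 ∨ SSL.round.exec τ 14 0 = 0 ∨ F' = i + 1) := by
      by_cases hst : τ 15 0 ≠ 0 ∨ τ 14 0 = 0
      · have hex : SSL.round.exec τ = τ := by
          unfold SSL.round
          rw [exec_cond, eval_var]
          by_cases h15 : τ 15 0 = 0
          · have h14 := hst.resolve_left (by simpa using h15)
            rw [if_neg (by simpa using h15), exec_cond, eval_var, if_neg (by simpa using h14),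
              exec_skip]
          · rw [if_pos h15, exec_skip]
        rw [hex]
        exact ⟨F, h1, by tauto⟩
      · have hF : F = i := by tauto
        obtain ⟨F', h3, h4⟩ := h1.round hR hτ
        exact ⟨F', h3, by rw [← hF]; exact h4⟩
    refine ⟨F', ⟨?_, ?_, ?_, ?_, ?_, ?_⟩, h4⟩ <;>
      simp only [f 34 (by decide), f 36 (by decide), f 14 (by decide), f 15 (by decide)]
    exacts [h3.good, h3.source, h3.sink_le, h3.sent, h3.total, h3.flag]

/-! ### Multiplication -/

/-- Multiply variable `40` by variable `41`, whose binary length must be at most cell `2` of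
array `10`; the product is in variable `42`. -/
def mul : Code :=
  assign 42 (const 0) ;; rep 43 10 2
    (cond (var 41 - half (var 41) - half (var 41)) (assign 42 (var 42 + var 40)) skip ;;
      assign 40 (var 40 + var 40) ;; assign 41 (half (var 41)))

theorem exec_mul {σ : Memory} (h : σ 41 0 < 2 ^ σ 10 2) :
    mul.exec σ 42 0 = σ 40 0 * σ 41 0 := by
  rw [mul, exec_seq]
  set σ₁ := (assign 42 (const 0)).exec σ with hσ₁
  have f₁ : ∀ a, a ≠ 42 → σ₁ a = σ a := fun a ha => put_ne ha _ _ _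
  have key := exec_rep (A := cond (var 41 - half (var 41) - half (var 41))
      (assign 42 (var 42 + var 40)) skip ;;
      assign 40 (var 40 + var 40) ;; assign 41 (half (var 41))) (c := 43) (b := 10) (k := 2)
    (σ := σ₁) (fun i τ => τ 42 0 + τ 40 0 * τ 41 0 = σ 40 0 * σ 41 0 ∧ τ 41 0 = σ 41 0 / 2 ^ i)
    (by decide) ?_ ?_
  · obtain ⟨h1, h2⟩ := key
    rw [f₁ 10 (by decide), Nat.div_eq_of_lt h] at h2
    rw [h2, mul_zero, add_zero] at h1
    exact h1
  · simp [put_apply, hσ₁, exec_assign, eval_const]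
  · rintro i τ hi h43 hfr ⟨I1, I2⟩
    have hodd : τ 41 0 = 2 * (τ 41 0 / 2) + (τ 41 0 - τ 41 0 / 2 - τ 41 0 / 2) := by omega
    have h2 : τ 41 0 / 2 = σ 41 0 / 2 ^ (i + 1) := by
      rw [I2, Nat.div_div_eq_div_mul, pow_succ]
    have hbit : (var 41 - half (var 41) - half (var 41)).eval τ =
        τ 41 0 - τ 41 0 / 2 - τ 41 0 / 2 := rfl
    rw [exec_seq, exec_cond, ← h2, ← I1]
    obtain h0 | h1 : τ 41 0 - τ 41 0 / 2 - τ 41 0 / 2 = 0 ∨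
      τ 41 0 - τ 41 0 / 2 - τ 41 0 / 2 = 1 := by omega
    · rw [if_neg (by omega)]
      rw [h0] at hodd
      simp only [exec_seq, exec_assign, exec_skip, eval_add, eval_var, eval_half, put_apply]
      norm_num
      conv_rhs => rw [hodd]
      ring
    · rw [if_pos (by omega)]
      rw [h1] at hodd
      simp only [exec_seq, exec_assign, eval_add, eval_var, eval_half, put_apply]
      norm_num
      conv_rhs => rw [hodd]
      ring

/-! ### Building the network -/

/-- The arrays `0` to `8` hold the instance; the loop counts and the total edge cost have been
computed, and cell `2` of array `10` bounds the binary lengths of demands and node costs. -/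
structure Loaded (I : Instance) (σ : Memory) : Prop where
  params : σ 0 = I.input 0
  src : σ 1 = I.input 1
  tgt : σ 2 = I.input 2
  edgeCost : σ 3 = I.input 3
  nodeCost : σ 4 = I.input 4
  demand : σ 5 = I.input 5
  q : σ 6 = I.input 6
  p : σ 7 = I.input 7
  bound : σ 8 = I.input 8
  n : σ 10 0 = I.n
  m : σ 10 1 = I.m
  demand_lt : ∀ v, I.demand v < 2 ^ σ 10 2
  nodeCost_lt : ∀ v, I.nodeCost v < 2 ^ σ 10 2
  one_lt : 1 < 2 ^ σ 10 2
  nodes : σ 10 3 = I.n + I.n + 1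
  rounds : σ 10 4 = 2 * I.m + 1
  arcs : σ 10 5 = (I.m + I.m + I.n + I.n) + (I.m + I.m + I.n + I.n)
  half_arcs : σ 10 6 = I.m + I.m + I.n + I.n
  total : σ 12 0 = I.totalCost

theorem Loaded.congr {I : Instance} {σ τ : Memory} (h : Loaded I σ)
    (he : ∀ a ∈ [0, 1, 2, 3, 4, 5, 6, 7, 8, 10, 12], τ a = σ a) : Loaded I τ := by
  simp only [List.mem_cons, List.not_mem_nil, or_false, forall_eq_or_imp, forall_eq] at he
  obtain ⟨h0, h1, h2, h3, h4, h5, h6, h7, h8, h10, h12⟩ := he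
  exact ⟨h0 ▸ h.params, h1 ▸ h.src, h2 ▸ h.tgt, h3 ▸ h.edgeCost, h4 ▸ h.nodeCost, h5 ▸ h.demand,
    h6 ▸ h.q, h7 ▸ h.p, h8 ▸ h.bound, h10 ▸ h.n, h10 ▸ h.m, h10 ▸ h.demand_lt,
    h10 ▸ h.nodeCost_lt, h10 ▸ h.one_lt, h10 ▸ h.nodes, h10 ▸ h.rounds, h10 ▸ h.arcs,
    h10 ▸ h.half_arcs, h12 ▸ h.total⟩

theorem Loaded.frame {I : Instance} {σ τ : Memory} (h : Loaded I σ) (A : Code)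
    (hfr : ∀ a, a ∉ A.writes → τ a = σ a)
    (hA : ∀ a ∈ [0, 1, 2, 3, 4, 5, 6, 7, 8, 10, 12], a ∉ A.writes) : Loaded I τ :=
  h.congr fun a ha => hfr a (hA a ha)

theorem Loaded.exec {I : Instance} {σ : Memory} (h : Loaded I σ) (A : Code)
    (hA : ∀ a ∈ [0, 1, 2, 3, 4, 5, 6, 7, 8, 10, 12], a ∉ A.writes) : Loaded I (A.exec σ) :=
  h.frame A (fun _ ha => exec_frame _ ha σ) hA

/-- Arc `j` and its reversal are stored, without flow. -/
structure Stored (K j t h c cap : ℕ) (σ : Memory) : Prop where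
  tail : σ 30 j = t
  head : σ 31 j = h
  cp : σ 32 j = c
  cn : σ 33 j = 0
  rc : σ 34 j = cap
  pr : σ 35 j = K + j
  tail' : σ 30 (K + j) = h
  head' : σ 31 (K + j) = t
  cp' : σ 32 (K + j) = 0
  cn' : σ 33 (K + j) = c
  rc' : σ 34 (K + j) = 0
  pr' : σ 35 (K + j) = j

theorem Stored.congr {K j t h c cap : ℕ} {σ τ : Memory} (H : Stored K j t h c cap σ)
    (he : ∀ a ∈ [30, 31, 32, 33, 34, 35], τ a = σ a) : Stored K j t h c cap τ := by
  simp only [List.mem_cons, List.not_mem_nil, or_false, forall_eq_or_imp, forall_eq] at he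
  obtain ⟨h0, h1, h2, h3, h4, h5⟩ := he
  exact ⟨h0 ▸ H.tail, h1 ▸ H.head, h2 ▸ H.cp, h3 ▸ H.cn, h4 ▸ H.rc, h5 ▸ H.pr, h0 ▸ H.tail',
    h1 ▸ H.head', h2 ▸ H.cp', h3 ▸ H.cn', h4 ▸ H.rc', h5 ▸ H.pr'⟩

/-- Store arc `45` with tail `46`, head `47`, cost `48`, capacity `49`, and its reversal. -/
def storeArc : Code :=
  set 30 (var 45) (var 46) ;; set 30 (get 10 (const 6) + var 45) (var 47) ;;
  set 31 (var 45) (var 47) ;; set 31 (get 10 (const 6) + var 45) (var 46) ;;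
  set 32 (var 45) (var 48) ;; set 32 (get 10 (const 6) + var 45) (const 0) ;;
  set 33 (var 45) (const 0) ;; set 33 (get 10 (const 6) + var 45) (var 48) ;;
  set 34 (var 45) (var 49) ;; set 34 (get 10 (const 6) + var 45) (const 0) ;;
  set 35 (var 45) (get 10 (const 6) + var 45) ;; set 35 (get 10 (const 6) + var 45) (var 45)

theorem exec_storeArc (σ : Memory) (b i : ℕ) : storeArc.exec σ b i =
    if b = 30 then (if i = σ 10 6 + σ 45 0 then σ 47 0 else if i = σ 45 0 then σ 46 0 else σ b i)
    else if b = 31 then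
      (if i = σ 10 6 + σ 45 0 then σ 46 0 else if i = σ 45 0 then σ 47 0 else σ b i)
    else if b = 32 then
      (if i = σ 10 6 + σ 45 0 then 0 else if i = σ 45 0 then σ 48 0 else σ b i)
    else if b = 33 then
      (if i = σ 10 6 + σ 45 0 then σ 48 0 else if i = σ 45 0 then 0 else σ b i)
    else if b = 34 then
      (if i = σ 10 6 + σ 45 0 then 0 else if i = σ 45 0 then σ 49 0 else σ b i)
    else if b = 35 then (if i = σ 10 6 + σ 45 0 then σ 45 0 else
      if i = σ 45 0 then σ 10 6 + σ 45 0 else σ b i)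
    else σ b i := by
  simp only [storeArc, exec_seq, exec_set, eval_var, eval_add, eval_get, eval_const]
  by_cases h30 : b = 30
  · subst h30; simp [put_apply]
  by_cases h31 : b = 31
  · subst h31; simp [put_apply]
  by_cases h32 : b = 32
  · subst h32; simp [put_apply]
  by_cases h33 : b = 33
  · subst h33; simp [put_apply]
  by_cases h34 : b = 34
  · subst h34; simp [put_apply]
  by_cases h35 : b = 35
  · subst h35; simp [put_apply]
  simp [put_apply, h30, h31, h32, h33, h34, h35]

theorem stored_storeArc {σ : Memory} {K j : ℕ} (hK : σ 10 6 = K) (h45 : σ 45 0 = j) (hj : j < K) :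
    Stored K j (σ 46 0) (σ 47 0) (σ 48 0) (σ 49 0) (storeArc.exec σ) := by
  have hne : j ≠ K + j := by omega
  constructor <;> simp [exec_storeArc, hK, h45]
  all_goals omega

theorem Stored.storeArc {σ : Memory} {K i t h c cap : ℕ} (hK : σ 10 6 = K) (hi : i < K)
    (hne : i ≠ σ 45 0) (hj : σ 45 0 < K) (H : Stored K i t h c cap σ) :
    Stored K i t h c cap (storeArc.exec σ) := by
  have h1 : i ≠ K + σ 45 0 := by omega
  have h2 : K + i ≠ σ 45 0 := by omega
  constructor <;> simp [exec_storeArc, hK, h1, h2, hne, H.tail, H.head, H.cp, H.cn, H.rc, H.pr,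
    H.tail', H.head', H.cp', H.cn', H.rc', H.pr']

/-- Add an arc to the network. -/
def addArc (j t h c cap : Term) : Code :=
  assign 45 j ;; assign 46 t ;; assign 47 h ;; assign 48 c ;; assign 49 cap ;; storeArc

/-- The hypotheses say that the terms do not depend on the scratch variables `45` to `48`. -/
theorem exec_addArc {σ : Memory} {K J T H C Q : ℕ} {j t h c cap : Term} (hK : σ 10 6 = K)
    (hJ : J < K) (hj : j.eval σ = J) (ht : ∀ x, t.eval (put σ 45 0 x) = T)
    (hh : ∀ x y, h.eval (put (put σ 45 0 x) 46 0 y) = H)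
    (hc : ∀ x y z, c.eval (put (put (put σ 45 0 x) 46 0 y) 47 0 z) = C)
    (hq : ∀ x y z w, cap.eval (put (put (put (put σ 45 0 x) 46 0 y) 47 0 z) 48 0 w) = Q) :
    Stored K J T H C Q ((addArc j t h c cap).exec σ) ∧
      ∀ i t' h' c' q', i < K → i ≠ J → Stored K i t' h' c' q' σ →
        Stored K i t' h' c' q' ((addArc j t h c cap).exec σ) := by
  simp only [addArc, exec_seq, exec_assign, hj, ht, hh, hc, hq]
  set σ' := put (put (put (put (put σ 45 0 J) 46 0 T) 47 0 H) 48 0 C) 49 0 Q with hσ'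
  have e45 : σ' 45 0 = J := by simp [hσ', put_apply]
  have e46 : σ' 46 0 = T := by simp [hσ', put_apply]
  have e47 : σ' 47 0 = H := by simp [hσ', put_apply]
  have e48 : σ' 48 0 = C := by simp [hσ', put_apply]
  have e49 : σ' 49 0 = Q := by simp [hσ', put_apply]
  have e10 : σ' 10 6 = K := by simp [hσ', put_apply, hK]
  refine ⟨?_, fun i t' h' c' q' hi hne hS => ?_⟩
  · have := stored_storeArc e10 e45 hJ
    rwa [e46, e47, e48, e49] at this
  · refine Stored.storeArc e10 hi (by rwa [e45]) (by rwa [e45]) (hS.congr ?_)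
    intro a ha
    have : a ≠ 45 ∧ a ≠ 46 ∧ a ≠ 47 ∧ a ≠ 48 ∧ a ≠ 49 := by
      simp only [List.mem_cons, List.not_mem_nil, or_false] at ha
      omega
    simp [hσ', put_ne, this]

/-- Store both directions of edge `28`. -/
def edgeBody : Code :=
  addArc (var 28) (get 10 (const 0) + get 1 (var 28)) (get 2 (var 28)) (get 3 (var 28)) (const 1) ;;
  addArc (get 10 (const 1) + var 28) (get 10 (const 0) + get 2 (var 28)) (get 1 (var 28))
    (get 3 (var 28)) (const 1 - get 0 (const 2))

/-- Store the node arc and the supply arc of node `29`. -/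
def nodeBody : Code :=
  cond (differ (var 29) (var 13)) (assign 50 (get 6 (var 29))) (assign 50 (get 10 (const 4))) ;;
  cond (differ (var 29) (var 13))
    (cond (get 9 (var 29)) (assign 51 (get 7 (var 29))) (assign 51 (const 0)))
    (assign 51 (const 0)) ;;
  addArc (get 10 (const 1) + get 10 (const 1) + var 29) (var 29) (get 10 (const 0) + var 29)
    (const 0) (var 50) ;;
  addArc (get 10 (const 1) + get 10 (const 1) + get 10 (const 0) + var 29)
    (get 10 (const 0) + get 10 (const 0)) (var 29) (const 0) (var 51)

/-- Arc `j` of the network `G` is stored. -/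
def StoredIn (G : Net) (j : ℕ) (σ : Memory) : Prop :=
  Stored G.arcs j (G.tail j) (G.head j) (G.cost j) (G.cap j) σ

theorem StoredIn.put {G : Net} {j : ℕ} {σ : Memory} (h : StoredIn G j σ) {a : ℕ} (i x : ℕ)
    (ha : a ∉ [30, 31, 32, 33, 34, 35]) : StoredIn G j (put σ a i x) :=
  h.congr fun b hb => put_ne (by rintro rfl; exact ha hb) _ _ _

theorem exec_edgeBody {I : Instance} {σ : Memory} (hσ : Loaded I σ) (v : Fin I.n)
    (sup : Fin I.n → ℕ) (e : Fin I.m) (h28 : σ 28 0 = e) :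
    StoredIn (I.net v sup) e (edgeBody.exec σ) ∧
      StoredIn (I.net v sup) (I.m + e) (edgeBody.exec σ) ∧
      ∀ j < (I.net v sup).arcs, j ≠ e → j ≠ I.m + e → StoredIn (I.net v sup) j σ →
        StoredIn (I.net v sup) j (edgeBody.exec σ) := by
  have hsrc : σ 1 e = I.src e := by rw [hσ.src]; exact toArray_val (fun e => (I.src e : ℕ)) e
  have htgt : σ 2 e = I.tgt e := by rw [hσ.tgt]; exact toArray_val (fun e => (I.tgt e : ℕ)) e
  have hcost : σ 3 e = I.edgeCost e := by rw [hσ.edgeCost]; exact toArray_val _ e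
  have hdir : 1 - σ 0 2 = if I.directed then 0 else 1 := by
    rw [hσ.params]
    cases h : I.directed <;> simp [Instance.input, toArray, h]
  have hle : (e : ℕ) < I.m + I.m + I.n + I.n := by omega
  have hle2 : I.m + (e : ℕ) < I.m + I.m + I.n + I.n := by omega
  have A1 := exec_addArc (σ := σ) (j := var 28) (t := get 10 (const 0) + get 1 (var 28))
    (h := get 2 (var 28)) (c := get 3 (var 28)) (cap := const 1) hσ.half_arcs hle
    (T := I.n + I.src e) (H := I.tgt e) (C := I.edgeCost e) (Q := 1)
    (by simp [eval_var, h28])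
    (by simp [eval_add, eval_get, eval_var, eval_const, put_apply, hσ.n, h28, hsrc])
    (by simp [eval_get, eval_var, put_apply, h28, htgt])
    (by simp [eval_get, eval_var, put_apply, h28, hcost])
    (by simp [eval_const])
  rw [edgeBody, exec_seq]
  set σ₁ := (addArc (var 28) (get 10 (const 0) + get 1 (var 28)) (get 2 (var 28))
    (get 3 (var 28)) (const 1)).exec σ with hσ₁
  have f₁ : ∀ a, a ∉ (addArc (var 28) (get 10 (const 0) + get 1 (var 28)) (get 2 (var 28))
    (get 3 (var 28)) (const 1)).writes → σ₁ a = σ a := fun a ha => exec_frame _ ha σ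
  have A2 := exec_addArc (σ := σ₁) (j := get 10 (const 1) + var 28)
    (t := get 10 (const 0) + get 2 (var 28))
    (h := get 1 (var 28)) (c := get 3 (var 28)) (cap := const 1 - get 0 (const 2))
    (by rw [f₁ 10 (by decide)]; exact hσ.half_arcs) hle2
    (T := I.n + I.tgt e) (H := I.src e) (C := I.edgeCost e) (Q := if I.directed then 0 else 1)
    (by simp [eval_add, eval_get, eval_var, eval_const, f₁ 10 (by decide), f₁ 28 (by decide),
      hσ.m, h28])
    (by simp [eval_add, eval_get, eval_var, eval_const, put_apply, f₁ 10 (by decide),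
      f₁ 2 (by decide), f₁ 28 (by decide), hσ.n, h28, htgt])
    (by simp [eval_get, eval_var, put_apply, f₁ 1 (by decide), f₁ 28 (by decide), h28, hsrc])
    (by simp [eval_get, eval_var, put_apply, f₁ 3 (by decide), f₁ 28 (by decide), h28, hcost])
    (by simp [eval_get, eval_sub, eval_const, put_apply, f₁ 0 (by decide), hdir])
  refine ⟨?_, ?_, ?_⟩
  · refine A2.2 _ _ _ _ _ hle (by omega) ?_
    simpa only [Instance.net, blocks_one] using A1.1
  · simpa only [StoredIn, Instance.net, blocks_two] using A2.1
  · intro j hj h1 h2 hS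
    exact A2.2 _ _ _ _ _ hj h2 (A1.2 _ _ _ _ _ hj h1 hS)

theorem exec_nodeBody {I : Instance} {σ : Memory} (hσ : Loaded I σ) (v : Fin I.n)
    (h13 : σ 13 0 = v) (u : Fin I.n) (h29 : σ 29 0 = u) :
    StoredIn (I.net v (I.supplyExcept v (I.output σ))) (I.m + I.m + u) (nodeBody.exec σ) ∧
      StoredIn (I.net v (I.supplyExcept v (I.output σ))) (I.m + I.m + I.n + u)
        (nodeBody.exec σ) ∧
      ∀ j < (I.net v (I.supplyExcept v (I.output σ))).arcs, j ≠ I.m + I.m + u →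
        j ≠ I.m + I.m + I.n + u → StoredIn (I.net v (I.supplyExcept v (I.output σ))) j σ →
        StoredIn (I.net v (I.supplyExcept v (I.output σ))) j (nodeBody.exec σ) := by
  set G := I.net v (I.supplyExcept v (I.output σ)) with hG
  have hq : σ 6 u = I.q u := by rw [hσ.q]; exact toArray_val _ u
  have hp : σ 7 u = I.p u := by rw [hσ.p]; exact toArray_val _ u
  have hS : u ∈ I.output σ ↔ σ 9 u ≠ 0 := by simp [Instance.output]
  have hd : ∀ τ : Memory, τ 29 = σ 29 → τ 13 = σ 13 →
      ((differ (var 29) (var 13)).eval τ ≠ 0 ↔ u ≠ v) := by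
    intro τ h1 h2
    rw [Ne, eval_differ, eval_var, eval_var, h1, h2, h29, h13, Fin.val_inj]
  have hle : I.m + I.m + (u : ℕ) < I.m + I.m + I.n + I.n := by omega
  have hle2 : I.m + I.m + I.n + (u : ℕ) < I.m + I.m + I.n + I.n := by omega
  have hc1 : (cond (differ (var 29) (var 13)) (assign 50 (get 6 (var 29)))
      (assign 50 (get 10 (const 4)))).exec σ =
      put σ 50 0 (if u = v then 2 * I.m + 1 else I.q u) := by
    rw [exec_cond]
    by_cases huv : u = v
    · rw [if_neg (fun h => (hd σ rfl rfl).1 h huv), if_pos huv, exec_assign]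
      simp [eval_get, eval_const, hσ.rounds]
    · rw [if_pos ((hd σ rfl rfl).2 huv), if_neg huv, exec_assign]
      simp [eval_get, eval_var, h29, hq]
  set σ₁ := put σ 50 0 (if u = v then 2 * I.m + 1 else I.q u) with hσ₁
  have f₁ : ∀ a, a ≠ 50 → σ₁ a = σ a := fun a ha => put_ne ha _ _ _
  have hc2 : (cond (differ (var 29) (var 13))
      (cond (get 9 (var 29)) (assign 51 (get 7 (var 29))) (assign 51 (const 0)))
      (assign 51 (const 0))).exec σ₁ = put σ₁ 51 0 (I.supplyExcept v (I.output σ) u) := by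
    rw [exec_cond]
    have hd1 := hd σ₁ (f₁ 29 (by decide)) (f₁ 13 (by decide))
    by_cases huv : u = v
    · rw [if_neg (fun h => hd1.1 h huv), exec_assign]
      simp [eval_const, Instance.supplyExcept, huv]
    · rw [if_pos (hd1.2 huv), exec_cond, eval_get, eval_var, f₁ 29 (by decide), f₁ 9 (by decide),
        h29]
      by_cases h9 : σ 9 u = 0
      · rw [if_neg (by simpa using h9), exec_assign]
        simp [eval_const, Instance.supplyExcept, hS, h9]
      · rw [if_pos h9, exec_assign]
        simp [eval_get, eval_var, f₁, h29, hp, Instance.supplyExcept, hS, h9, huv]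
  set σ₂ := put σ₁ 51 0 (I.supplyExcept v (I.output σ) u) with hσ₂
  have f₂ : ∀ a, a ≠ 50 → a ≠ 51 → σ₂ a = σ a := fun a h1 h2 => by
    rw [hσ₂, put_ne h2, f₁ a h1]
  have e50 : σ₂ 50 0 = if u = v then 2 * I.m + 1 else I.q u := by
    simp [hσ₂, hσ₁, put_apply]
  have e51 : σ₂ 51 0 = I.supplyExcept v (I.output σ) u := by simp [hσ₂, put_apply]
  have e10 : σ₂ 10 = σ 10 := f₂ 10 (by decide) (by decide)
  have e29 : σ₂ 29 = σ 29 := f₂ 29 (by decide) (by decide)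
  have A1 := exec_addArc (σ := σ₂) (j := get 10 (const 1) + get 10 (const 1) + var 29)
    (t := var 29) (h := get 10 (const 0) + var 29) (c := const 0) (cap := var 50)
    (by rw [e10]; exact hσ.half_arcs) hle
    (T := u) (H := I.n + u) (C := 0) (Q := if u = v then 2 * I.m + 1 else I.q u)
    (by simp [eval_add, eval_get, eval_var, eval_const, e10, e29, hσ.m, h29])
    (by simp [eval_var, put_apply, e29, h29])
    (by simp [eval_add, eval_get, eval_var, eval_const, put_apply, e10, e29, hσ.n, h29])
    (by simp [eval_const])
    (by simp [eval_var, put_apply, e50])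
  rw [nodeBody, exec_seq, hc1, exec_seq, hc2, exec_seq]
  set σ₃ := (addArc (get 10 (const 1) + get 10 (const 1) + var 29) (var 29)
    (get 10 (const 0) + var 29) (const 0) (var 50)).exec σ₂ with hσ₃
  have f₃ : ∀ a, a ∉ (addArc (get 10 (const 1) + get 10 (const 1) + var 29) (var 29)
    (get 10 (const 0) + var 29) (const 0) (var 50)).writes → σ₃ a = σ₂ a :=
    fun a ha => exec_frame _ ha σ₂
  have g10 : σ₃ 10 = σ 10 := by rw [f₃ 10 (by decide), e10]
  have g29 : σ₃ 29 = σ 29 := by rw [f₃ 29 (by decide), e29]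
  have g51 : σ₃ 51 0 = I.supplyExcept v (I.output σ) u := by rw [f₃ 51 (by decide), e51]
  have A2 := exec_addArc (σ := σ₃)
    (j := get 10 (const 1) + get 10 (const 1) + get 10 (const 0) + var 29)
    (t := get 10 (const 0) + get 10 (const 0)) (h := var 29) (c := const 0) (cap := var 51)
    (by rw [g10]; exact hσ.half_arcs) hle2
    (T := I.n + I.n) (H := u) (C := 0) (Q := I.supplyExcept v (I.output σ) u)
    (by simp [eval_add, eval_get, eval_var, eval_const, g10, g29, hσ.m, hσ.n, h29])
    (by simp [eval_add, eval_get, eval_const, put_apply, g10, hσ.n])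
    (by simp [eval_var, put_apply, g29, h29])
    (by simp [eval_const])
    (by simp [eval_var, put_apply, g51])
  refine ⟨?_, ?_, ?_⟩
  · refine A2.2 _ _ _ _ _ hle (by omega) ?_
    simpa only [hG, Instance.net, blocks_three] using A1.1
  · simpa only [hG, StoredIn, Instance.net, blocks_four] using A2.1
  · intro j hj h1 h2 hSj
    refine A2.2 _ _ _ _ _ hj h2 (A1.2 _ _ _ _ _ hj h1 ?_)
    exact (hSj.put 0 _ (by decide)).put 0 _ (by decide)

/-- Store the network for the sink `13`. -/
def buildNet : Code := rep 28 10 1 edgeBody ;; rep 29 10 0 nodeBody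

theorem exec_buildNet {I : Instance} {σ : Memory} (hσ : Loaded I σ) (v : Fin I.n)
    (h13 : σ 13 0 = v) : ∀ j < I.m + I.m + I.n + I.n,
      StoredIn (I.net v (I.supplyExcept v (I.output σ))) j (buildNet.exec σ) := by
  set G := I.net v (I.supplyExcept v (I.output σ)) with hG
  have K1 := exec_rep (A := edgeBody) (c := 28) (b := 10) (k := 1) (σ := σ)
    (fun i τ => ∀ e : Fin I.m, (e : ℕ) < i → StoredIn G e τ ∧ StoredIn G (I.m + e) τ) (by decide)
    (by intro e he; omega) ?_
  swap
  · intro i τ hi h28 hfr hI e he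
    have hτ := hσ.frame _ hfr (by decide)
    rw [hσ.m] at hi
    obtain ⟨B1, B2, B3⟩ := exec_edgeBody hτ v (I.supplyExcept v (I.output σ)) ⟨i, hi⟩ h28
    rw [← hG] at B1 B2 B3
    suffices StoredIn G e (edgeBody.exec τ) ∧ StoredIn G (I.m + e) (edgeBody.exec τ) from
      ⟨this.1.put _ _ (by decide), this.2.put _ _ (by decide)⟩
    by_cases hei : (e : ℕ) = i
    · obtain rfl : e = ⟨i, hi⟩ := Fin.ext hei
      exact ⟨B1, B2⟩
    · obtain ⟨C1, C2⟩ := hI e (by omega)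
      have : G.arcs = I.m + I.m + I.n + I.n := rfl
      exact ⟨B3 _ (by omega) (by simpa using hei) (by simp only; omega) C1,
        B3 _ (by omega) (by simp only; omega) (by simp only; omega) C2⟩
  rw [buildNet, exec_seq]
  set σ₁ := (rep 28 10 1 edgeBody).exec σ with hσ₁
  have f₁ : ∀ a, a ∉ (rep 28 10 1 edgeBody).writes → σ₁ a = σ a := fun a ha => exec_frame _ ha σ
  have H₁ : Loaded I σ₁ := hσ.exec _ (by decide)
  rw [hσ.m] at K1
  have K2 := exec_rep (A := nodeBody) (c := 29) (b := 10) (k := 0) (σ := σ₁)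
    (fun i τ => (∀ e : Fin I.m, StoredIn G e τ ∧ StoredIn G (I.m + e) τ) ∧
      ∀ u : Fin I.n, (u : ℕ) < i →
        StoredIn G (I.m + I.m + u) τ ∧ StoredIn G (I.m + I.m + I.n + u) τ) (by decide)
    ⟨fun e => ⟨(K1 e e.2).1.put _ _ (by decide), (K1 e e.2).2.put _ _ (by decide)⟩,
      fun u hu => by omega⟩ ?_
  · rw [H₁.n] at K2
    refine forall_lt_blocks.2 ⟨fun e => (K2.1 e).1, fun e => (K2.1 e).2,
      fun u => (K2.2 u u.2).1, fun u => (K2.2 u u.2).2⟩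
  · rintro i τ hi h29 hfr ⟨I1, I2⟩
    have hτ := H₁.frame _ hfr (by decide)
    rw [H₁.n] at hi
    have e13 : τ 13 0 = v := by rw [hfr 13 (by decide), f₁ 13 (by decide), h13]
    have e9 : I.output τ = I.output σ := by
      unfold Instance.output
      rw [hfr 9 (by decide), f₁ 9 (by decide)]
    obtain ⟨B1, B2, B3⟩ := exec_nodeBody hτ v e13 ⟨i, hi⟩ h29
    rw [e9, ← hG] at B1 B2 B3
    have : G.arcs = I.m + I.m + I.n + I.n := rfl
    refine ⟨fun e => ⟨?_, ?_⟩, fun u hu => ?_⟩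
    · exact (B3 _ (by omega) (by simp only; omega) (by simp only; omega) (I1 e).1).put _ _
        (by decide)
    · exact (B3 _ (by omega) (by simp only; omega) (by simp only; omega) (I1 e).2).put _ _
        (by decide)
    · suffices StoredIn G (I.m + I.m + u) (nodeBody.exec τ) ∧
          StoredIn G (I.m + I.m + I.n + u) (nodeBody.exec τ) from
        ⟨this.1.put _ _ (by decide), this.2.put _ _ (by decide)⟩
      by_cases hui : (u : ℕ) = i
      · obtain rfl : u = ⟨i, hi⟩ := Fin.ext hui
        exact ⟨B1, B2⟩
      · obtain ⟨C1, C2⟩ := I2 u (by omega)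
        exact ⟨B3 _ (by omega) (by simp only; omega) (by simp only; omega) C1,
          B3 _ (by omega) (by simp only; omega) (by simp only; omega) C2⟩

/-! ### Evaluating a set of nodes -/

/-- Start with the zero flow and zero potentials. -/
def initFlow : Code :=
  rep 44 10 3 (set 36 (var 44) (const 0)) ;; assign 15 (const 0) ;;
  cond (get 9 (var 13)) (assign 14 (get 5 (var 13) - get 7 (var 13)))
    (assign 14 (get 5 (var 13)))

theorem exec_initFlow {I : Instance} {σ : Memory} (hσ : Loaded I σ) (v : Fin I.n)
    (h13 : σ 13 0 = v) :
    (∀ w < I.n + I.n + 1, initFlow.exec σ 36 w = 0) ∧ initFlow.exec σ 15 0 = 0 ∧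
      initFlow.exec σ 14 0 = I.residualDemand v (I.output σ) := by
  have hd : σ 5 v = I.demand v := by rw [hσ.demand]; exact toArray_val _ v
  have hp : σ 7 v = I.p v := by rw [hσ.p]; exact toArray_val _ v
  have hS : v ∈ I.output σ ↔ σ 9 v ≠ 0 := by simp [Instance.output]
  have key := exec_rep (A := set 36 (var 44) (const 0)) (c := 44) (b := 10) (k := 3) (σ := σ)
    (fun i τ => ∀ w < i, τ 36 w = 0) (by decide) (by simp) ?_
  · rw [hσ.nodes] at key
    simp only [initFlow, exec_seq]
    set σ₁ := (rep 44 10 3 (set 36 (var 44) (const 0))).exec σ with hσ₁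
    have f₁ : ∀ a, a ∉ (rep 44 10 3 (set 36 (var 44) (const 0))).writes → σ₁ a = σ a :=
      fun a ha => exec_frame _ ha σ
    rw [exec_assign, eval_const]
    have e9 : put σ₁ 15 0 0 9 = σ 9 := by rw [put_ne (by decide), f₁ 9 (by decide)]
    have e5 : put σ₁ 15 0 0 5 = σ 5 := by rw [put_ne (by decide), f₁ 5 (by decide)]
    have e7 : put σ₁ 15 0 0 7 = σ 7 := by rw [put_ne (by decide), f₁ 7 (by decide)]
    have e13 : put σ₁ 15 0 0 13 = σ 13 := by rw [put_ne (by decide), f₁ 13 (by decide)]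
    have hev : eval (put σ₁ 15 0 0) (get 9 (var 13)) = σ 9 v := by
      rw [eval_get, eval_var, e9, e13, h13]
    by_cases h9 : σ 9 v = 0
    · rw [exec_cond, if_neg (by rw [hev]; exact not_not.2 h9), exec_assign, eval_get, eval_var,
        e13, h13, e5, hd, Instance.residualDemand, if_neg (by rw [hS]; exact not_not.2 h9)]
      simpa [put_apply] using key
    · rw [exec_cond, if_pos (by rw [hev]; exact h9), exec_assign, eval_sub, eval_get, eval_get,
        eval_var, e13, h13, e5, e7, hd, hp, Instance.residualDemand, if_pos (hS.2 h9)]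
      simpa [put_apply] using key
  · intro i τ hi h44 hfr hI w hw
    rw [put_ne (by decide), exec_set, put_apply, eval_var, h44, eval_const]
    split_ifs with h
    · rfl
    · exact hI w (by omega)

/-- Compute the penalized cost of the flow in variable `21`. -/
def flowValue : Code :=
  assign 21 (const 0) ;;
  rep 52 10 6 (cond (get 34 (get 10 (const 6) + var 52))
    (assign 21 (var 21 + get 32 (var 52))) skip) ;;
  assign 40 (var 12 + const 1) ;; assign 41 (var 14) ;; mul ;; assign 21 (var 21 + var 42)

theorem exec_flowValue {σ : Memory} {K : ℕ} (hK : σ 10 6 = K) (h14 : σ 14 0 < 2 ^ σ 10 2)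
    (hc : ∀ j < K, σ 32 j = 0 ∨ σ 34 (K + j) ≤ 1) :
    flowValue.exec σ 21 0 =
      ∑ j ∈ Finset.range K, σ 32 j * σ 34 (K + j) + (σ 12 0 + 1) * σ 14 0 := by
  rw [flowValue, exec_seq]
  set σ₁ := (assign 21 (const 0)).exec σ with hσ₁
  have f₁ : ∀ a, a ≠ 21 → σ₁ a = σ a := fun a ha => put_ne ha _ _ _
  have key := exec_rep (A := cond (get 34 (get 10 (const 6) + var 52))
    (assign 21 (var 21 + get 32 (var 52))) skip) (c := 52) (b := 10) (k := 6) (σ := σ₁)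
    (fun i τ => τ 21 0 = ∑ j ∈ Finset.range i, σ 32 j * σ 34 (K + j)) (by decide)
    (by simp [hσ₁, exec_assign, put_apply, eval_const]) ?_
  · rw [f₁ 10 (by decide), hK] at key
    rw [exec_seq]
    set σ₂ := (rep 52 10 6 (cond (get 34 (get 10 (const 6) + var 52))
      (assign 21 (var 21 + get 32 (var 52))) skip)).exec σ₁ with hσ₂
    have f₂ : ∀ a, a ≠ 21 → a ≠ 52 → σ₂ a = σ a := by
      intro a h1 h2
      rw [hσ₂, exec_frame _ (by simp [writes, assign, h1, h2]), f₁ a h1]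
    simp only [exec_seq, exec_assign, eval_add, eval_var, eval_const]
    rw [put_ne (by decide : (14 : ℕ) ≠ 40), f₂ 14 (by decide) (by decide), f₂ 12 (by decide)
      (by decide)]
    set σ₃ := put (put σ₂ 40 0 (σ 12 0 + 1)) 41 0 (σ 14 0) with hσ₃
    have e40 : σ₃ 40 0 = σ 12 0 + 1 := by simp [hσ₃, put_apply]
    have e41 : σ₃ 41 0 = σ 14 0 := by simp [hσ₃, put_apply]
    have e10 : σ₃ 10 = σ 10 := by
      rw [hσ₃, put_ne (by decide), put_ne (by decide), f₂ 10 (by decide) (by decide)]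
    have e21 : mul.exec σ₃ 21 = σ₂ 21 := by
      rw [exec_frame _ (by decide), hσ₃, put_ne (by decide), put_ne (by decide)]
    have hm := exec_mul (σ := σ₃) (by rw [e41, e10]; exact h14)
    rw [put_apply, if_pos ⟨rfl, rfl⟩, hm, e21, key, e40, e41]
  · intro i τ hi h52 hfr hI
    rw [f₁ 10 (by decide), hK] at hi
    have e10 : τ 10 6 = K := by rw [hfr 10 (by decide), f₁ 10 (by decide), hK]
    have e32 : τ 32 = σ 32 := by rw [hfr 32 (by decide), f₁ 32 (by decide)]
    have e34 : τ 34 = σ 34 := by rw [hfr 34 (by decide), f₁ 34 (by decide)]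
    simp only [exec_cond, exec_assign, exec_skip, eval_get, eval_add, eval_var, eval_const, e10,
      h52, e34, e32]
    rw [put_ne (by decide), Finset.sum_range_succ, ← hI]
    by_cases hx : σ 34 (K + i) = 0
    · simp [hx]
    · rw [if_pos hx, put_apply, if_pos ⟨rfl, rfl⟩]
      rcases hc i hi with h0 | h1
      · simp [h0]
      · rw [show σ 34 (K + i) = 1 by omega, mul_one]

/-- Compute `I.val v S` in variable `21`, for `v` in variable `13` and `S` in array `9`. -/
def minCostFlow : Code := buildNet ;; initFlow ;; rep 27 10 4 SSL.round ;; flowValue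

theorem Instance.inflow_le (I : Instance) (fwd bwd : Fin I.m → ℕ) (h1 : ∀ e, fwd e ≤ 1)
    (h2 : ∀ e, bwd e ≤ 1) (u : Fin I.n) : I.inflow fwd bwd u ≤ 2 * I.m := by
  have : I.inflow fwd bwd u ≤ ∑ _e : Fin I.m, 2 := by
    refine Finset.sum_le_sum fun e _ => ?_
    have := h1 e
    have := h2 e
    split_ifs <;> omega
  simpa [mul_comm] using this

theorem exec_minCostFlow {I : Instance} {σ : Memory} (hσ : Loaded I σ) (v : Fin I.n)
    (h13 : σ 13 0 = v) : ∃ x π F rem,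
      I.Certificate v (I.output σ) x π F rem (minCostFlow.exec σ 21 0) := by
  have hB := exec_buildNet hσ v h13
  set G := I.net v (I.supplyExcept v (I.output σ)) with hG
  have hK : G.arcs = I.m + I.m + I.n + I.n := rfl
  simp only [minCostFlow, exec_seq]
  set σ₁ := buildNet.exec σ with hσ₁
  have f₁ : ∀ a, a ∉ buildNet.writes → σ₁ a = σ a := fun a ha => exec_frame _ ha σ
  have L₁ : Loaded I σ₁ := hσ.exec _ (by decide)
  have e13 : σ₁ 13 0 = v := by rw [f₁ 13 (by decide), h13]
  have hout : I.output σ₁ = I.output σ := by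
    unfold Instance.output
    rw [f₁ 9 (by decide)]
  obtain ⟨i1, i2, i3⟩ := exec_initFlow L₁ v e13
  rw [hout] at i3
  set σ₂ := initFlow.exec σ₁ with hσ₂
  have f₂ : ∀ a, a ∉ initFlow.writes → σ₂ a = σ₁ a := fun a ha => exec_frame _ ha σ₁
  have L₂ : Loaded I σ₂ := L₁.exec _ (by decide)
  set R : ResNet := ⟨I.n + I.n + 1, G.arcs + G.arcs, I.n + I.n, v, σ₁ 30, σ₁ 31, σ₁ 32, σ₁ 33,
    σ₁ 35⟩ with hR
  have hres : R.IsResidual G := ⟨rfl, rfl, rfl, rfl, fun j hj => (hB j hj).tail,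
    fun j hj => (hB j hj).head, fun j hj => (hB j hj).cp, fun j hj => (hB j hj).cn,
    fun j hj => (hB j hj).pr, fun j hj => (hB j hj).tail', fun j hj => (hB j hj).head',
    fun j hj => (hB j hj).cp', fun j hj => (hB j hj).cn', fun j hj => (hB j hj).pr'⟩
  have hval : R.Valid := hres.valid (I.net_valid _ _) (by simp only [hG, Instance.net]; omega)
  have H₂ : Holds R (I.totalCost + 1) σ₂ := ⟨f₂ 30 (by decide), f₂ 31 (by decide),
    f₂ 32 (by decide), f₂ 33 (by decide), f₂ 35 (by decide), by rw [L₂.n], L₂.nodes, L₂.arcs,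
    by rw [L₂.total], by rw [f₂ 13 (by decide), e13]⟩
  have e34 : σ₂ 34 = σ₁ 34 := f₂ 34 (by decide)
  have hrc0 : ∀ j < G.arcs, σ₁ 34 j = G.cap j := fun j hj => (hB j hj).rc
  have hrc1 : ∀ j < G.arcs, σ₁ 34 (G.arcs + j) = 0 := fun j hj => (hB j hj).rc'
  have hS₂ : Solving R (I.totalCost + 1) (σ₁ 34) (I.residualDemand v (I.output σ)) 0 σ₂ := by
    refine ⟨?_, i1 _ hval.source_lt, ?_, ?_, ?_, ?_⟩
    · intro j hj hpos
      rw [i1 _ (hval.head_lt j hj), i1 _ (hval.tail_lt j hj)]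
      rw [e34] at hpos
      have hjK : j < G.arcs := by
        by_contra hcon
        have hj' : j < G.arcs + G.arcs := hj
        have := hrc1 (j - G.arcs) (by omega)
        rw [Nat.add_sub_cancel' (by omega)] at this
        omega
      rw [hres.cn j hjK]
      omega
    · rw [i1 _ hval.sink_lt]; omega
    · rw [e34]
      exact ⟨fun _ _ => rfl, fun w => by simp⟩
    · rw [i3, zero_add]
    · exact fun hne => absurd i2 hne
  have hcap : R.resIn (σ₁ 34) R.sink < σ₂ 10 4 := by
    rw [L₂.rounds, hres.resIn_eq]
    have h1 := I.sum_head_entry v (I.supplyExcept v (I.output σ)) (σ₁ 34) v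
    rw [← hG] at h1
    have h2 : ∑ j ∈ Finset.range G.arcs,
        (if G.tail j = R.sink then σ₁ 34 (G.arcs + j) else 0) = 0 := by
      refine Finset.sum_eq_zero fun j hj => ?_
      rw [hrc1 j (Finset.mem_range.1 hj), ite_self]
    have h3 : R.sink = v := rfl
    rw [h2, h3, h1, hrc0 _ (by omega)]
    have h4 : G.cap (I.m + I.m + I.n + v) = 0 := by
      simp [hG, Instance.net, blocks_four, Instance.supplyExcept]
    have h5 := I.inflow_le (fun e => σ₁ 34 e) (fun e => σ₁ 34 (I.m + e))
      (fun e => by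
        rw [hrc0 _ (by omega)]
        simp [hG, Instance.net, blocks_one])
      (fun e => by
        rw [hrc0 _ (by omega)]
        simp only [hG, Instance.net, blocks_two]
        split_ifs <;> simp) v
    omega
  obtain ⟨F, hsol, hopt⟩ := Solving.rounds hval H₂ hS₂ hcap
  set σ₃ := (rep 27 10 4 SSL.round).exec σ₂ with hσ₃
  have f₃ : ∀ a, a ∉ (rep 27 10 4 SSL.round).writes → σ₃ a = σ₂ a :=
    fun a ha => exec_frame _ ha σ₂
  have L₃ : Loaded I σ₃ := L₂.exec _ (by decide)
  have hflow := hsol.sent.isFlow hres hrc0 hrc1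
  have e32 : ∀ j < G.arcs, σ₃ 32 j = G.cost j := fun j hj => by
    rw [f₃ 32 (by decide), f₂ 32 (by decide)]
    exact (hB j hj).cp
  have hunit : ∀ j < G.arcs, G.cost j = 0 ∨ G.cap j ≤ 1 := by
    refine (forall_lt_blocks (m := I.m) (n := I.n)).2 ⟨?_, ?_, ?_, ?_⟩ <;> intro i <;>
      simp only [hG, Instance.net, blocks_one, blocks_two, blocks_three, blocks_four, true_or]
    · exact Or.inr le_rfl
    · right; split_ifs <;> simp
  have hrem : σ₃ 14 0 < 2 ^ σ₃ 10 2 := by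
    have h1 := hsol.total
    have h2 : I.residualDemand v (I.output σ) ≤ I.demand v := Nat.sub_le _ _
    have h3 := L₃.demand_lt v
    omega
  have hv := exec_flowValue (σ := σ₃) (K := G.arcs) L₃.half_arcs hrem (fun j hj => by
    rcases hunit j hj with h | h
    · exact Or.inl (by rw [e32 j hj, h])
    · exact Or.inr ((hflow.le_cap j hj).trans h))
  refine ⟨fun j => σ₃ 34 (G.arcs + j), σ₃ 36, F, σ₃ 14 0, hflow, hsol.total, hsol.source,
    hsol.sink_le, hopt, ?_, ?_, ?_⟩
  · intro j hj hlt
    have hpair := hsol.sent.pair j (by rw [hres.arcs, ← hG] at *; omega)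
    rw [hres.pr j hj, hrc0 j hj, hrc1 j hj] at hpair
    have hg := hsol.good j (by rw [hres.arcs, ← hG] at *; omega) (by
      rw [← hG] at hlt; omega)
    rwa [hres.head j hj, hres.tail j hj, hres.cn j hj, hres.cp j hj, add_zero] at hg
  · intro j hj hpos
    have hg := hsol.good (G.arcs + j) (by rw [hres.arcs, ← hG] at *; omega) hpos
    rwa [hres.head' j hj, hres.tail' j hj, hres.cn' j hj, hres.cp' j hj, add_zero] at hg
  · rw [hv, L₃.total, ← hG, Net.flowCost]
    congr 1
    exact Finset.sum_congr rfl fun j hj => by rw [e32 j (Finset.mem_range.1 hj)]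

/-- Compute `I.gap S` in variable `53`, for `S` in array `9`. -/
def gapCode : Code :=
  assign 53 (const 0) ;;
  rep 13 10 0 (minCostFlow ;; assign 53 (var 53 + ((var 21 - get 8 (var 13)) +
    ((var 21 - var 12) - (var 21 - get 8 (var 13))))))

theorem exec_gapCode {I : Instance} {σ : Memory} (hσ : Loaded I σ) :
    gapCode.exec σ 53 0 = I.gap (I.output σ) := by
  rw [gapCode, exec_seq]
  set σ₁ := (assign 53 (const 0)).exec σ with hσ₁
  have f₁ : ∀ a, a ≠ 53 → σ₁ a = σ a := fun a ha => put_ne ha _ _ _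
  have L₁ : Loaded I σ₁ := hσ.exec _ (by decide)
  set g : Fin I.n → ℕ := fun v => I.val v (I.output σ) - min (I.bound v) I.totalCost with hg
  have key := exec_rep (A := minCostFlow ;; assign 53 (var 53 + ((var 21 - get 8 (var 13)) +
    ((var 21 - var 12) - (var 21 - get 8 (var 13)))))) (c := 13) (b := 10) (k := 0) (σ := σ₁)
    (fun i τ => τ 53 0 = ∑ v ∈ Finset.range i, toArray g v) (by decide)
    (by simp [hσ₁, exec_assign, put_apply, eval_const]) ?_
  · rw [key, L₁.n, Finset.sum_range]
    simp only [toArray_val]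
    rfl
  · intro i τ hi h13 hfr hI
    rw [L₁.n] at hi
    have Lτ := L₁.frame _ hfr (by decide)
    obtain ⟨x, π, F, rem, hcert⟩ := exec_minCostFlow Lτ ⟨i, hi⟩ h13
    have hout : I.output τ = I.output σ := by
      unfold Instance.output
      rw [hfr 9 (by decide), f₁ 9 (by decide)]
    rw [hout] at hcert
    rw [exec_seq]
    set τ' := minCostFlow.exec τ with hτ'
    have f' : ∀ a, a ∉ minCostFlow.writes → τ' a = τ a := fun a ha => exec_frame _ ha τ
    have e8 : τ' 8 i = I.bound ⟨i, hi⟩ := by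
      rw [f' 8 (by decide), Lτ.bound]
      exact toArray_val _ (⟨i, hi⟩ : Fin I.n)
    have e12 : τ' 12 0 = I.totalCost := by rw [f' 12 (by decide), Lτ.total]
    have e13 : τ' 13 0 = i := by rw [f' 13 (by decide), h13]
    have e53 : τ' 53 0 = τ 53 0 := by rw [f' 53 (by decide)]
    rw [put_ne (by decide), exec_assign, put_apply, if_pos ⟨rfl, rfl⟩]
    simp only [eval_add, eval_sub, eval_var, eval_get, e8, e12, e13, e53]
    rw [Finset.sum_range_succ, ← hI, toArray_of_lt _ hi, hg]
    simp only [hcert.val_eq]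
    omega

/-! ### The greedy algorithm -/

/-- Compare node `56` with the best candidate so far: its gain is `59`, its cost `60`, its number
`62`. The quotients of gain and cost are compared by cross-multiplication. -/
def candidateBody : Code :=
  assign 57 (get 9 (var 56)) ;; set 9 (var 56) (const 1) ;; gapCode ;;
  set 9 (var 56) (var 57) ;; assign 58 (var 55 - var 53) ;;
  assign 40 (var 59) ;; assign 41 (get 4 (var 56)) ;; mul ;; assign 61 (var 42) ;;
  assign 40 (var 58) ;; assign 41 (var 60) ;; mul ;;
  cond (var 42 - var 61)
    (assign 59 (var 58) ;; assign 60 (get 4 (var 56)) ;; assign 62 (var 56)) skip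

theorem Instance.output_put_one (I : Instance) (σ : Memory) (u : Fin I.n) :
    I.output (put σ 9 u 1) = insert u (I.output σ) := by
  ext w
  simp only [output, Finset.mem_filter, Finset.mem_univ, true_and, Finset.mem_insert, put_apply,
    Fin.val_inj]
  by_cases h : w = u <;> simp [h]

/-- The best candidate is replaced if and only if node `u` has the greater quotient of gain and
cost; the set in array `9` is restored. -/
theorem exec_candidateBody {I : Instance} {σ : Memory} (hσ : Loaded I σ) (u : Fin I.n)
    (h56 : σ 56 0 = u) (h60 : σ 60 0 < 2 ^ σ 10 2) :
    let τ := candidateBody.exec σ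
    let gain := σ 55 0 - I.gap (insert u (I.output σ))
    τ 9 = σ 9 ∧ ((I.nodeCost u * σ 59 0 < gain * σ 60 0 ∧ τ 59 0 = gain ∧
        τ 60 0 = I.nodeCost u ∧ τ 62 0 = u) ∨
      (gain * σ 60 0 ≤ I.nodeCost u * σ 59 0 ∧ τ 59 0 = σ 59 0 ∧ τ 60 0 = σ 60 0 ∧
        τ 62 0 = σ 62 0)) := by
  intro τ gain
  have hcost : σ 4 u = I.nodeCost u := by rw [hσ.nodeCost]; exact toArray_val _ u
  have hτ : τ = candidateBody.exec σ := rfl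
  simp only [candidateBody, exec_seq] at hτ
  set σ₁ := (set 9 (var 56) (const 1)).exec ((assign 57 (get 9 (var 56))).exec σ) with hσ₁
  have f₁ : ∀ a, a ≠ 9 → a ≠ 57 → σ₁ a = σ a := fun a h1 h2 => by
    rw [hσ₁, exec_set, put_ne h1, exec_assign, put_ne h2]
  have a56 : σ₁ 56 0 = u := by rw [f₁ 56 (by decide) (by decide), h56]
  have e57 : σ₁ 57 0 = σ 9 u := by
    rw [hσ₁, exec_set, put_ne (by decide), exec_assign, put_apply, if_pos ⟨rfl, rfl⟩, eval_get,
      eval_var, h56]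
  have e9 : σ₁ 9 = Function.update (σ 9) u 1 := by
    rw [hσ₁, exec_set, put_same, exec_assign, put_ne (by decide), eval_var, put_ne (by decide),
      h56, eval_const]
  have L₁ : Loaded I σ₁ := hσ.congr (by simp [f₁])
  have hout : I.output σ₁ = insert u (I.output σ) := by
    rw [← I.output_put_one σ u]
    unfold Instance.output
    rw [e9, put_same]
  have hgap := exec_gapCode L₁
  rw [hout] at hgap
  set σ₂ := gapCode.exec σ₁ with hσ₂
  have f₂ : ∀ a, a ∉ gapCode.writes → σ₂ a = σ₁ a := fun a ha => exec_frame _ ha σ₁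
  set σ₃ := (assign 41 (get 4 (var 56))).exec ((assign 40 (var 59)).exec
    ((assign 58 (var 55 - var 53)).exec ((set 9 (var 56) (var 57)).exec σ₂))) with hσ₃
  have f₃ : ∀ a, a ≠ 9 → a ≠ 40 → a ≠ 41 → a ≠ 58 → σ₃ a = σ₂ a := fun a h1 h2 h3 h4 => by
    rw [hσ₃, exec_assign, put_ne h3, exec_assign, put_ne h2, exec_assign, put_ne h4, exec_set,
      put_ne h1]
  have b56 : σ₂ 56 0 = u := by rw [f₂ 56 (by decide), a56]
  have g9 : σ₃ 9 = σ 9 := by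
    rw [hσ₃, exec_assign, put_ne (by decide), exec_assign, put_ne (by decide), exec_assign,
      put_ne (by decide), exec_set, put_same, eval_var, eval_var, b56, f₂ 9 (by decide),
      f₂ 57 (by decide), e57, e9, Function.update_idem, Function.update_eq_self]
  have g58 : σ₃ 58 0 = gain := by
    simp [hσ₃, exec_assign, exec_set, put_apply, eval_sub, eval_var, hgap, f₂ 55 (by decide),
      f₁ 55, gain]
  have g40 : σ₃ 40 0 = σ 59 0 := by
    simp [hσ₃, exec_assign, exec_set, put_apply, eval_var, f₂ 59 (by decide), f₁ 59]
  have g41 : σ₃ 41 0 = I.nodeCost u := by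
    simp [hσ₃, exec_assign, exec_set, put_apply, eval_var, eval_get, f₂ 4 (by decide), f₁ 4, b56,
      hcost]
  have g10 : σ₃ 10 = σ 10 := by
    rw [f₃ 10 (by decide) (by decide) (by decide) (by decide), f₂ 10 (by decide),
      f₁ 10 (by decide) (by decide)]
  have gf : ∀ a, a ∈ [4, 56, 59, 60, 62] → σ₃ a = σ a := by
    intro a ha
    simp only [List.mem_cons, List.not_mem_nil, or_false] at ha
    rw [f₃ a (by omega) (by omega) (by omega) (by omega), f₂ a (by
      rcases ha with rfl | rfl | rfl | rfl | rfl <;> decide), f₁ a (by omega) (by omega)]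
  have hm₁ := exec_mul (σ := σ₃) (by rw [g41, g10]; exact hσ.nodeCost_lt u)
  rw [g40, g41] at hm₁
  set σ₄ := mul.exec σ₃ with hσ₄
  have f₄ : ∀ a, a ∉ mul.writes → σ₄ a = σ₃ a := fun a ha => exec_frame _ ha σ₃
  set σ₅ := (assign 41 (var 60)).exec ((assign 40 (var 58)).exec
    ((assign 61 (var 42)).exec σ₄)) with hσ₅
  have f₅ : ∀ a, a ≠ 40 → a ≠ 41 → a ≠ 61 → σ₅ a = σ₄ a := fun a h1 h2 h3 => by
    rw [hσ₅, exec_assign, put_ne h2, exec_assign, put_ne h1, exec_assign, put_ne h3]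
  have h61 : σ₅ 61 0 = σ 59 0 * I.nodeCost u := by
    simp [hσ₅, exec_assign, put_apply, eval_var, hm₁]
  have h40 : σ₅ 40 0 = gain := by
    simp [hσ₅, exec_assign, put_apply, eval_var, f₄ 58 (by decide), g58]
  have h41 : σ₅ 41 0 = σ 60 0 := by
    simp [hσ₅, exec_assign, put_apply, eval_var, f₄ 60 (by decide), gf 60 (by simp)]
  have h10 : σ₅ 10 = σ 10 := by
    rw [f₅ 10 (by decide) (by decide) (by decide), f₄ 10 (by decide), g10]
  have hm₂ := exec_mul (σ := σ₅) (by rw [h41, h10]; exact h60)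
  rw [h40, h41] at hm₂
  set σ₆ := mul.exec σ₅ with hσ₆
  have f₆ : ∀ a, a ∉ mul.writes → σ₆ a = σ₅ a := fun a ha => exec_frame _ ha σ₅
  have kf : ∀ a, a ∈ [4, 56, 59, 60, 62] → σ₆ a = σ a := by
    intro a ha
    rw [← gf a ha]
    simp only [List.mem_cons, List.not_mem_nil, or_false] at ha
    rw [f₆ a (by rcases ha with rfl | rfl | rfl | rfl | rfl <;> decide),
      f₅ a (by omega) (by omega) (by omega),
      f₄ a (by rcases ha with rfl | rfl | rfl | rfl | rfl <;> decide)]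
  have k9 : σ₆ 9 = σ 9 := by
    rw [f₆ 9 (by decide), f₅ 9 (by decide) (by decide) (by decide), f₄ 9 (by decide), g9]
  have k58 : σ₆ 58 0 = gain := by
    rw [f₆ 58 (by decide), f₅ 58 (by decide) (by decide) (by decide), f₄ 58 (by decide), g58]
  have k61 : σ₆ 61 0 = σ 59 0 * I.nodeCost u := by rw [f₆ 61 (by decide), h61]
  have k4 := kf 4 (by simp)
  have k56 := kf 56 (by simp)
  rw [exec_cond] at hτ
  have hcond : (var 42 - var 61).eval σ₆ = gain * σ 60 0 - σ 59 0 * I.nodeCost u := by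
    rw [eval_sub, eval_var, eval_var, hm₂, k61]
  rw [hcond] at hτ
  by_cases hlt : I.nodeCost u * σ 59 0 < gain * σ 60 0
  · rw [if_pos (by rw [mul_comm (σ 59 0)]; omega)] at hτ
    rw [hτ]
    refine ⟨?_, Or.inl ⟨hlt, ?_, ?_, ?_⟩⟩ <;>
      simp [exec_seq, exec_assign, put_apply, put_ne, eval_var, eval_get, k58, k4, k56, h56,
        hcost, k9]
  · rw [if_neg (by rw [mul_comm (σ 59 0)]; omega), exec_skip] at hτ
    rw [hτ]
    exact ⟨k9, Or.inr ⟨by omega, by rw [kf 59 (by simp)], by rw [kf 60 (by simp)],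
      by rw [kf 62 (by simp)]⟩⟩

/-- Add the node with the best quotient of gain and cost to the set in array `9`. -/
def greedyBody : Code :=
  gapCode ;; assign 55 (var 53) ;; assign 59 (const 0) ;; assign 60 (const 1) ;;
  rep 56 10 0 candidateBody ;; cond (var 59) (set 9 (var 62) (const 1)) skip

/-- A round either finds that no node has a positive gain, or adds a node for which the quotient of
gain and cost is greatest. -/
theorem exec_greedyBody {I : Instance} {σ : Memory} (hσ : Loaded I σ) :
    (I.output (greedyBody.exec σ) = I.output σ ∧
      ∀ w, I.gap (I.output σ) ≤ I.gap (insert w (I.output σ))) ∨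
    ∃ u, I.output (greedyBody.exec σ) = insert u (I.output σ) ∧
      I.gap (insert u (I.output σ)) < I.gap (I.output σ) ∧
      ∀ w, I.nodeCost u * (I.gap (I.output σ) - I.gap (insert w (I.output σ))) ≤
        I.nodeCost w * (I.gap (I.output σ) - I.gap (insert u (I.output σ))) := by
  simp only [greedyBody, exec_seq]
  have hgap := exec_gapCode hσ
  set S := I.output σ with hS
  set gain : Fin I.n → ℕ := fun w => I.gap S - I.gap (insert w S) with hgain
  set σ₁ := gapCode.exec σ with hσ₁
  have f₁ : ∀ a, a ∉ gapCode.writes → σ₁ a = σ a := fun a ha => exec_frame _ ha σ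
  set σ₂ := (assign 60 (const 1)).exec ((assign 59 (const 0)).exec
    ((assign 55 (var 53)).exec σ₁)) with hσ₂
  have f₂ : ∀ a, a ≠ 55 → a ≠ 59 → a ≠ 60 → σ₂ a = σ₁ a := fun a h1 h2 h3 => by
    rw [hσ₂, exec_assign, put_ne h3, exec_assign, put_ne h2, exec_assign, put_ne h1]
  have L₁ : Loaded I σ₁ := hσ.exec _ (by decide)
  have L₂ : Loaded I σ₂ := L₁.congr (by simp [f₂])
  have e9 : σ₂ 9 = σ 9 := by rw [f₂ 9 (by decide) (by decide) (by decide), f₁ 9 (by decide)]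
  have e55 : σ₂ 55 0 = I.gap S := by
    simp [hσ₂, exec_assign, put_apply, eval_var, hgap]
  have e59 : σ₂ 59 0 = 0 := by simp [hσ₂, exec_assign, put_apply, eval_const]
  have e60 : σ₂ 60 0 = 1 := by simp [hσ₂, exec_assign, put_apply, eval_const]
  have key := exec_rep (A := candidateBody) (c := 56) (b := 10) (k := 0) (σ := σ₂)
    (fun i τ => τ 9 = σ 9 ∧
      (∀ w : Fin I.n, (w : ℕ) < i → τ 60 0 * gain w ≤ I.nodeCost w * τ 59 0) ∧
      ((τ 59 0 = 0 ∧ τ 60 0 = 1) ∨ ∃ u : Fin I.n, τ 62 0 = u ∧ τ 60 0 = I.nodeCost u ∧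
        τ 59 0 = gain u ∧ 0 < gain u)) (by decide) ?_ ?_
  · obtain ⟨k9, kall, kbest⟩ := key
    rw [L₂.n] at kall
    set σ₃ := (rep 56 10 0 candidateBody).exec σ₂ with hσ₃
    rw [exec_cond, eval_var]
    rcases kbest with ⟨h1, h2⟩ | ⟨u, h1, h2, h3, h4⟩
    · left
      rw [if_neg (by simpa using h1), exec_skip]
      refine ⟨by rw [hS]; unfold Instance.output; rw [k9], fun w => ?_⟩
      have := kall w w.2
      rw [h1, h2, one_mul, mul_zero] at this
      simp only [hgain] at this
      omega
    · right
      rw [if_pos (by omega), exec_set, eval_var, eval_const, h1, I.output_put_one]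
      refine ⟨u, ?_, ?_, fun w => ?_⟩
      · congr 1
        rw [hS]; unfold Instance.output; rw [k9]
      · simp only [hgain] at h4
        omega
      · have := kall w w.2
        rwa [h2, h3] at this
  · refine ⟨by rw [put_ne (by decide), e9], fun w hw => by omega, Or.inl ?_⟩
    rw [put_ne (by decide), put_ne (by decide)]
    exact ⟨e59, e60⟩
  · rintro i τ hi h56 hfr ⟨I9, Iall, Ibest⟩
    rw [L₂.n] at hi
    have Lτ : Loaded I τ := L₂.frame _ hfr (by decide)
    have t55 : τ 55 0 = I.gap S := by rw [hfr 55 (by decide), e55]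
    have hout : I.output τ = S := by rw [hS]; unfold Instance.output; rw [I9]
    have h60 : τ 60 0 < 2 ^ τ 10 2 := by
      rcases Ibest with h | ⟨u, -, h, -⟩
      · rw [h.2]; exact Lτ.one_lt
      · rw [h]; exact Lτ.nodeCost_lt u
    obtain ⟨c9, hc⟩ := exec_candidateBody Lτ ⟨i, hi⟩ h56 h60
    rw [hout, t55] at hc
    have hgi : I.gap S - I.gap (insert ⟨i, hi⟩ S) = gain ⟨i, hi⟩ := rfl
    rw [hgi] at hc
    set τ' := candidateBody.exec τ with hτ'
    have p : ∀ a, a ≠ 56 → put τ' 56 0 (i + 1) a = τ' a := fun a ha => put_ne ha _ _ _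
    rw [p 9 (by decide), p 59 (by decide), p 60 (by decide), p 62 (by decide)]
    refine ⟨by rw [c9, I9], fun w hw => ?_, ?_⟩
    · rcases hc with ⟨d1, d2, d3, d4⟩ | ⟨d1, d2, d3, d4⟩
      · rw [d2, d3]
        by_cases hwi : (w : ℕ) = i
        · obtain rfl : w = ⟨i, hi⟩ := Fin.ext hwi
          exact le_rfl
        · have hw' := Iall w (by omega)
          rcases Ibest with ⟨b1, b2⟩ | ⟨u, b1, b2, b3, b4⟩
          · rw [b1, b2, one_mul, mul_zero, Nat.le_zero] at hw'
            rw [hw', mul_zero]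
            exact Nat.zero_le _
          · -- the order of the quotients is transitive
            rw [b2, b3] at d1 hw'
            refine Nat.le_of_mul_le_mul_right ?_ b4
            calc I.nodeCost ⟨i, hi⟩ * gain w * gain u
                = (I.nodeCost ⟨i, hi⟩ * gain u) * gain w := by ring
              _ ≤ (gain ⟨i, hi⟩ * I.nodeCost u) * gain w := Nat.mul_le_mul_right _ d1.le
              _ = (I.nodeCost u * gain w) * gain ⟨i, hi⟩ := by ring
              _ ≤ (I.nodeCost w * gain u) * gain ⟨i, hi⟩ := Nat.mul_le_mul_right _ hw'
              _ = I.nodeCost w * gain ⟨i, hi⟩ * gain u := by ring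
      · rw [d2, d3]
        by_cases hwi : (w : ℕ) = i
        · obtain rfl : w = ⟨i, hi⟩ := Fin.ext hwi
          rwa [mul_comm]
        · exact Iall w (by omega)
    · rcases hc with ⟨d1, d2, d3, d4⟩ | ⟨d1, d2, d3, d4⟩
      · exact Or.inr ⟨⟨i, hi⟩, d4, d3, d2, Nat.pos_of_ne_zero fun h0 => by
          rw [h0, zero_mul] at d1; omega⟩
      · rw [d2, d3, d4]
        exact Ibest

/-- The greedy algorithm, with as many rounds as there are nodes. -/
def greedy : Code := rep 54 10 0 greedyBody

/-- `T` is an arbitrary solution to compare with. Every round with positive gap adds a node, so the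
counted loop ends with gap `0`. -/
theorem exec_greedy {I : Instance} {σ : Memory} (hσ : Loaded I σ) (h0 : I.output σ = ∅)
    (T : Finset (Fin I.n)) (hT : I.gap T = 0) :
    I.gap (I.output (greedy.exec σ)) = 0 ∧
      (I.cost (I.output (greedy.exec σ)) : ℚ) ≤ I.cost T * harmonic (I.gap ∅) := by
  have huniv : I.gap Finset.univ = 0 := by
    have := I.gap_anti T Finset.univ (Finset.subset_univ T)
    omega
  have key := exec_rep (A := greedyBody) (c := 54) (b := 10) (k := 0) (σ := σ)
    (fun i τ => (I.gap (I.output τ) = 0 ∨ i ≤ (I.output τ).card) ∧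
      (I.cost (I.output τ) : ℚ) ≤
        I.cost T * (harmonic (I.gap ∅) - harmonic (I.gap (I.output τ)))) (by decide) ?_ ?_
  · rw [hσ.n] at key
    obtain ⟨h1, h2⟩ := key
    have h3 : I.gap (I.output (greedy.exec σ)) = 0 := by
      rcases h1 with h1 | h1
      · exact h1
      · have : I.output (greedy.exec σ) = Finset.univ := by
          rw [← Finset.card_eq_iff_eq_univ, Fintype.card_fin]
          exact le_antisymm (by simpa using Finset.card_le_univ (I.output (greedy.exec σ))) h1
        rw [this, huniv]
    refine ⟨h3, ?_⟩
    change (I.cost (I.output (greedy.exec σ)) : ℚ) ≤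
      I.cost T * (harmonic (I.gap ∅) - harmonic (I.gap (I.output (greedy.exec σ)))) at h2
    rwa [h3, harmonic_zero, sub_zero] at h2
  · have : I.output (put σ 54 0 0) = ∅ := by
      rw [← h0]; unfold Instance.output; rw [put_ne (by decide)]
    rw [this]
    simp [Instance.cost]
  · rintro i τ hi h54 hfr ⟨h1, h2⟩
    have Lτ : Loaded I τ := hσ.frame _ hfr (by decide)
    have hout : I.output (put (greedyBody.exec τ) 54 0 (i + 1)) =
        I.output (greedyBody.exec τ) := by
      unfold Instance.output; rw [put_ne (by decide)]
    rw [hout]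
    rcases exec_greedyBody Lτ with ⟨g1, g2⟩ | ⟨u, g1, g2, g3⟩
    · rw [g1]
      refine ⟨Or.inl ?_, h2⟩
      -- no node has a positive gain, so neither has the set of all nodes
      have := gap_sub_le_sum I.gap_anti I.gap_supermodular (I.output τ) Finset.univ
      rw [Finset.union_eq_right.2 (Finset.subset_univ _), huniv, zero_add,
        Finset.sum_eq_zero fun w _ => Nat.sub_eq_zero_of_le (g2 w)] at this
      omega
    · rw [g1]
      constructor
      · rcases h1 with h1 | h1
        · omega
        · right
          rw [Finset.card_insert_of_notMem]
          · omega
          · intro hu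
            rw [Finset.insert_eq_of_mem hu] at g2
            omega
      · exact greedy_step I.gap_anti I.gap_supermodular I.nodeCost (I.output τ) T u g3 hT g2 h2

/-! ### The whole program -/

/-- Compute the total edge cost, the loop counts except for cell `2`, and in variable `63` a number
that exceeds all demands and node costs. -/
def prelude : Code :=
  assign 63 (const 1) ;;
  rep 64 0 0 (assign 63 (var 63 + (get 4 (var 64) + get 5 (var 64)))) ;;
  assign 12 (const 0) ;; rep 65 0 1 (assign 12 (var 12 + get 3 (var 65))) ;;
  set 10 (const 0) (get 0 (const 0)) ;; set 10 (const 1) (get 0 (const 1)) ;;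
  set 10 (const 3) (get 0 (const 0) + get 0 (const 0) + const 1) ;;
  set 10 (const 4) (get 0 (const 1) + get 0 (const 1) + const 1) ;;
  set 10 (const 6) (get 0 (const 1) + get 0 (const 1) + get 0 (const 0) + get 0 (const 0)) ;;
  set 10 (const 5) (get 10 (const 6) + get 10 (const 6))

theorem exec_sumLoop {σ : Memory} {s c k l : ℕ} (x : Term) (f : Fin l → ℕ) (hk : σ 0 k = l)
    (hc : c ≠ s)
    (hx : ∀ (τ : Memory) (i : Fin l), τ c 0 = i → (∀ a, a ≠ s → a ≠ c → τ a = σ a) →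
      x.eval τ = f i) :
    (rep c 0 k (assign s (var s + x))).exec σ s 0 = σ s 0 + ∑ i, f i := by
  have key := exec_rep (A := assign s (var s + x)) (c := c) (b := 0) (k := k) (σ := σ)
    (fun i τ => τ s 0 = σ s 0 + ∑ j ∈ Finset.range i, toArray f j) (by simpa [writes, assign])
    (by simp [put_apply, hc.symm]) ?_
  · rw [key, hk, Finset.sum_range]
    simp only [toArray_val]
  · intro i τ hi h1 hfr hI
    rw [hk] at hi
    have := hx τ ⟨i, hi⟩ h1 (fun a h2 h3 => hfr a (by simp [writes, assign, h2, h3]))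
    rw [put_ne hc.symm, exec_assign, put_apply, if_pos ⟨rfl, rfl⟩, eval_add, eval_var, this, hI,
      Finset.sum_range_succ, toArray_of_lt f hi]
    ring

theorem exec_prelude (I : Instance) :
    let σ := prelude.exec I.input
    (∀ a, a ∉ prelude.writes → σ a = I.input a) ∧
      σ 63 0 = 1 + ∑ v, (I.nodeCost v + I.demand v) ∧ σ 12 0 = I.totalCost ∧
      σ 10 0 = I.n ∧ σ 10 1 = I.m ∧ σ 10 3 = I.n + I.n + 1 ∧ σ 10 4 = 2 * I.m + 1 ∧
      σ 10 5 = (I.m + I.m + I.n + I.n) + (I.m + I.m + I.n + I.n) ∧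
      σ 10 6 = I.m + I.m + I.n + I.n ∧ ∀ k, k ∉ [0, 1, 3, 4, 5, 6] → σ 10 k = 0 := by
  intro σ
  refine ⟨fun a ha => exec_frame _ ha _, ?_⟩
  have n0 : I.input 0 0 = I.n := rfl
  have m0 : I.input 0 1 = I.m := rfl
  have hσ : σ = prelude.exec I.input := rfl
  simp only [prelude, exec_seq] at hσ
  have s1 := exec_sumLoop (σ := (assign 63 (const 1)).exec I.input) (s := 63) (c := 64) (k := 0)
    (get 4 (var 64) + get 5 (var 64)) (fun v : Fin I.n => I.nodeCost v + I.demand v)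
    (by rw [exec_assign, put_ne (by decide), n0]) (by decide)
    (fun τ i h1 h2 => by
      rw [eval_add, eval_get, eval_get, eval_var, h1, h2 4 (by decide) (by decide),
        h2 5 (by decide) (by decide), exec_assign, put_ne (by decide), put_ne (by decide)]
      exact congrArg₂ _ (toArray_val _ i) (toArray_val _ i))
  set σ₁ := (rep 64 0 0 (assign 63 (var 63 + (get 4 (var 64) + get 5 (var 64))))).exec
    ((assign 63 (const 1)).exec I.input) with hσ₁
  have f₁ : ∀ a, a ≠ 63 → a ≠ 64 → σ₁ a = I.input a := fun a h1 h2 => by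
    rw [hσ₁, exec_frame _ (by simp [writes, assign, h1, h2]), exec_assign, put_ne h1]
  have s2 := exec_sumLoop (σ := (assign 12 (const 0)).exec σ₁) (s := 12) (c := 65) (k := 1)
    (get 3 (var 65)) I.edgeCost
    (by rw [exec_assign, put_ne (by decide), f₁ 0 (by decide) (by decide), m0]) (by decide)
    (fun τ i h1 h2 => by
      rw [eval_get, eval_var, h1, h2 3 (by decide) (by decide), exec_assign, put_ne (by decide),
        f₁ 3 (by decide) (by decide)]
      exact toArray_val _ i)
  set σ₂ := (rep 65 0 1 (assign 12 (var 12 + get 3 (var 65)))).exec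
    ((assign 12 (const 0)).exec σ₁) with hσ₂
  have f₂ : ∀ a, a ≠ 12 → a ≠ 65 → σ₂ a = σ₁ a := fun a h1 h2 => by
    rw [hσ₂, exec_frame _ (by simp [writes, assign, h1, h2]), exec_assign, put_ne h1]
  have c63 : σ₂ 63 0 = 1 + ∑ v, (I.nodeCost v + I.demand v) := by
    rw [f₂ 63 (by decide) (by decide), s1]
    rfl
  have c12 : σ₂ 12 0 = I.totalCost := by
    rw [s2, exec_assign, put_apply, if_pos ⟨rfl, rfl⟩, eval_const, zero_add]
    rfl
  have c0 : σ₂ 0 = I.input 0 := by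
    rw [f₂ 0 (by decide) (by decide), f₁ 0 (by decide) (by decide)]
  have c10 : ∀ k, σ₂ 10 k = 0 := fun k => by
    rw [f₂ 10 (by decide) (by decide), f₁ 10 (by decide) (by decide)]
    rfl
  rw [hσ]
  simp only [exec_set, eval_get, eval_add, eval_const]
  refine ⟨?_, ?_, ?_, ?_, ?_, ?_, ?_, ?_, ?_⟩
  · simp [put_apply, c63]
  · simp [put_apply, c12]
  · simp [put_apply, c0, n0]
  · simp [put_apply, c0, m0]
  · simp [put_apply, c0, n0]
  · simp [put_apply, c0, m0]; omega
  · simp [put_apply, c0, n0, m0]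
  · simp [put_apply, c0, n0, m0]
  · intro k hk
    simp only [List.mem_cons, List.not_mem_nil, or_false, not_or] at hk
    simp [put_apply, c10, hk]

/-- Count the binary digits of variable `63` in cell `2` of array `10`. -/
def countDigits : Program :=
  .loop (var 63) (.seq (.set 63 (const 0) (half (var 63)))
    (.set 10 (const 2) (get 10 (const 2) + const 1)))

/-- An input below `2 ^ s` takes at most `s` passes, of `14` steps each. -/
theorem runs_countDigits (s : ℕ) (σ : Memory) (h : σ 63 0 < 2 ^ s) :
    ∃ t ≤ 3 + s * 14, ∃ τ, Runs countDigits σ t τ ∧ (∀ a, a ≠ 63 → a ≠ 10 → τ a = σ a) ∧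
      (∀ k, k ≠ 2 → τ 10 k = σ 10 k) ∧ ∃ L ≤ s, τ 10 2 = σ 10 2 + L ∧ σ 63 0 < 2 ^ L := by
  induction s generalizing σ with
  | zero =>
    have h0 : σ 63 0 = 0 := by simpa using h
    exact ⟨_, by decide, σ, Runs.loop_done h0, fun _ _ _ => rfl, fun _ _ => rfl, 0, le_rfl, rfl,
      by simpa using h⟩
  | succ s ih =>
    by_cases h0 : σ 63 0 = 0
    · exact ⟨3, by omega, σ, Runs.loop_done h0, fun _ _ _ => rfl, fun _ _ => rfl, 0,
        Nat.zero_le _, rfl, by simp [h0]⟩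
    · set σ' := put (put σ 63 0 (σ 63 0 / 2)) 10 2 (σ 10 2 + 1) with hσ'
      have e63 : σ' 63 0 = σ 63 0 / 2 := by simp [hσ', put_apply]
      have e10 : σ' 10 2 = σ 10 2 + 1 := by simp [hσ', put_apply]
      obtain ⟨t, ht, τ, hr, h1, h2, L, hL, h3, h4⟩ := ih σ' (by rw [e63]; rw [pow_succ] at h; omega)
      refine ⟨_, ?_, τ, Runs.loop_step h0 (Runs.seq (Runs.set _ _ _ _) (Runs.set _ _ _ _)) hr,
        fun a ha hb => ?_, fun k hk => ?_, L + 1, by omega, by rw [h3, e10]; ring, ?_⟩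
      · have e : (var 63).steps + 1 + ((const 0).steps + (half (var 63)).steps + 1 +
            ((const 2).steps + (get 10 (const 2) + const 1).steps + 1)) + t = 14 + t := rfl
        omega
      · rw [h1 a ha hb, hσ', put_ne hb, put_ne ha]
      · rw [h2 k hk, hσ', put_apply, if_neg (by simp [hk]), put_ne (by decide)]
      · rw [e63] at h4
        rw [pow_succ]
        omega

theorem Instance.n_add_m_le_size (I : Instance) : I.n + I.m ≤ I.size := by
  unfold size
  omega

theorem Instance.one_add_sum_lt (I : Instance) :
    1 + ∑ v, (I.nodeCost v + I.demand v) < 2 ^ (I.size + 1) := by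
  have key : ∀ s : Finset (Fin I.n), 1 + ∑ v ∈ s, (I.nodeCost v + I.demand v) ≤
      2 ^ ∑ v ∈ s, ((I.nodeCost v).size + (I.demand v).size) := by
    intro s
    induction s using Finset.induction with
    | empty => simp
    | insert v s hv ih =>
      rw [Finset.sum_insert hv, Finset.sum_insert hv, pow_add, pow_add]
      have h1 : I.nodeCost v + 1 ≤ 2 ^ (I.nodeCost v).size := Nat.lt_size_self _
      have h2 : I.demand v + 1 ≤ 2 ^ (I.demand v).size := Nat.lt_size_self _
      have h3 := Nat.mul_le_mul (Nat.mul_le_mul h1 h2) ih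
      refine le_trans ?_ h3
      nlinarith [Nat.zero_le (I.nodeCost v * I.demand v),
        Nat.zero_le ((I.nodeCost v + I.demand v + I.nodeCost v * I.demand v) *
          ∑ w ∈ s, (I.nodeCost w + I.demand w))]
  refine (key Finset.univ).trans_lt (Nat.pow_lt_pow_right one_lt_two (Nat.lt_succ_of_le ?_))
  have : ∑ v, ((I.nodeCost v).size + (I.demand v).size) ≤
      ∑ v, (Nat.size (I.nodeCost v) + Nat.size (I.demand v) + Nat.size (I.q v)
        + Nat.size (I.p v) + Nat.size (I.bound v)) := Finset.sum_le_sum fun v _ => by omega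
  unfold Instance.size
  omega

/-- The whole algorithm. -/
def algorithm : Program := .seq prelude.compile (.seq countDigits greedy.compile)

/-- A bound on the running time of `algorithm`. -/
noncomputable def algorithmTime : Polynomial ℕ :=
  prelude.timePoly.comp (4 * Polynomial.X + 1) +
    (17 + 14 * Polynomial.X + greedy.timePoly.comp (4 * Polynomial.X + 1))

/-- After the preparation the instance is loaded, and the greedy algorithm starts with the empty
set. -/
theorem runs_algorithm (I : Instance) : ∃ t ≤ algorithmTime.eval I.size, ∃ σ,
    Runs algorithm I.input t (greedy.exec σ) ∧ Loaded I σ ∧ I.output σ = ∅ := by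
  have hs := I.n_add_m_le_size
  obtain ⟨p1, p63, p12, q0, q1, q3, q4, q5, q6, qz⟩ := exec_prelude I
  obtain ⟨t₁, ht₁, hr₁⟩ := runs_compile (b := 0) (B := 4 * I.size + 1) prelude (by decide) I.input
    (fun k => by
      change toArray ![I.n, I.m, if I.directed then 1 else 0] k ≤ _
      unfold toArray
      by_cases hk : k < 3
      · rw [dif_pos hk]
        interval_cases k
        · change I.n ≤ _
          omega
        · change I.m ≤ _
          omega
        · change (if I.directed then 1 else 0) ≤ _
          split_ifs <;> omega
      · rw [dif_neg hk]
        exact Nat.zero_le _)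
  set σ₁ := prelude.exec I.input with hσ₁
  obtain ⟨t₂, ht₂, σ, hr₂, r1, r2, L, hL, r3, r4⟩ := runs_countDigits (I.size + 1) σ₁
    (by rw [p63]; exact I.one_add_sum_lt)
  rw [qz 2 (by decide), zero_add] at r3
  rw [p63] at r4
  have hin : ∀ a, a ∉ prelude.writes → a ≠ 63 → a ≠ 10 → σ a = I.input a := fun a h1 h2 h3 => by
    rw [r1 a h2 h3, p1 a h1]
  have hle : ∀ v, I.nodeCost v + I.demand v ≤ ∑ v, (I.nodeCost v + I.demand v) := fun v =>
    Finset.single_le_sum (f := fun v => I.nodeCost v + I.demand v) (fun _ _ => Nat.zero_le _)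
      (Finset.mem_univ v)
  obtain ⟨t₃, ht₃, hr₃⟩ := runs_compile (b := 10) (B := 4 * I.size + 1) greedy (by decide) σ
    (fun k => by
      by_cases h2 : k = 2
      · subst h2; rw [r3]; omega
      · rw [r2 k h2]
        by_cases hk : k ∈ [0, 1, 3, 4, 5, 6]
        · simp only [List.mem_cons, List.not_mem_nil, or_false] at hk
          rcases hk with rfl | rfl | rfl | rfl | rfl | rfl <;> omega
        · rw [qz k hk]; omega)
  refine ⟨t₁ + (t₂ + t₃), ?_, σ, Runs.seq hr₁ (Runs.seq hr₂ hr₃), ?_, ?_⟩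
  · simp only [algorithmTime, Polynomial.eval_add, Polynomial.eval_comp, Polynomial.eval_mul,
      Polynomial.eval_X, Polynomial.eval_ofNat, Polynomial.eval_one]
    omega
  · refine ⟨hin 0 (by decide) (by decide) (by decide), hin 1 (by decide) (by decide) (by decide),
      hin 2 (by decide) (by decide) (by decide), hin 3 (by decide) (by decide) (by decide),
      hin 4 (by decide) (by decide) (by decide), hin 5 (by decide) (by decide) (by decide),
      hin 6 (by decide) (by decide) (by decide), hin 7 (by decide) (by decide) (by decide),
      hin 8 (by decide) (by decide) (by decide), by rw [r2 0 (by decide), q0],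
      by rw [r2 1 (by decide), q1], fun v => ?_, fun v => ?_, ?_, by rw [r2 3 (by decide), q3],
      by rw [r2 4 (by decide), q4], by rw [r2 5 (by decide), q5], by rw [r2 6 (by decide), q6],
      by rw [r1 12 (by decide) (by decide), p12]⟩
    · have := hle v
      rw [r3]
      omega
    · have := hle v
      rw [r3]
      omega
    · rw [r3]
      omega
  · unfold Instance.output
    rw [hin 9 (by decide) (by decide) (by decide)]
    simp [Instance.input]

/-- A memory in which the instance is loaded witnesses strong duality for its output set. -/
theorem Loaded.feasible_of_gap_eq_zero {I : Instance} {σ : Memory} (hσ : Loaded I σ)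
    (h : I.gap (I.output σ) = 0) : I.Feasible (I.output σ) := by
  refine I.feasible_of_gap_eq_zero (fun v => ?_) h
  have hL : Loaded I (put σ 13 0 v) := hσ.congr fun a ha => put_ne (by
    rintro rfl
    exact absurd ha (by decide)) _ _ _
  obtain ⟨x, π, F, rem, hc⟩ := exec_minCostFlow hL v (by simp [put_apply])
  have hout : I.output (put σ 13 0 v) = I.output σ := by
    unfold Instance.output
    rw [put_ne (by decide)]
  rw [hout] at hc
  exact ⟨x, π, F, rem, _, hc⟩

end SSL

theorem theorem5 :
    SSL.AdmitsApproximationRatio fun I : SSL.Instance =>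
      harmonic (∑ v, I.demand v) + harmonic (∑ e, I.edgeCost e) := by
  refine ⟨SSL.algorithm, SSL.algorithmTime, fun I => ?_⟩
  obtain ⟨t, ht, σ, hr, hσ, h0⟩ := SSL.runs_algorithm I
  refine ⟨t, _, hr, ht, fun ⟨S, hS⟩ => ⟨?_, fun T hT => ?_⟩⟩
  · exact (hσ.exec SSL.greedy (by decide)).feasible_of_gap_eq_zero
      (SSL.exec_greedy hσ h0 S (I.gap_eq_zero_of_feasible hS)).1
  · rw [mul_comm]
    refine (SSL.exec_greedy hσ h0 T (I.gap_eq_zero_of_feasible hT)).2.trans ?_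
    exact mul_le_mul_of_nonneg_left ((SSL.harmonic_mono (I.gap_le ∅)).trans
      (SSL.harmonic_mul_succ_le _ _)) (Nat.cast_nonneg _)
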